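/- Conventions. Let $K$ be an evenly graded commutative ring containing $\mathbb{Q}$, and let $V$ be a free graded $K$-module with homogeneous basis $(v_i)_{i\in I}$. Gradings are cohomological, $(\Sigma X)^n=X^{n+1}$, and $V^*=\operatorname{Hom}_K(V,K)$ is the graded dual. Let $t_i$, of degree $1-|v_i|$, be the topological basis of $(\Sigma V)^*$ dual to $(\Sigma v_i)$; let $K\langle\langle t\rangle\rangle$ be the algebra of noncommutative formal power series in the $t_i$ with the inverse limit topology, and $\widehat L\subset K\langle\langle t\rangle\rangle$ the pro-free graded Lie algebra, i.e. the closed span of the Lie monomials in the $t_i$. A $C_\infty$-structure on $V$ is a continuous derivation $m:\widehat L\to\widehat L$ of degree $1$ with $m^2=0$. It is unital, with unit $v_e$, if $|v_e|=0$ and, with $\tau=t_e$, one has $m(\tau)=A+[\tau,\tau]-\tau^2$ and $m(t_i)=B_i+[\tau,t_i]$ for $i\neq e$, where the power series $A$, $B_i$ do not involve $\tau$. Let $\Omega$ be the differential envelope of $\widehat L$ (the pro-free graded Lie algebra on the letters $t_i$ and $dt_i$, where $dt_i$ has form degree $1$ and total degree $|t_i|+1$, with the differential $d:t_i\mapsto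 dt_i\mapsto 0$), and let $DR$ be the quotient of $\Omega\hat\otimes\Omega$ by the closed submodule generated by the relations $x\otimes y=(-1)^{|x||y|}y\otimes x$ and $x\otimes[y,z]=[x,y]\otimes z$. On $DR$ one has the differential $d$ and the Lie derivative $L_m$, induced by the derivation $t_i\mapsto m(t_i)$, $dt_i\mapsto -d(m(t_i))$ of $\Omega$. Let $DR^0$ be the part of $DR$ of form degree $0$ and $DR^1$ the suspension of the part of form degree $1$. The cyclic Harrison cohomology $HC^\bullet_{\mathrm{Harr}}(V)$ is the cohomology of $(\Sigma DR^0,L_m)$, the Harrison cohomology $H^\bullet_{\mathrm{Harr}}(V,V^*)$ is the cohomology of $(\Sigma DR^1,L_m)$, and $H^\bullet(V^*)$ is the cohomology of the complex $V^*$ with the differential dual to $\check m_1:V\to V$, $v_j\mapsto\sum_i a_{ij}v_i$, where $\sum_j a_{ij}t_j$ is the linear part of $m(t_i)$. Statement. Let $V$ be a unital $C_\infty$-algebra over $K$ with unit $v_e$. There is a long exact sequence $$\cdots\to H^{n-2}(V^*)\xrightarrow{S}HC^n_{\mathrm{Harr}}(V)\xrightarrow{I}H^n_{\mathrm{Harr}}(V,V^*)\xrightarrow{B}H^{n-1}(V^*)\xrightarrow{S}\cdots\qquad(n\in\mathbb{Z})$$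 in which the maps are as follows. (i) $I$ is induced by $d:DR^0\to DR^1$. (ii) Every cocycle of $\Sigma DR^1$ can be written as $\sum_i dt_i\otimes y_i$ with $y_i\in\widehat L$, and $B$ sends its class to the class of the functional $\varphi\in V^*$ for which $-\varphi(v_j)$ is the coefficient of the word $\tau t_j$ in $\sum_i[t_i,y_i]$. (iii) For every homogeneous cocycle $\varphi\in V^*$, put $w=\sum_i\varphi(v_i)t_i$. There are $\alpha=\sum_i dt_i\otimes y_i$ with $y_i\in\widehat L$ and $\sum_i[t_i,y_i]=m(w)$, and a cocycle $c$ of $\Sigma DR^0$ with $dc=L_m\alpha$ in $DR^1$; and $S[\varphi]=[c]$ for any such choice. -/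

import Mathlib

/-!
Coordinates.  A free graded module `V` over the evenly graded ring `K` is given by a basis
`v i` (`i : I`) with degrees `d i : ℤ`.  The dual topological basis `t i` of `(ΣV)^*` then has
degree `1 - d i`, and the completed tensor algebra of `(ΣV)^*` is the algebra `K⟪t⟫` of
noncommutative formal power series, that is, of all functions `List I → K` on words.  It carries
the product topology, `K` being discrete.  The same is used for other graded alphabets `A`.
-/

namespace CInf

noncomputable section

section Series

variable {K A : Type*} [CommRing K]

/-- The degree of a word in graded letters. -/
def wdeg (deg : A → ℤ) (w : List A) : ℤ := (w.map deg).sum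

open Classical in
/-- The letter `a`, as a power series. -/
def letter (K : Type*) [CommRing K] (a : A) : List A → K := fun w => if w = [a] then 1 else 0

/-- The (concatenation) product of noncommutative power series. -/
def mul (f g : List A → K) : List A → K := fun w =>
  ∑ k ∈ Finset.range (w.length + 1), f (w.take k) * g (w.drop k)

/-- The graded commutator `[f, g] = f g - (-1)^{|f||g|} g f`, extended bilinearly and continuously.
Since `K` is evenly graded, the parity of a monomial is the parity of its word. -/
def bracket (deg : A → ℤ) (f g : List A → K) : List A → K := fun w =>
  ∑ k ∈ Finset.range (w.length + 1),
    (f (w.take k) * g (w.drop k) -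
      (wdeg deg (w.take k) * wdeg deg (w.drop k)).negOnePow • (g (w.take k) * f (w.drop k)))

/-- The parity involution `f ↦ (-1)^{|f|} f`. -/
def parity (deg : A → ℤ) (f : List A → K) : List A → K := fun w => (wdeg deg w).negOnePow • f w

/-- The power series that are homogeneous of degree `n`. -/
def homog (𝒜 : ℤ → AddSubgroup K) (deg : A → ℤ) (n : ℤ) : AddSubgroup (List A → K) where
  carrier := {f | ∀ w, f w ∈ 𝒜 (n - wdeg deg w)}
  zero_mem' _ := zero_mem _
  add_mem' hf hg w := add_mem (hf w) (hg w)
  neg_mem' hf w := neg_mem (hf w)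

/-- Lie monomials in the letters. -/
inductive LieMonomial (K : Type*) [CommRing K] (deg : A → ℤ) : (List A → K) → Prop
  | letter (a : A) : LieMonomial K deg (letter K a)
  | bracket {f g : List A → K} (hf : LieMonomial K deg f) (hg : LieMonomial K deg g) :
      LieMonomial K deg (bracket deg f g)

open Classical in
/-- For a family `δ a` of power series that depends continuously on `a`, the finite set of those
`a` for which the word `v` occurs in `δ a`. -/
def lettersAt (δ : A → List A → K) (v : List A) : Finset A :=
  if h : {a | δ a v ≠ 0}.Finite then h.toFinset else ∅

/-- The continuous derivation of odd degree of the algebra of power series with `a ↦ δ a` on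
letters: it sends a word `a₁ ⋯ aₙ` to `∑ j, (-1)^{|a₁| + ⋯ + |a_{j-1}|} a₁ ⋯ (δ a_j) ⋯ aₙ`.  The
coefficient of `w` in the image of `f` is a sum over all factorisations `w = u v u'` and all
letters `a`, of `± f (u a u') * δ a v`. -/
def oddDer (deg : A → ℤ) (δ : A → List A → K) : (List A → K) →ₗ[K] (List A → K) where
  toFun f w := ∑ k ∈ Finset.range (w.length + 1), ∑ l ∈ Finset.range (w.length - k + 1),
    ∑ a ∈ lettersAt δ ((w.drop k).take l), (wdeg deg (w.take k)).negOnePow •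
      (f (w.take k ++ a :: (w.drop k).drop l) * δ a ((w.drop k).take l))
  map_add' f g := by
    funext w
    simp only [Pi.add_apply, add_mul, smul_add, Finset.sum_add_distrib]
  map_smul' c f := by
    funext w
    simp only [Pi.smul_apply, smul_eq_mul, RingHom.id_apply, Finset.mul_sum, mul_assoc,
      mul_smul_comm]

/-- The elementary tensor of two series, in the completed tensor square of the algebra of power
series, which is the module of all functions on pairs of words. -/
def tmul (f g : List A → K) : List A × List A → K := fun p => f p.1 * g p.2

/-- The signed interchange `x ⊗ y ↦ (-1)^{|x||y|} y ⊗ x`. -/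
def swap (deg : A → ℤ) (F : List A × List A → K) : List A × List A → K := fun p =>
  (wdeg deg p.1 * wdeg deg p.2).negOnePow • F (p.2, p.1)

/-- The operator `x ⊗ y ↦ D x ⊗ y + (-1)^{|x|} x ⊗ D y` on the completed tensor square, for an odd
operator `D`. -/
def tensorOdd (deg : A → ℤ) (D : (List A → K) →ₗ[K] (List A → K)) :
    (List A × List A → K) →ₗ[K] (List A × List A → K) where
  toFun F p := D (fun u => F (u, p.2)) p.1 +
    (wdeg deg p.1).negOnePow • D (fun v => F (p.1, v)) p.2
  map_add' F G := by
    funext p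
    have h1 : (fun u => (F + G) (u, p.2)) = (fun u => F (u, p.2)) + fun u => G (u, p.2) := rfl
    have h2 : (fun v => (F + G) (p.1, v)) = (fun v => F (p.1, v)) + fun v => G (p.1, v) := rfl
    rw [h1, h2, map_add, map_add]
    simp only [Pi.add_apply, smul_add]
    abel
  map_smul' c F := by
    funext p
    have h1 : (fun u => (c • F) (u, p.2)) = c • fun u => F (u, p.2) := rfl
    have h2 : (fun v => (c • F) (p.1, v)) = c • fun v => F (p.1, v) := rfl
    rw [h1, h2, map_smul, map_smul]
    simp only [Pi.smul_apply, smul_eq_mul, RingHom.id_apply, mul_add, mul_smul_comm]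

end Series

section Topology

variable {K A : Type*} [CommRing K] [TopologicalSpace K] [DiscreteTopology K]

/-- The pro-free graded Lie algebra on the letters: the closed span of the Lie monomials. -/
def freeLie (K : Type*) [CommRing K] [TopologicalSpace K] [DiscreteTopology K] (deg : A → ℤ) :
    Submodule K (List A → K) :=
  (Submodule.span K {f | LieMonomial K deg f}).topologicalClosure

theorem letter_mem (deg : A → ℤ) (a : A) : letter K a ∈ freeLie K deg :=
  Submodule.le_topologicalClosure _ (Submodule.subset_span (LieMonomial.letter a))

theorem bracket_mem {deg : A → ℤ} {f g : List A → K} (hf : f ∈ freeLie K deg)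
    (hg : g ∈ freeLie K deg) : bracket deg f g ∈ freeLie K deg := by
  have hadd1 : ∀ f f' g : List A → K, bracket deg (f + f') g = bracket deg f g + bracket deg f' g := by
    intro f f' g; funext w
    simp only [bracket, Pi.add_apply, add_mul, mul_add, smul_add, ← Finset.sum_add_distrib]
    exact Finset.sum_congr rfl fun k _ => by abel
  have hadd2 : ∀ f g g' : List A → K, bracket deg f (g + g') = bracket deg f g + bracket deg f g' := by
    intro f g g'; funext w
    simp only [bracket, Pi.add_apply, add_mul, mul_add, smul_add, ← Finset.sum_add_distrib]
    exact Finset.sum_congr rfl fun k _ => by abel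
  have hsm1 : ∀ (c : K) (f g : List A → K), bracket deg (c • f) g = c • bracket deg f g := by
    intro c f g; funext w
    simp only [bracket, Pi.smul_apply, smul_eq_mul, Finset.mul_sum]
    refine Finset.sum_congr rfl fun k _ => ?_
    rcases Int.units_eq_one_or
      (wdeg deg (w.take k) * wdeg deg (w.drop k)).negOnePow with h | h <;>
      simp only [h, Units.smul_def, Units.val_one, Units.val_neg, one_smul, neg_smul] <;> ring
  have hsm2 : ∀ (c : K) (f g : List A → K), bracket deg f (c • g) = c • bracket deg f g := by
    intro c f g; funext w
    simp only [bracket, Pi.smul_apply, smul_eq_mul, Finset.mul_sum]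
    refine Finset.sum_congr rfl fun k _ => ?_
    rcases Int.units_eq_one_or
      (wdeg deg (w.take k) * wdeg deg (w.drop k)).negOnePow with h | h <;>
      simp only [h, Units.smul_def, Units.val_one, Units.val_neg, one_smul, neg_smul] <;> ring
  have hz1 : ∀ g : List A → K, bracket deg 0 g = 0 := by
    intro g; funext w; simp [bracket]
  have hz2 : ∀ g : List A → K, bracket deg g 0 = 0 := by
    intro g; funext w; simp [bracket]
  have hc : Continuous (Function.uncurry fun f g : List A → K => bracket deg f g) := by
    refine continuous_pi fun w => ?_
    change Continuous fun p : (List A → K) × (List A → K) =>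
      ∑ k ∈ Finset.range (w.length + 1), (p.1 (w.take k) * p.2 (w.drop k) -
        (wdeg deg (w.take k) * wdeg deg (w.drop k)).negOnePow • (p.2 (w.take k) * p.1 (w.drop k)))
    refine continuous_finsetSum _ fun k _ => ?_
    have c1 : ∀ u : List A, Continuous fun p : (List A → K) × (List A → K) => p.1 u := fun u =>
      (continuous_apply u).comp continuous_fst
    have c2 : ∀ u : List A, Continuous fun p : (List A → K) × (List A → K) => p.2 u := fun u =>
      (continuous_apply u).comp continuous_snd
    exact ((c1 _).mul (c2 _)).sub
      ((continuous_of_discreteTopology (f := fun x : K =>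
        (wdeg deg (w.take k) * wdeg deg (w.drop k)).negOnePow • x)).comp ((c2 _).mul (c1 _)))
  refine map_mem_closure₂ hc hf hg fun f hf g hg => ?_
  refine Submodule.span_induction₂ (p := fun f g _ _ => bracket deg f g ∈
    Submodule.span K {f | LieMonomial K deg f}) ?_ ?_ ?_ ?_ ?_ ?_ ?_ hf hg
  · exact fun x y hx hy => Submodule.subset_span (LieMonomial.bracket hx hy)
  · intro y _; rw [hz1]; exact zero_mem _
  · intro y _; rw [hz2]; exact zero_mem _
  · intro x y z _ _ _ h1 h2; rw [hadd1]; exact add_mem h1 h2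
  · intro x y z _ _ _ h1 h2; rw [hadd2]; exact add_mem h1 h2
  · intro r x y _ _ h; rw [hsm1]; exact Submodule.smul_mem _ _ h
  · intro r x y _ _ h; rw [hsm2]; exact Submodule.smul_mem _ _ h

/-- The Lie bracket of the pro-free Lie algebra. -/
def lieBracket {deg : A → ℤ} (f g : freeLie K deg) : freeLie K deg :=
  ⟨bracket deg f g, bracket_mem f.2 g.2⟩

/-- The letter `a`, in the pro-free Lie algebra. -/
def gen (deg : A → ℤ) (a : A) : freeLie K deg := ⟨letter K a, letter_mem deg a⟩

/-- The completed tensor square of the pro-free Lie algebra. -/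
def lieTensor (K : Type*) [CommRing K] [TopologicalSpace K] [DiscreteTopology K] (deg : A → ℤ) :
    Submodule K (List A × List A → K) :=
  (Submodule.span K {F | ∃ x ∈ freeLie K deg, ∃ y ∈ freeLie K deg,
    F = tmul x y}).topologicalClosure

/-- The closed submodule of the completed tensor square that is generated by the relations
`x ⊗ y = (-1)^{|x||y|} y ⊗ x` and `x ⊗ [y, z] = [x, y] ⊗ z`. -/
def lieRel (K : Type*) [CommRing K] [TopologicalSpace K] [DiscreteTopology K] (deg : A → ℤ) :
    Submodule K (List A × List A → K) :=
  (Submodule.span K ({F | ∃ x ∈ freeLie K deg, ∃ y ∈ freeLie K deg,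
      F = tmul x y - swap deg (tmul x y)} ∪
    {F | ∃ x ∈ freeLie K deg, ∃ y ∈ freeLie K deg, ∃ z ∈ freeLie K deg,
      F = tmul x (bracket deg y z) - tmul (bracket deg x y) z})).topologicalClosure

end Topology

/-! ### `C_∞`-structures -/

/-- The degree of `t i`, for a basis element `v i` of degree `d i`. -/
def tdeg {I : Type*} (d : I → ℤ) (i : I) : ℤ := 1 - d i

/-- A `C_∞`-structure on the free graded `K`-module with a basis of degrees `d i`: a vector field
(continuous derivation) `m` of degree one on the pro-free Lie algebra on the `t i`, with
`m² = 0`. -/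
structure CInftyStructure {K I : Type*} [CommRing K] [TopologicalSpace K] [DiscreteTopology K]
    (𝒜 : ℤ → AddSubgroup K) (d : I → ℤ) where
  /-- the vector field -/
  m : freeLie K (tdeg d) →L[K] freeLie K (tdeg d)
  leibniz : ∀ x y : freeLie K (tdeg d), (m (lieBracket x y) : List I → K) =
    bracket (tdeg d) (m x) y + bracket (tdeg d) (parity (tdeg d) x) (m y)
  degree_one : ∀ (n : ℤ) (x : freeLie K (tdeg d)),
    (x : List I → K) ∈ homog 𝒜 (tdeg d) n → (m x : List I → K) ∈ homog 𝒜 (tdeg d) (n + 1)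
  sq_zero : ∀ x, m (m x) = 0

section Complexes

variable {K I V : Type*} [CommRing K] [TopologicalSpace K] [DiscreteTopology K]
  {𝒜 : ℤ → AddSubgroup K} {d : I → ℤ}

/-- The power series `m (t i)`. -/
def CInftyStructure.onGen (M : CInftyStructure 𝒜 d) (i : I) : List I → K := M.m (gen (tdeg d) i)

open Classical in
/-- The basis element `v e` is a unit: it has degree `0` and, with `τ = t e`, the vector field has
the form `A(t) ∂_τ + ∑_{i ≠ e} B_i(t) ∂_{t_i} + ad τ - τ² ∂_τ`, where the power series `A`, `B_i` do
not involve `τ`. -/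
def CInftyStructure.IsUnital (M : CInftyStructure 𝒜 d) (e : I) : Prop :=
  d e = 0 ∧ ∀ (i : I) (w : List I), e ∈ w →
    (M.onGen i - bracket (tdeg d) (letter K e) (letter K i) +
      if i = e then mul (letter K e) (letter K e) else 0) w = 0

/-! #### Differential forms

The differential envelope of the pro-free Lie algebra on the letters `t i` is the pro-free Lie
algebra on the letters `t i` (`Sum.inl i`) and `dt i` (`Sum.inr i`). -/

/-- The total degrees of `t i` and `dt i`. -/
def fdeg (d : I → ℤ) : I ⊕ I → ℤ := Sum.elim (fun i => tdeg d i) (fun i => tdeg d i + 1)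

/-- The number of letters `dt i` in a word. -/
def formDeg (w : List (I ⊕ I)) : ℕ := w.countP Sum.isRight

/-- The inclusion of the power series in the `t i` into those in the `t i` and `dt i`. -/
def incl (f : List I → K) : List (I ⊕ I) → K := fun w =>
  if formDeg w = 0 then f (w.filterMap Sum.getLeft?) else 0

/-- The de Rham differential on forms: `t i ↦ dt i`, `dt i ↦ 0`. -/
def dForm (K : Type*) [CommRing K] (d : I → ℤ) :
    (List (I ⊕ I) → K) →ₗ[K] (List (I ⊕ I) → K) :=
  oddDer (fdeg d) (Sum.elim (fun i => letter K (Sum.inr i)) fun _ => 0)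

/-- The Lie derivative along `m` on forms: `t i ↦ m (t i)`, `dt i ↦ - d (m (t i))`. -/
def CInftyStructure.lieDer (M : CInftyStructure 𝒜 d) :
    (List (I ⊕ I) → K) →ₗ[K] (List (I ⊕ I) → K) :=
  oddDer (fdeg d) (Sum.elim (fun i => incl (M.onGen i)) fun i => - dForm K d (incl (M.onGen i)))

/-- The de Rham differential of the Lie de Rham complex (before passing to the quotient). -/
def dDR (K : Type*) [CommRing K] (d : I → ℤ) :
    (List (I ⊕ I) × List (I ⊕ I) → K) →ₗ[K] (List (I ⊕ I) × List (I ⊕ I) → K) :=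
  tensorOdd (fdeg d) (dForm K d)

/-- The Lie derivative along `m` on the Lie de Rham complex (before passing to the quotient). -/
def CInftyStructure.lieDR (M : CInftyStructure 𝒜 d) :
    (List (I ⊕ I) × List (I ⊕ I) → K) →ₗ[K] (List (I ⊕ I) × List (I ⊕ I) → K) :=
  tensorOdd (fdeg d) M.lieDer

/-- The elements of the completed tensor square of form degree `p` and total degree `N`. -/
def bihomog (𝒜 : ℤ → AddSubgroup K) (d : I → ℤ) (p : ℕ) (N : ℤ) :
    AddSubgroup (List (I ⊕ I) × List (I ⊕ I) → K) where
  carrier := {F | ∀ u v, (formDeg u + formDeg v ≠ p → F (u, v) = 0) ∧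
    F (u, v) ∈ 𝒜 (N - wdeg (fdeg d) u - wdeg (fdeg d) v)}
  zero_mem' u v := ⟨fun _ => rfl, zero_mem _⟩
  add_mem' hF hG u v := ⟨fun h => by
    rw [Pi.add_apply, (hF u v).1 h, (hG u v).1 h, add_zero], add_mem (hF u v).2 (hG u v).2⟩
  neg_mem' hF u v := ⟨fun h => by rw [Pi.neg_apply, (hF u v).1 h, neg_zero],
    neg_mem (hF u v).2⟩

/-- Representatives of the elements of form degree `p` and total degree `N` of the Lie de Rham
complex, which is `Ω ⊗ Ω` modulo `lieRel`, where `Ω` is the differential envelope. -/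
def drCochains (𝒜 : ℤ → AddSubgroup K) (d : I → ℤ) (p : ℕ) (N : ℤ) :
    AddSubgroup (List (I ⊕ I) × List (I ⊕ I) → K) :=
  (lieTensor K (fdeg d)).toAddSubgroup ⊓ bihomog 𝒜 d p N

/-- Representatives of the cocycles for the Lie derivative. -/
def CInftyStructure.drCocycles (M : CInftyStructure 𝒜 d) (p : ℕ) (N : ℤ) :
    AddSubgroup (List (I ⊕ I) × List (I ⊕ I) → K) :=
  drCochains 𝒜 d p N ⊓ (lieRel K (fdeg d)).toAddSubgroup.comap M.lieDR.toAddMonoidHom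

/-- Representatives of the coboundaries for the Lie derivative (together with the relations). -/
def CInftyStructure.drCoboundaries (M : CInftyStructure 𝒜 d) (p : ℕ) (N : ℤ) :
    AddSubgroup (List (I ⊕ I) × List (I ⊕ I) → K) :=
  (drCochains 𝒜 d p (N - 1)).map M.lieDR.toAddMonoidHom ⊔ (lieRel K (fdeg d)).toAddSubgroup

/-- Cocycles of degree `n` of the cyclic Harrison complex `Σ DR⁰`: form degree `0`, and total
degree `n + 1` because of the suspension `(ΣX)ⁿ = Xⁿ⁺¹`. -/
def CInftyStructure.cyclicCocycles (M : CInftyStructure 𝒜 d) (n : ℤ) :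
    AddSubgroup (List (I ⊕ I) × List (I ⊕ I) → K) := M.drCocycles 0 (n + 1)

/-- Cyclic Harrison cohomology in degree `n`. -/
abbrev CInftyStructure.HCHarr (M : CInftyStructure 𝒜 d) (n : ℤ) : Type _ :=
  M.cyclicCocycles n ⧸ (M.drCoboundaries 0 (n + 1)).addSubgroupOf (M.cyclicCocycles n)

/-- Cocycles of degree `n` of the Harrison complex `Σ DR¹` with coefficients in `V^*`: form degree
`1`, and total degree `n + 2`, because `DR¹` is itself the suspension of the part of form degree
`1`. -/
def CInftyStructure.harrCocycles (M : CInftyStructure 𝒜 d) (n : ℤ) :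
    AddSubgroup (List (I ⊕ I) × List (I ⊕ I) → K) := M.drCocycles 1 (n + 2)

/-- Harrison cohomology with coefficients in `V^*`, in degree `n`. -/
abbrev CInftyStructure.HHarr (M : CInftyStructure 𝒜 d) (n : ℤ) : Type _ :=
  M.harrCocycles n ⧸ (M.drCoboundaries 1 (n + 2)).addSubgroupOf (M.harrCocycles n)

/-! #### The dual complex -/

variable [AddCommGroup V] [Module K V]

/-- The linear part `V → V` of the structure: if `m (t i) = ∑ j, a i j • t j + ⋯`, then
`v j ↦ ∑ i, a i j • v i`. -/
def CInftyStructure.linearPart (M : CInftyStructure 𝒜 d) (b : Module.Basis I K V) : V →ₗ[K] V :=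
  b.constr K fun j => ∑ i ∈ lettersAt M.onGen [j], M.onGen i [j] • b i

/-- The functionals on `V` that are homogeneous of degree `n`. -/
def dualCochains (𝒜 : ℤ → AddSubgroup K) (d : I → ℤ) (b : Module.Basis I K V) (n : ℤ) :
    AddSubgroup (Module.Dual K V) where
  carrier := {φ | ∀ i, φ (b i) ∈ 𝒜 (n + d i)}
  zero_mem' _ := zero_mem _
  add_mem' hf hg i := add_mem (hf i) (hg i)
  neg_mem' hf i := neg_mem (hf i)

/-- Cocycles of degree `n` of the dual complex `V^*`. -/
def CInftyStructure.dualCocycles (M : CInftyStructure 𝒜 d) (b : Module.Basis I K V) (n : ℤ) :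
    AddSubgroup (Module.Dual K V) :=
  dualCochains 𝒜 d b n ⊓ (M.linearPart b).dualMap.toAddMonoidHom.ker

/-- The cohomology of the dual complex `V^*` in degree `n`. -/
abbrev CInftyStructure.HDual (M : CInftyStructure 𝒜 d) (b : Module.Basis I K V) (n : ℤ) :
    Type _ :=
  M.dualCocycles b n ⧸ ((dualCochains 𝒜 d b (n - 1)).map
    (M.linearPart b).dualMap.toAddMonoidHom).addSubgroupOf (M.dualCocycles b n)

/-! #### The maps in the long exact sequence -/

/-- The one-form `∑ i, dt i ⊗ y i`. -/
def oneForm (y : I → freeLie K (tdeg d)) : List (I ⊕ I) × List (I ⊕ I) → K := fun p =>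
  ∑ᶠ i, tmul (letter K (Sum.inr i)) (incl (y i : List I → K)) p

/-- The power series `∑ i, [t i, y i]`. -/
def bracketSum (y : I → freeLie K (tdeg d)) : List I → K := fun w =>
  ∑ᶠ i, bracket (tdeg d) (letter K i) (y i) w

/-- The functional `φ = ∑ i, φ (v i) v i^*` represents the value of `B` on the one-form `x`: if
`x = ∑ i, dt i ⊗ y i` in `DR¹`, then `-φ` is the contraction with the unit, in the first slot, of
the quadratic part of `∑ i, [t i, y i]`. -/
def BRel (b : Module.Basis I K V) (e : I)
    (x : List (I ⊕ I) × List (I ⊕ I) → K) (φ : Module.Dual K V) : Prop :=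
  ∃ y : I → freeLie K (tdeg d), x - oneForm y ∈ lieRel K (fdeg d) ∧
    ∀ j, φ (b j) = - bracketSum y [e, j]

/-- The zero-form `c` represents the value of `S` on the functional `φ`: with
`w = ∑ i, φ (v i) t i`, there is a one-form `α = ∑ i, dt i ⊗ y i` with
`∑ i, [t i, y i] = m w` and `d c = L_m α` in `DR¹`. -/
def CInftyStructure.SRel (M : CInftyStructure 𝒜 d) (b : Module.Basis I K V)
    (φ : Module.Dual K V) (c : List (I ⊕ I) × List (I ⊕ I) → K) : Prop :=
  ∃ (w : freeLie K (tdeg d)) (y : I → freeLie K (tdeg d)),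
    (∀ u, (w : List I → K) u = ∑ᶠ i, φ (b i) * letter K i u) ∧
    bracketSum y = M.m w ∧
    dDR K d c - M.lieDR (oneForm y) ∈ lieRel K (fdeg d)

end Complexes

end

end CInf

/-!
The sequence is the long exact sequence of a four-term exact sequence of complexes
`0 → DR⁰ → DR¹ → L → V^* → 0`, up to shifts, in which `L` is the pro-free Lie algebra with the
differential `m`.

*One-forms.*  Modulo the relations of `DR`, all brackets of a one-form can be moved into the factor
without `dt`, so that the form becomes `∑ i, dt i ⊗ y i` with Lie series `y i`
(`mem_normalSub_of_formDeg_one`).  The series `y i` are unique: multiplying the two factors turns the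
relations into graded commutators, which do not change the sum of the words rotated so as to begin
with `dt i` (`coeff`, `coeff_eq_zero_of_mem_lieRel`).  Hence the moment map
`∑ i, dt i ⊗ y i ↦ ∑ i, [t i, y i]` from `DR¹` to `L` is well defined.  It anticommutes with the
differentials (`moment_lieDR`).

*Exactness of the four terms.*  The first map is `d`, the second is the moment, the third takes the
linear part.  Contraction with the Euler vector field shows that `d` is injective on `DR⁰`
(`mem_lieRel_of_dDR_mem`).  The composite of `d` with the moment is zero (`moment_dDR`).  If the
moment of `∑ i, dt i ⊗ y i` vanishes, then `∑ i, t i * y i` is cyclically invariant, and the same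
contraction, divided by the length of words, gives a primitive (`sub_dDR_primitive_mem`).  Finally,
the theorem of Dynkin, Specht and Wever writes every Lie series without linear part as
`∑ i, [t i, y i]` with Lie series `y i` (`bsum_lieTails`).

*Acyclicity.*  For a unital structure, `(L, m)` is acyclic (`exists_der_eq`).  To lowest order in the
number of letters other than `τ`, the unit axioms make `m` the commutator with `τ`, corrected by
`-τ²` on `τ`.  The derivative with respect to `τ`, in which each occurrence of `τ` is weighted by the
number of letters `≠ τ` to its right, preserves Lie series, and its graded commutator with `m` counts
the letters `≠ τ` up to terms with more such letters (`homotopyError_mem_offFil`).  Dividing by the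
count and iterating solves `m u = z` for closed `z` without pure powers of `τ`; the only power that
can occur in a closed Lie series is `τ²`, and it is removed by a multiple of `m τ`.

*The maps.*  By acyclicity, the series without linear part have the cohomology of `V^*`, shifted by
one: a closed series `z` without linear part is `m u`, and the linear part of `u` is the cocycle that
corresponds to it.  This cocycle need not be computed from `u`, since the coefficients of the words
`τ t j` in `m u` agree with the linear part of `u` up to a coboundary (`unitFunctional_der`); this is
the formula for `B`.  The map `S` is the connecting map: for a cocycle `φ` with series
`w = ∑ i, φ (v i) t i`, the series `m w` has no linear part and thus is the moment of some one-form
`α`; then `L_m α` has zero moment and is `d c` for a cocycle `c`.  In the characterisation of `S`, the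
form `α` need not be homogeneous; that the class of `c` is still determined follows by passing to
homogeneous components (`sub_mapS_mem`).
-/

namespace CInf

noncomputable section

set_option linter.unusedSectionVars false

/-! ### Sums over the factorisations of a word -/

section Split

variable {A B M : Type*} [AddCommMonoid M]

/-- The sum of `F u v` over all factorisations `w = u v` of a word. -/
def splitSum (w : List A) (F : List A → List A → M) : M :=
  ∑ k ∈ Finset.range (w.length + 1), F (w.take k) (w.drop k)

theorem splitSum_nil (F : List A → List A → M) : splitSum [] F = F [] [] := by
  simp [splitSum]

theorem splitSum_cons (c : A) (w : List A) (F : List A → List A → M) :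
    splitSum (c :: w) F = F [] (c :: w) + splitSum w fun u v => F (c :: u) v := by
  simp only [splitSum, List.length_cons]
  rw [Finset.sum_range_succ']
  simp [add_comm]

theorem splitSum_congr {w : List A} {F G : List A → List A → M}
    (h : ∀ u v, u ++ v = w → F u v = G u v) : splitSum w F = splitSum w G :=
  Finset.sum_congr rfl fun k _ => h _ _ (List.take_append_drop k w)

theorem splitSum_eq_zero {w : List A} {F : List A → List A → M}
    (h : ∀ u v, u ++ v = w → F u v = 0) : splitSum w F = 0 :=
  Finset.sum_eq_zero fun k _ => h _ _ (List.take_append_drop k w)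

theorem splitSum_add (w : List A) (F G : List A → List A → M) :
    splitSum w (fun u v => F u v + G u v) = splitSum w F + splitSum w G :=
  Finset.sum_add_distrib

theorem splitSum_const (w : List A) (x : M) :
    splitSum w (fun _ _ => x) = (w.length + 1) • x := by
  simp [splitSum]

theorem map_splitSum {N F : Type*} [AddCommMonoid N] [FunLike F M N] [AddMonoidHomClass F M N]
    (φ : F) (w : List A) (G : List A → List A → M) :
    φ (splitSum w G) = splitSum w fun u v => φ (G u v) := map_sum φ _ _

theorem neg_splitSum {G : Type*} [AddCommGroup G] (w : List A) (F : List A → List A → G) :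
    -splitSum w F = splitSum w fun u v => -F u v := (Finset.sum_neg_distrib _).symm

theorem mul_splitSum {R : Type*} [NonUnitalNonAssocSemiring R] (r : R) (w : List A)
    (G : List A → List A → R) : r * splitSum w G = splitSum w fun u v => r * G u v :=
  Finset.mul_sum ..

theorem splitSum_mul {R : Type*} [NonUnitalNonAssocSemiring R] (r : R) (w : List A)
    (G : List A → List A → R) : splitSum w G * r = splitSum w fun u v => G u v * r :=
  Finset.sum_mul ..

theorem smul_splitSum {R : Type*} [DistribSMul R M] (r : R) (w : List A)
    (G : List A → List A → M) : r • splitSum w G = splitSum w fun u v => r • G u v :=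
  Finset.smul_sum

theorem splitSum_map (g : A → B) (w : List A) (F : List B → List B → M) :
    splitSum (w.map g) F = splitSum w fun u v => F (u.map g) (v.map g) := by
  simp [splitSum, List.map_take, List.map_drop]

theorem splitSum_append_cons (p : List A) (x : A) (q : List A) (F : List A → List A → M) :
    splitSum (p ++ x :: q) F =
      splitSum p (fun a b => F a (b ++ x :: q)) + splitSum q fun a b => F (p ++ x :: a) b := by
  induction p generalizing F with
  | nil => simp [splitSum_cons, splitSum_nil]
  | cons c p ih => simp only [List.cons_append, splitSum_cons, ih, add_assoc]

/-- The factorisations of a word into three factors can be enumerated in two ways. -/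
theorem splitSum_assoc (w : List A) (H : List A → List A → List A → M) :
    splitSum w (fun p q => splitSum p fun a b => H a b q) =
      splitSum w fun a r => splitSum r fun b c => H a b c := by
  induction w generalizing H with
  | nil => simp [splitSum_nil]
  | cons c w ih => simp only [splitSum_cons, splitSum_nil, splitSum_add, ih, add_assoc]

theorem splitSum_eq_single_right {w : List A} {F : List A → List A → M}
    (h : ∀ u v, u ++ v = w → v ≠ [] → F u v = 0) : splitSum w F = F w [] := by
  rw [splitSum, Finset.sum_range_succ, Finset.sum_eq_zero, zero_add]
  · simp
  · intro k hk
    refine h _ _ (List.take_append_drop k w) fun h0 => ?_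
    have := Finset.mem_range.1 hk
    rw [List.drop_eq_nil_iff] at h0
    omega

theorem splitSum_eq_single_left {w : List A} {F : List A → List A → M}
    (h : ∀ u v, u ++ v = w → u ≠ [] → F u v = 0) : splitSum w F = F [] w := by
  cases w with
  | nil => exact splitSum_nil F
  | cons c w =>
    rw [splitSum_cons, splitSum_eq_zero, add_zero]
    exact fun u v huv => h _ _ (by simp [huv]) (by simp)

end Split

/-! ### The algebra of noncommutative power series -/

section Algebra

variable {K A : Type*} [CommRing K]

theorem mul_apply (f g : List A → K) (w : List A) :
    mul f g w = splitSum w fun u v => f u * g v := rfl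

open Classical in
/-- A word, as a power series. -/
def word (K : Type*) [CommRing K] (w : List A) : List A → K := Pi.single w 1

theorem letter_eq_word (a : A) : letter K a = word K [a] := by
  classical
  funext w
  simp [letter, word, Pi.single_apply]

theorem word_apply_self (w : List A) : word K w w = 1 := by classical simp [word]

theorem word_apply_of_ne {v w : List A} (h : v ≠ w) : word K w v = 0 := by
  classical simp [word, h]

theorem letter_apply_self (a : A) : letter K a [a] = 1 := by simp [letter]

theorem letter_apply_of_ne {a : A} {w : List A} (h : w ≠ [a]) : letter K a w = 0 := by
  simp [letter, h]

theorem mul_assoc' (f g h : List A → K) : mul (mul f g) h = mul f (mul g h) := by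
  funext w
  simp only [mul_apply, splitSum_mul, mul_splitSum]
  rw [splitSum_assoc w fun a b c => f a * g b * h c]
  simp only [mul_assoc]

/-- The product of power series, as a bilinear map. -/
def mulB : (List A → K) →ₗ[K] (List A → K) →ₗ[K] (List A → K) :=
  LinearMap.mk₂ K mul
    (fun f f' g => by funext w; simp [mul_apply, add_mul, splitSum_add])
    (fun c f g => by funext w; simp [mul_apply, mul_splitSum, mul_assoc])
    (fun f f' g => by funext w; simp [mul_apply, mul_add, splitSum_add])
    (fun c f g => by funext w; simp [mul_apply, mul_splitSum, mul_left_comm])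

theorem mul_add' (f g h : List A → K) : mul f (g + h) = mul f g + mul f h := (mulB f).map_add g h
theorem add_mul' (f g h : List A → K) : mul (f + g) h = mul f h + mul g h :=
  LinearMap.map_add₂ mulB f g h
theorem mul_sub' (f g h : List A → K) : mul f (g - h) = mul f g - mul f h := (mulB f).map_sub g h
theorem sub_mul' (f g h : List A → K) : mul (f - g) h = mul f h - mul g h :=
  LinearMap.map_sub₂ mulB f g h
theorem mul_neg' (f g : List A → K) : mul f (-g) = -mul f g := (mulB f).map_neg g
theorem neg_mul' (f g : List A → K) : mul (-f) g = -mul f g := LinearMap.map_neg₂ mulB f g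
theorem mul_zero' (f : List A → K) : mul f 0 = 0 := (mulB f).map_zero
theorem zero_mul' (f : List A → K) : mul 0 f = 0 := LinearMap.map_zero₂ mulB f
theorem mul_smul' (c : K) (f g : List A → K) : mul f (c • g) = c • mul f g := (mulB f).map_smul c g
theorem smul_mul' (c : K) (f g : List A → K) : mul (c • f) g = c • mul f g :=
  LinearMap.map_smul₂ mulB c f g

theorem mul_usmul (c : ℤˣ) (f g : List A → K) : mul f (c • g) = c • mul f g := by
  rcases Int.units_eq_one_or c with rfl | rfl <;> simp [mul_neg']

theorem usmul_mul (c : ℤˣ) (f g : List A → K) : mul (c • f) g = c • mul f g := by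
  rcases Int.units_eq_one_or c with rfl | rfl <;> simp [neg_mul']

theorem word_nil_mul (f : List A → K) : mul (word K []) f = f := by
  funext w
  rw [mul_apply, splitSum_eq_single_left]
  · simp [word_apply_self]
  · intro u v _ hu
    rw [word_apply_of_ne hu, zero_mul]

theorem mul_word_nil (f : List A → K) : mul f (word K []) = f := by
  funext w
  rw [mul_apply, splitSum_eq_single_right]
  · simp [word_apply_self]
  · intro u v _ hu
    rw [word_apply_of_ne hu, mul_zero]

theorem letter_mul_nil (a : A) (f : List A → K) : mul (letter K a) f [] = 0 := by
  simp [mul_apply, splitSum_nil, letter]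

theorem letter_mul_cons_self (a : A) (f : List A → K) (w : List A) :
    mul (letter K a) f (a :: w) = f w := by
  rw [mul_apply, splitSum_cons, letter_apply_of_ne (by simp), zero_mul, zero_add,
    splitSum_eq_single_left]
  · simp [letter_apply_self]
  · intro u v _ hu
    rw [letter_apply_of_ne (by simpa using hu), zero_mul]

theorem letter_mul_cons_of_ne {a c : A} (h : c ≠ a) (f : List A → K) (w : List A) :
    mul (letter K a) f (c :: w) = 0 := by
  rw [mul_apply]
  refine splitSum_eq_zero fun u v huv => ?_
  rw [letter_apply_of_ne, zero_mul]
  rintro rfl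
  simp only [List.cons_append, List.cons.injEq] at huv
  exact h huv.1.symm

theorem mul_letter_nil (a : A) (f : List A → K) : mul f (letter K a) [] = 0 := by
  simp [mul_apply, splitSum_nil, letter]

theorem mul_letter_concat_self (a : A) (f : List A → K) (w : List A) :
    mul f (letter K a) (w ++ [a]) = f w := by
  rw [mul_apply, splitSum_append_cons, splitSum_nil, letter_apply_of_ne (by simp), mul_zero,
    add_zero, splitSum_eq_single_right]
  · simp [letter_apply_self]
  · intro u v _ hv
    rw [letter_apply_of_ne, mul_zero]
    intro h
    have := congrArg List.length h
    simp only [List.length_append, List.length_cons, List.length_nil] at this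
    exact hv (List.length_eq_zero_iff.1 (by omega))

theorem mul_letter_concat_of_ne {a c : A} (h : c ≠ a) (f : List A → K) (w : List A) :
    mul f (letter K a) (w ++ [c]) = 0 := by
  rw [mul_apply]
  refine splitSum_eq_zero fun u v huv => ?_
  rw [letter_apply_of_ne, mul_zero]
  rintro rfl
  have := (List.append_inj' huv rfl).2
  simp only [List.cons.injEq, and_true] at this
  exact h this.symm

theorem letter_mul_word (a : A) (w : List A) : mul (letter K a) (word K w) = word K (a :: w) := by
  funext v
  cases v with
  | nil => rw [letter_mul_nil, word_apply_of_ne (by simp)]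
  | cons c v =>
    by_cases h : c = a
    · subst h
      rw [letter_mul_cons_self]
      by_cases h : v = w
      · rw [h, word_apply_self, word_apply_self]
      · rw [word_apply_of_ne h, word_apply_of_ne (by simpa using h)]
    · rw [letter_mul_cons_of_ne h, word_apply_of_ne (by simp [h])]

/-! ### Tensors and the graded commutator -/

variable (deg : A → ℤ)

theorem wdeg_nil : wdeg deg [] = 0 := rfl
theorem wdeg_cons (a : A) (w : List A) : wdeg deg (a :: w) = deg a + wdeg deg w := by simp [wdeg]
theorem wdeg_append (v w : List A) : wdeg deg (v ++ w) = wdeg deg v + wdeg deg w := by simp [wdeg]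

/-- The parity involution, as a linear map. -/
def parityL : (List A → K) →ₗ[K] (List A → K) where
  toFun := parity deg
  map_add' f g := by funext w; simp [parity, smul_add]
  map_smul' c f := by funext w; simp [parity, mul_smul_comm]

theorem parityL_apply (f : List A → K) : parityL deg f = parity deg f := rfl

theorem parity_mul (f g : List A → K) :
    parity deg (mul f g) = mul (parity deg f) (parity deg g) := by
  funext w
  simp only [parity, mul_apply, smul_splitSum]
  refine splitSum_congr fun u v h => ?_
  rw [← h, wdeg_append, Int.negOnePow_add, smul_mul_smul_comm]

theorem parity_parity (f : List A → K) : parity deg (parity deg f) = f := by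
  funext w
  simp [parity, smul_smul]

/-- The elementary tensor, as a bilinear map. -/
def tmulB : (List A → K) →ₗ[K] (List A → K) →ₗ[K] (List A × List A → K) :=
  LinearMap.mk₂ K tmul
    (fun f f' g => by funext w; simp [tmul, add_mul])
    (fun c f g => by funext w; simp [tmul, mul_assoc])
    (fun f f' g => by funext w; simp [tmul, mul_add])
    (fun c f g => by funext w; simp [tmul, mul_left_comm])

theorem tmulB_apply (f g : List A → K) : tmulB f g = tmul f g := rfl

/-- The signed interchange, as a linear map. -/
def swapL : (List A × List A → K) →ₗ[K] (List A × List A → K) where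
  toFun := swap deg
  map_add' f g := by funext w; simp [swap, smul_add]
  map_smul' c f := by funext w; simp [swap, mul_smul_comm]

theorem swapL_apply (F : List A × List A → K) : swapL deg F = swap deg F := rfl

/-- The multiplication map from the completed tensor square of the algebra of power series. -/
def tensorMul : (List A × List A → K) →ₗ[K] (List A → K) where
  toFun F w := splitSum w fun u v => F (u, v)
  map_add' F G := by funext w; simp [splitSum_add]
  map_smul' c F := by funext w; simp [mul_splitSum]

theorem tensorMul_apply (F : List A × List A → K) (w : List A) :
    tensorMul F w = splitSum w fun u v => F (u, v) := rfl

theorem tensorMul_tmul (f g : List A → K) : tensorMul (tmul f g) = mul f g := rfl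

/-- The graded commutator, as a bilinear map. -/
def bracketB : (List A → K) →ₗ[K] (List A → K) →ₗ[K] (List A → K) :=
  tmulB.compr₂ (tensorMul ∘ₗ (LinearMap.id - swapL deg))

theorem bracketB_apply (f g : List A → K) : bracketB deg f g = bracket deg f g := by
  funext w
  simp only [bracketB, LinearMap.compr₂_apply, LinearMap.comp_apply, LinearMap.sub_apply,
    LinearMap.id_apply, tmulB_apply, swapL_apply, tensorMul_apply, bracket, splitSum]
  refine Finset.sum_congr rfl fun k _ => ?_
  simp [tmul, swap, mul_comm (g _)]

theorem bracket_eq_tensorMul (f g : List A → K) :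
    bracket deg f g = tensorMul (tmul f g) - tensorMul (swap deg (tmul f g)) := by
  rw [← map_sub, ← bracketB_apply]; rfl

theorem bracket_neg_left (f h : List A → K) :
    bracket deg (-f) h = -bracket deg f h := by
  simp only [← bracketB_apply, map_neg, LinearMap.neg_apply]
theorem bracket_smul_right (c : K) (f h : List A → K) :
    bracket deg f (c • h) = c • bracket deg f h := by
  simp only [← bracketB_apply, map_smul]
theorem bracket_usmul_left (c : ℤˣ) (f h : List A → K) :
    bracket deg (c • f) h = c • bracket deg f h := by
  rcases Int.units_eq_one_or c with rfl | rfl <;> simp [bracket_neg_left]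
theorem bracket_zero_right (f : List A → K) : bracket deg f 0 = 0 := by
  rw [← bracketB_apply, map_zero]
end Algebra

/-! ### Gradings and parity -/

section Grading

variable {K A : Type*} [CommRing K]

/-- A family of additive subgroups of `K` indexed by `ℤ` that is closed under products. -/
def IsMul (𝒬 : ℤ → AddSubgroup K) : Prop :=
  ∀ ⦃a b : ℤ⦄ ⦃x y : K⦄, x ∈ 𝒬 a → y ∈ 𝒬 b → x * y ∈ 𝒬 (a + b)

/-- Everything in even degrees, nothing in odd degrees: `homog (evenSub K) deg p` consists of the
series of parity `p`. -/
def evenSub (K : Type*) [CommRing K] (k : ℤ) : AddSubgroup K where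
  carrier := {x | ¬ Even k → x = 0}
  zero_mem' _ := rfl
  add_mem' hx hy h := by rw [hx h, hy h, add_zero]
  neg_mem' hx h := by rw [hx h, neg_zero]

/-- Everything in degree `0`, nothing in other degrees: `homog (zeroSub K) wt n` consists of the
series all of whose words have weight `n`. -/
def zeroSub (K : Type*) [CommRing K] (k : ℤ) : AddSubgroup K where
  carrier := {x | k ≠ 0 → x = 0}
  zero_mem' _ := rfl
  add_mem' hx hy h := by rw [hx h, hy h, add_zero]
  neg_mem' hx h := by rw [hx h, neg_zero]

/-- Everything in degrees `≤ 0`, nothing in positive degrees: `homog (nonposSub K) wt n` consists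
of the series all of whose words have weight at least `n`. -/
def nonposSub (K : Type*) [CommRing K] (k : ℤ) : AddSubgroup K where
  carrier := {x | 0 < k → x = 0}
  zero_mem' _ := rfl
  add_mem' hx hy h := by rw [hx h, hy h, add_zero]
  neg_mem' hx h := by rw [hx h, neg_zero]

theorem mem_zeroSub {k : ℤ} {x : K} : x ∈ zeroSub K k ↔ (k ≠ 0 → x = 0) := Iff.rfl
theorem mem_nonposSub {k : ℤ} {x : K} : x ∈ nonposSub K k ↔ (0 < k → x = 0) := Iff.rfl

theorem evenSub_isMul : IsMul (evenSub K) := by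
  intro a b x y hx hy h
  by_cases ha : Even a
  · rw [hy fun hb => h (ha.add hb), mul_zero]
  · rw [hx ha, zero_mul]

theorem zeroSub_isMul : IsMul (zeroSub K) := by
  intro a b x y hx hy h
  by_cases ha : a = 0
  · rw [hy fun hb => h (by rw [ha, hb, add_zero]), mul_zero]
  · rw [hx ha, zero_mul]

theorem nonposSub_isMul : IsMul (nonposSub K) := by
  intro a b x y hx hy h
  by_cases ha : 0 < a
  · rw [hx ha, zero_mul]
  · rw [hy (by omega), mul_zero]

theorem one_mem_evenSub : (1 : K) ∈ evenSub K 0 := fun h => absurd (by simp) h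
theorem one_mem_zeroSub : (1 : K) ∈ zeroSub K 0 := fun h => absurd rfl h
theorem one_mem_nonposSub : (1 : K) ∈ nonposSub K 0 := fun h => absurd h (by simp)

theorem isMul_of_gradedRing (𝒜 : ℤ → AddSubgroup K) [GradedRing 𝒜] : IsMul 𝒜 :=
  fun _ _ _ _ hx hy => SetLike.GradedMul.mul_mem hx hy

theorem usmul_mem {M : Type*} [AddCommGroup M] {S : AddSubgroup M} (c : ℤˣ) {x : M} (hx : x ∈ S) :
    c • x ∈ S := by
  rcases Int.units_eq_one_or c with rfl | rfl
  · simpa using hx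
  · simpa using hx

theorem splitSum_mem {M : Type*} [AddCommGroup M] {S : AddSubgroup M} {w : List A}
    {F : List A → List A → M} (h : ∀ u v, u ++ v = w → F u v ∈ S) : splitSum w F ∈ S :=
  sum_mem fun k _ => h _ _ (List.take_append_drop k w)

variable {𝒬 : ℤ → AddSubgroup K} {wt deg : A → ℤ} {m n : ℤ} {f g : List A → K}

theorem mul_mem_homog (h𝒬 : IsMul 𝒬) (hf : f ∈ homog 𝒬 wt m) (hg : g ∈ homog 𝒬 wt n) :
    mul f g ∈ homog 𝒬 wt (m + n) := by
  intro w
  rw [mul_apply]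
  refine splitSum_mem fun u v h => ?_
  have := h𝒬 (hf u) (hg v)
  rwa [← h, wdeg_append, show m + n - (wdeg wt u + wdeg wt v) = m - wdeg wt u + (n - wdeg wt v) by
    ring]

theorem word_mem_homog (h1 : (1 : K) ∈ 𝒬 0) (w : List A) : word K w ∈ homog 𝒬 wt (wdeg wt w) := by
  intro v
  by_cases h : v = w
  · subst h
    rwa [word_apply_self, sub_self]
  · rw [word_apply_of_ne h]
    exact zero_mem _

theorem letter_mem_homog (h1 : (1 : K) ∈ 𝒬 0) (a : A) : letter K a ∈ homog 𝒬 wt (wt a) := by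
  have := word_mem_homog (wt := wt) h1 [a]
  rwa [← letter_eq_word, wdeg_cons, wdeg_nil, add_zero] at this

/-- The elements of the completed tensor square all of whose coefficients are homogeneous of the
complementary degree. -/
def tensorHomog (𝒬 : ℤ → AddSubgroup K) (wt : A → ℤ) (n : ℤ) :
    AddSubgroup (List A × List A → K) where
  carrier := {F | ∀ p : List A × List A, F p ∈ 𝒬 (n - wdeg wt p.1 - wdeg wt p.2)}
  zero_mem' _ := zero_mem _
  add_mem' hf hg p := add_mem (hf p) (hg p)
  neg_mem' hf p := neg_mem (hf p)

theorem tmul_mem_tensorHomog (h𝒬 : IsMul 𝒬) (hf : f ∈ homog 𝒬 wt m) (hg : g ∈ homog 𝒬 wt n) :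
    tmul f g ∈ tensorHomog 𝒬 wt (m + n) := by
  intro p
  have := h𝒬 (hf p.1) (hg p.2)
  rwa [show m - wdeg wt p.1 + (n - wdeg wt p.2) = m + n - wdeg wt p.1 - wdeg wt p.2 by ring] at this

theorem swap_mem_tensorHomog {F : List A × List A → K} (hF : F ∈ tensorHomog 𝒬 wt n) :
    swap deg F ∈ tensorHomog 𝒬 wt n := by
  intro p
  have := hF (p.2, p.1)
  rw [sub_right_comm] at this
  exact usmul_mem _ this

theorem tensorMul_mem_homog {F : List A × List A → K} (hF : F ∈ tensorHomog 𝒬 wt n) :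
    tensorMul F ∈ homog 𝒬 wt n := by
  intro w
  rw [tensorMul_apply]
  refine splitSum_mem fun u v h => ?_
  have := hF (u, v)
  rwa [← h, wdeg_append, ← sub_sub]

theorem bracket_mem_homog (h𝒬 : IsMul 𝒬) (hf : f ∈ homog 𝒬 wt m) (hg : g ∈ homog 𝒬 wt n) :
    bracket deg f g ∈ homog 𝒬 wt (m + n) := by
  rw [bracket_eq_tensorMul]
  exact sub_mem (tensorMul_mem_homog (tmul_mem_tensorHomog h𝒬 hf hg))
    (tensorMul_mem_homog (swap_mem_tensorHomog (tmul_mem_tensorHomog h𝒬 hf hg)))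

/-- The series all of whose words have the parity of `p`. -/
abbrev HasPar (deg : A → ℤ) (p : ℤ) (f : List A → K) : Prop := f ∈ homog (evenSub K) deg p

theorem HasPar.negOnePow_eq {p : ℤ} (hf : HasPar deg p f) {w : List A} (hw : f w ≠ 0) :
    (wdeg deg w).negOnePow = p.negOnePow := by
  by_contra h
  refine hw (hf w fun he => h ?_)
  rw [Int.negOnePow_eq_iff]
  simpa using he.neg

theorem HasPar.even_sub {p : ℤ} (hf : HasPar deg p f) {w : List A} (hw : f w ≠ 0) :
    Even (p - wdeg deg w) := by
  by_contra h
  exact hw (hf w h)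

theorem HasPar.parity_eq {p : ℤ} (hf : HasPar deg p f) : parity deg f = p.negOnePow • f := by
  funext w
  by_cases hw : f w = 0
  · simp [parity, hw]
  · simp [parity, hf.negOnePow_eq hw]

theorem HasPar.swap_tmul {p q : ℤ} (hf : HasPar deg p f) (hg : HasPar deg q g) :
    swap deg (tmul f g) = (p * q).negOnePow • tmul g f := by
  funext w
  by_cases h1 : f w.2 = 0
  · simp [swap, tmul, h1]
  by_cases h2 : g w.1 = 0
  · simp [swap, tmul, h2]
  have : (wdeg deg w.1 * wdeg deg w.2).negOnePow = (p * q).negOnePow := by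
    rw [Int.negOnePow_eq_iff]
    have e1 := hf.even_sub h1
    have e2 := hg.even_sub h2
    have : wdeg deg w.1 * wdeg deg w.2 - p * q =
      -((p - wdeg deg w.2) * q + (q - wdeg deg w.1) * wdeg deg w.2) := by ring
    rw [this]
    exact ((e1.mul_right _).add (e2.mul_right _)).neg
  simp [swap, tmul, this, mul_comm]

theorem HasPar.bracket_eq {p q : ℤ} (hf : HasPar deg p f) (hg : HasPar deg q g) :
    bracket deg f g = mul f g - (p * q).negOnePow • mul g f := by
  rw [bracket_eq_tensorMul, hf.swap_tmul hg, tensorMul_tmul]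
  congr 1
  rcases Int.units_eq_one_or (p * q).negOnePow with h | h <;> simp [h, tensorMul_tmul]

theorem HasPar.bracket_symm {p q : ℤ} (hf : HasPar deg p f) (hg : HasPar deg q g) :
    bracket deg f g = -((p * q).negOnePow • bracket deg g f) := by
  rw [hf.bracket_eq hg, hg.bracket_eq hf, mul_comm q p]
  rcases Int.units_eq_one_or (p * q).negOnePow with h | h <;> simp [h, add_comm]

theorem HasPar.bracket {p q : ℤ} (hf : HasPar deg p f) (hg : HasPar deg q g) :
    HasPar deg (p + q) (bracket deg f g) := bracket_mem_homog evenSub_isMul hf hg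

theorem HasPar.mul {p q : ℤ} (hf : HasPar deg p f) (hg : HasPar deg q g) :
    HasPar deg (p + q) (mul f g) := mul_mem_homog evenSub_isMul hf hg

theorem letter_hasPar (a : A) : HasPar deg (deg a) (letter K a) :=
  letter_mem_homog one_mem_evenSub a

/-- The graded Jacobi identity. -/
theorem HasPar.jacobi {h : List A → K} {p q r : ℤ} (hf : HasPar deg p f) (hg : HasPar deg q g)
    (hh : HasPar deg r h) :
    CInf.bracket deg (CInf.bracket deg f g) h = CInf.bracket deg f (CInf.bracket deg g h) -
      (p * q).negOnePow • CInf.bracket deg g (CInf.bracket deg f h) := by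
  rw [(hf.bracket hg).bracket_eq hh, hf.bracket_eq (hg.bracket hh), hg.bracket_eq (hf.bracket hh),
    hf.bracket_eq hg, hg.bracket_eq hh, hf.bracket_eq hh]
  rw [add_mul, mul_add p, mul_add q, Int.negOnePow_add, Int.negOnePow_add, Int.negOnePow_add,
    mul_comm q p]
  generalize (p * q).negOnePow = a
  generalize (p * r).negOnePow = b
  generalize (q * r).negOnePow = c
  simp only [mul_sub', sub_mul', mul_usmul, usmul_mul, smul_sub, smul_smul, mul_assoc']
  rcases Int.units_eq_one_or a with rfl | rfl <;> rcases Int.units_eq_one_or b with rfl | rfl <;>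
  rcases Int.units_eq_one_or c with rfl | rfl <;> simp <;> abel

/-- The defect of the invariance relation is, after multiplication, a graded commutator. -/
theorem HasPar.mul_bracket_sub {h : List A → K} {p q r : ℤ} (hf : HasPar deg p f)
    (hg : HasPar deg q g) (hh : HasPar deg r h) :
    CInf.mul f (CInf.bracket deg g h) - CInf.mul (CInf.bracket deg f g) h =
      (p * q).negOnePow • CInf.bracket deg g (CInf.mul f h) := by
  rw [hg.bracket_eq hh, hf.bracket_eq hg, hg.bracket_eq (hf.mul hh), mul_add q, Int.negOnePow_add,
    mul_comm q p]
  generalize (p * q).negOnePow = a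
  generalize (q * r).negOnePow = c
  simp only [mul_sub', sub_mul', mul_usmul, usmul_mul, smul_sub, smul_smul, mul_assoc']
  rcases Int.units_eq_one_or a with rfl | rfl <;>
  rcases Int.units_eq_one_or c with rfl | rfl <;> simp <;> abel

/-- Lie monomials together with the multiset of letters that they involve. -/
inductive MonOf (K : Type*) [CommRing K] (deg : A → ℤ) : Multiset A → (List A → K) → Prop
  | letter (a : A) : MonOf K deg {a} (letter K a)
  | bracket {s t : Multiset A} {f g : List A → K} (hf : MonOf K deg s f) (hg : MonOf K deg t g) :
      MonOf K deg (s + t) (bracket deg f g)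

theorem LieMonomial.exists_monOf (hf : LieMonomial K deg f) : ∃ s, MonOf K deg s f := by
  induction hf with
  | letter a => exact ⟨_, .letter a⟩
  | bracket _ _ h1 h2 =>
    obtain ⟨s, hs⟩ := h1
    obtain ⟨t, ht⟩ := h2
    exact ⟨_, hs.bracket ht⟩

theorem MonOf.lieMonomial {s : Multiset A} (hf : MonOf K deg s f) : LieMonomial K deg f := by
  induction hf with
  | letter a => exact .letter a
  | bracket _ _ h1 h2 => exact h1.bracket h2

theorem MonOf.mem_homog {s : Multiset A} (hf : MonOf K deg s f) (h𝒬 : IsMul 𝒬)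
    (h1 : (1 : K) ∈ 𝒬 0) : f ∈ homog 𝒬 wt (s.map wt).sum := by
  induction hf with
  | letter a => simpa using letter_mem_homog h1 a
  | bracket _ _ h1 h2 => simpa using bracket_mem_homog h𝒬 h1 h2

theorem MonOf.hasPar {s : Multiset A} (hf : MonOf K deg s f) : HasPar deg (s.map deg).sum f :=
  hf.mem_homog evenSub_isMul one_mem_evenSub

theorem LieMonomial.exists_hasPar (hf : LieMonomial K deg f) : ∃ p, HasPar deg p f := by
  obtain ⟨s, hs⟩ := hf.exists_monOf
  exact ⟨_, hs.hasPar⟩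

end Grading

/-! ### Continuity and density -/


section Density

variable {K A B X Y : Type*} [CommRing K] [TopologicalSpace K] [DiscreteTopology K]

theorem continuous_splitSum {Z : Type*} [TopologicalSpace Z] {w : List A}
    {F : Z → List A → List A → K} (h : ∀ u v, Continuous fun z => F z u v) :
    Continuous fun z => splitSum w (F z) :=
  continuous_finsetSum _ fun _ _ => h _ _

theorem continuous_usmul {Z : Type*} [TopologicalSpace Z] {F : Z → K} (h : Continuous F) (c : ℤˣ) :
    Continuous fun z => c • F z :=
  (continuous_of_discreteTopology (f := fun x : K => c • x)).comp h

/-- A closed submodule contains every function all of whose monomials `f x • single x` it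
contains. -/
theorem mem_of_single_mem {Z : Submodule K (X → K)} (hZ : IsClosed (Z : Set (X → K))) {f : X → K}
    [DecidableEq X] (h : ∀ x, f x ≠ 0 → (Pi.single x 1 : X → K) ∈ Z) : f ∈ Z := by
  have ht : Filter.Tendsto (fun s : Finset X => ∑ x ∈ s, f x • (Pi.single x 1 : X → K))
      Filter.atTop (nhds f) := by
    rw [tendsto_pi_nhds]
    intro y
    refine tendsto_const_nhds.congr' ?_
    filter_upwards [Filter.eventually_ge_atTop {y}] with s hs
    rw [Finset.sum_apply, Finset.sum_eq_single y]
    · simp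
    · intro b _ hb
      simp [hb.symm]
    · intro hy
      exact absurd (hs (Finset.mem_singleton_self y)) hy
  refine hZ.mem_of_tendsto ht (Filter.Eventually.of_forall fun s => ?_)
  refine sum_mem fun x _ => ?_
  by_cases hx : f x = 0
  · rw [hx, zero_smul]; exact zero_mem _
  · exact Z.smul_mem _ (h x hx)

/-- A closed submodule contains a power series if it contains all the words that occur in it. -/
theorem mem_of_word_mem {Z : Submodule K (List A → K)} (hZ : IsClosed (Z : Set (List A → K)))
    {f : List A → K} (h : ∀ w, f w ≠ 0 → word K w ∈ Z) : f ∈ Z := by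
  classical
  refine mem_of_single_mem hZ fun x hx => ?_
  have : (Pi.single x 1 : List A → K) = word K x := by
    funext v
    by_cases hv : v = x
    · rw [hv, word_apply_self, Pi.single_eq_same]
    · rw [word_apply_of_ne hv, Pi.single_eq_of_ne hv]
  rw [this]
  exact h x hx

theorem tmul_word (p : List A × List A) [DecidableEq (List A × List A)] :
    tmul (word K p.1) (word K p.2) = Pi.single p 1 := by
  classical
  funext q
  by_cases h : q = p
  · subst h
    simp [tmul, word_apply_self]
  · rw [Pi.single_eq_of_ne h, tmul]
    by_cases h1 : q.1 = p.1
    · rw [word_apply_of_ne (v := q.2) (w := p.2), mul_zero]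
      exact fun h2 => h (Prod.ext h1 h2)
    · rw [word_apply_of_ne h1, zero_mul]

theorem isClosed_eqLocus {E F : Type*} [AddCommGroup E] [Module K E] [TopologicalSpace E]
    [AddCommGroup F] [Module K F] [TopologicalSpace F] [T2Space F] {Φ Ψ : E →ₗ[K] F}
    (hΦ : Continuous Φ) (hΨ : Continuous Ψ) : IsClosed (LinearMap.eqLocus Φ Ψ : Set E) :=
  isClosed_eq hΦ hΨ

/-- Continuous linear maps that agree on words are equal. -/
theorem eq_of_words {Φ Ψ : (List A → K) →ₗ[K] (X → K)} (hΦ : Continuous Φ) (hΨ : Continuous Ψ)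
    (h : ∀ w, Φ (word K w) = Ψ (word K w)) (f : List A → K) : Φ f = Ψ f :=
  mem_of_word_mem (isClosed_eqLocus hΦ hΨ) fun w _ => h w

/-- Continuous linear maps on the completed tensor square that agree on elementary tensors are
equal. -/
theorem eq_of_tmul {Φ Ψ : (List A × List A → K) →ₗ[K] (X → K)} (hΦ : Continuous Φ)
    (hΨ : Continuous Ψ) (h : ∀ f g, Φ (tmul f g) = Ψ (tmul f g)) (F : List A × List A → K) :
    Φ F = Ψ F := by
  classical
  refine mem_of_single_mem (isClosed_eqLocus hΦ hΨ) fun p _ => ?_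
  rw [← tmul_word]
  exact h _ _

theorem continuous_tmul_left (g : List A → K) : Continuous fun f : List A → K => tmul f g :=
  continuous_pi fun p => (continuous_apply p.1).mul continuous_const

theorem continuous_tmul_right (f : List A → K) : Continuous fun g : List A → K => tmul f g :=
  continuous_pi fun p => continuous_const.mul (continuous_apply p.2)

theorem continuous_tensorMul : Continuous (tensorMul : (List A × List A → K) →ₗ[K] _) :=
  continuous_pi fun w => continuous_splitSum (w := w)
    (F := fun F : List A × List A → K => fun u v => F (u, v)) fun u v => continuous_apply (u, v)

theorem continuous_swapL (deg : A → ℤ) : Continuous (swapL (K := K) deg) :=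
  continuous_pi fun p => continuous_usmul (continuous_apply (p.2, p.1)) _

theorem continuous_parityL (deg : A → ℤ) : Continuous (parityL (K := K) deg) :=
  continuous_pi fun p => continuous_usmul (continuous_apply p) _

theorem continuous_mul_left (g : List A → K) : Continuous fun f : List A → K => mul f g :=
  continuous_tensorMul.comp (continuous_tmul_left g)

theorem continuous_bracket_left (deg : A → ℤ) (g : List A → K) :
    Continuous fun f : List A → K => bracket deg f g := by
  simp only [bracket_eq_tensorMul]
  exact (continuous_tensorMul.comp (continuous_tmul_left g)).sub
    (continuous_tensorMul.comp ((continuous_swapL deg).comp (continuous_tmul_left g)))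

theorem continuous_bracket_right (deg : A → ℤ) (f : List A → K) :
    Continuous fun g : List A → K => bracket deg f g := by
  simp only [bracket_eq_tensorMul]
  exact (continuous_tensorMul.comp (continuous_tmul_right f)).sub
    (continuous_tensorMul.comp ((continuous_swapL deg).comp (continuous_tmul_right f)))

theorem isClosed_freeLie (deg : A → ℤ) : IsClosed (freeLie K deg : Set (List A → K)) :=
  Submodule.isClosed_topologicalClosure _

theorem freeLie_le {deg : A → ℤ} {Z : Submodule K (List A → K)}
    (hZ : IsClosed (Z : Set (List A → K))) (h : ∀ f, LieMonomial K deg f → f ∈ Z) :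
    freeLie K deg ≤ Z :=
  Submodule.topologicalClosure_minimal _ (Submodule.span_le.2 h) hZ

theorem LieMonomial.mem_freeLie {deg : A → ℤ} {f : List A → K} (hf : LieMonomial K deg f) :
    f ∈ freeLie K deg :=
  Submodule.le_topologicalClosure _ (Submodule.subset_span hf)

theorem MonOf.mem_freeLie {deg : A → ℤ} {s : Multiset A} {f : List A → K} (hf : MonOf K deg s f) :
    f ∈ freeLie K deg := hf.lieMonomial.mem_freeLie

/-- Continuous linear maps that agree on Lie monomials agree on the pro-free Lie algebra. -/
theorem eq_of_lieMonomial {deg : A → ℤ} {Φ Ψ : (List A → K) →ₗ[K] (X → K)} (hΦ : Continuous Φ)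
    (hΨ : Continuous Ψ) (h : ∀ f, LieMonomial K deg f → Φ f = Ψ f) {f : List A → K}
    (hf : f ∈ freeLie K deg) : Φ f = Ψ f :=
  freeLie_le (isClosed_eqLocus hΦ hΨ) h hf

/-- The generators of the completed tensor square that are tensors of Lie monomials. -/
def monTensors (K : Type*) [CommRing K] (deg : A → ℤ) : Set (List A × List A → K) :=
  {F | ∃ x y, LieMonomial K deg x ∧ LieMonomial K deg y ∧ F = tmul x y}

/-- The relations between Lie monomials. -/
def monRels (K : Type*) [CommRing K] (deg : A → ℤ) : Set (List A × List A → K) :=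
  {F | ∃ x y, LieMonomial K deg x ∧ LieMonomial K deg y ∧ F = tmul x y - swap deg (tmul x y)} ∪
  {F | ∃ x y z, LieMonomial K deg x ∧ LieMonomial K deg y ∧ LieMonomial K deg z ∧
    F = tmul x (bracket deg y z) - tmul (bracket deg x y) z}

theorem tmul_mem_of_monTensors {deg : A → ℤ} {Z : Submodule K (List A × List A → K)}
    (hZ : IsClosed (Z : Set (List A × List A → K))) (h : monTensors K deg ⊆ Z) {x y : List A → K}
    (hx : x ∈ freeLie K deg) (hy : y ∈ freeLie K deg) : tmul x y ∈ Z := by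
  have h1 : ∀ x, LieMonomial K deg x → ∀ y ∈ freeLie K deg, tmul x y ∈ Z := by
    intro x hx y hy
    refine freeLie_le (Z := Z.comap (tmulB x)) (hZ.preimage (continuous_tmul_right x))
      (fun y hy => ?_) hy
    exact h ⟨x, y, hx, hy, rfl⟩
  refine freeLie_le (Z := Z.comap (tmulB.flip y)) (hZ.preimage (continuous_tmul_left y))
    (fun x hx => h1 x hx y hy) hx

/-- The completed tensor square is generated by the tensors of Lie monomials. -/
theorem lieTensor_eq (deg : A → ℤ) :
    lieTensor K deg = (Submodule.span K (monTensors K deg)).topologicalClosure := by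
  apply le_antisymm
  · refine Submodule.topologicalClosure_minimal _ (Submodule.span_le.2 ?_)
      (Submodule.isClosed_topologicalClosure _)
    rintro F ⟨x, hx, y, hy, rfl⟩
    exact tmul_mem_of_monTensors (Submodule.isClosed_topologicalClosure _)
      (Submodule.subset_span.trans (Submodule.le_topologicalClosure _)) hx hy
  · refine Submodule.topologicalClosure_mono (Submodule.span_mono ?_)
    rintro F ⟨x, y, hx, hy, rfl⟩
    exact ⟨x, hx.mem_freeLie, y, hy.mem_freeLie, rfl⟩

/-- The relations of the Lie de Rham complex are generated by those between Lie monomials. -/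
theorem lieRel_eq (deg : A → ℤ) :
    lieRel K deg = (Submodule.span K (monRels K deg)).topologicalClosure := by
  set Z := (Submodule.span K (monRels K deg)).topologicalClosure with hZdef
  have hZ : IsClosed (Z : Set (List A × List A → K)) := Submodule.isClosed_topologicalClosure _
  have hsub : monRels K deg ⊆ Z :=
    Submodule.subset_span.trans (Submodule.le_topologicalClosure _)
  apply le_antisymm
  · refine Submodule.topologicalClosure_minimal _ (Submodule.span_le.2 ?_) hZ
    rintro F (⟨x, hx, y, hy, rfl⟩ | ⟨x, hx, y, hy, z, hz, rfl⟩)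
    · refine tmul_mem_of_monTensors (deg := deg)
        (Z := Z.comap ((LinearMap.id : _ →ₗ[K] (List A × List A → K)) - swapL deg)) ?_ ?_ hx hy
      · exact hZ.preimage (f := fun F => F - swapL deg F)
          (continuous_id.sub (continuous_swapL deg))
      · rintro F ⟨x, y, hx, hy, rfl⟩
        exact hsub (Or.inl ⟨x, y, hx, hy, rfl⟩)
    · have cl : ∀ z, Continuous fun y => bracketB (K := K) deg y z := fun z => by
        simpa only [← bracketB_apply] using continuous_bracket_left deg z
      have cr : ∀ y, Continuous fun z => bracketB (K := K) deg y z := fun y => by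
        simpa only [← bracketB_apply] using continuous_bracket_right deg y
      have h1 : ∀ x, LieMonomial K deg x → ∀ y, LieMonomial K deg y → ∀ z ∈ freeLie K deg,
          tmulB x (bracketB deg y z) - tmulB (bracketB deg x y) z ∈ Z := by
        intro x hx y hy
        refine freeLie_le
          (Z := Z.comap (tmulB x ∘ₗ bracketB deg y - tmulB (bracketB deg x y))) ?_ ?_
        · exact hZ.preimage (f := fun z => tmulB x (bracketB deg y z) - tmulB (bracketB deg x y) z)
            (((continuous_tmul_right x).comp (cr y)).sub (continuous_tmul_right _))
        · intro z hz
          refine hsub (Or.inr ⟨x, y, z, hx, hy, hz, ?_⟩)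
          simp only [← bracketB_apply]
          rfl
      have h2 : ∀ x, LieMonomial K deg x → ∀ z ∈ freeLie K deg, ∀ y ∈ freeLie K deg,
          tmulB x (bracketB deg y z) - tmulB (bracketB deg x y) z ∈ Z := by
        intro x hx z hz
        refine freeLie_le
          (Z := Z.comap (tmulB x ∘ₗ (bracketB deg).flip z - tmulB.flip z ∘ₗ bracketB deg x)) ?_ ?_
        · exact hZ.preimage (f := fun y => tmulB x (bracketB deg y z) - tmulB (bracketB deg x y) z)
            (((continuous_tmul_right x).comp (cl z)).sub ((continuous_tmul_left z).comp (cr x)))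
        · exact fun y hy => h1 x hx y hy z hz
      have h3 : ∀ x ∈ freeLie K deg,
          tmulB x (bracketB deg y z) - tmulB (bracketB deg x y) z ∈ Z := by
        refine freeLie_le
          (Z := Z.comap (tmulB.flip (bracketB deg y z) - tmulB.flip z ∘ₗ (bracketB deg).flip y))
          ?_ ?_
        · exact hZ.preimage (f := fun x => tmulB x (bracketB deg y z) - tmulB (bracketB deg x y) z)
            ((continuous_tmul_left _).sub ((continuous_tmul_left z).comp (cl y)))
        · exact fun x hx => h2 x hx z hz y hy
      simpa only [bracketB_apply, tmulB_apply, SetLike.mem_coe] using h3 x hx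
  · refine Submodule.topologicalClosure_mono (Submodule.span_mono ?_)
    rintro F (⟨x, y, hx, hy, rfl⟩ | ⟨x, y, z, hx, hy, hz, rfl⟩)
    · exact Or.inl ⟨x, hx.mem_freeLie, y, hy.mem_freeLie, rfl⟩
    · exact Or.inr ⟨x, hx.mem_freeLie, y, hy.mem_freeLie, z, hz.mem_freeLie, rfl⟩

theorem isClosed_lieTensor (deg : A → ℤ) :
    IsClosed (lieTensor K deg : Set (List A × List A → K)) :=
  Submodule.isClosed_topologicalClosure _

theorem isClosed_lieRel (deg : A → ℤ) : IsClosed (lieRel K deg : Set (List A × List A → K)) :=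
  Submodule.isClosed_topologicalClosure _

theorem lieTensor_le {deg : A → ℤ} {Z : Submodule K (List A × List A → K)}
    (hZ : IsClosed (Z : Set (List A × List A → K)))
    (h : ∀ x y, LieMonomial K deg x → LieMonomial K deg y → tmul x y ∈ Z) :
    lieTensor K deg ≤ Z := by
  rw [lieTensor_eq]
  refine Submodule.topologicalClosure_minimal _ (Submodule.span_le.2 ?_) hZ
  rintro F ⟨x, y, hx, hy, rfl⟩
  exact h x y hx hy

theorem lieRel_le {deg : A → ℤ} {Z : Submodule K (List A × List A → K)}
    (hZ : IsClosed (Z : Set (List A × List A → K)))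
    (h1 : ∀ x y, LieMonomial K deg x → LieMonomial K deg y → tmul x y - swap deg (tmul x y) ∈ Z)
    (h2 : ∀ x y z, LieMonomial K deg x → LieMonomial K deg y → LieMonomial K deg z →
      tmul x (bracket deg y z) - tmul (bracket deg x y) z ∈ Z) :
    lieRel K deg ≤ Z := by
  rw [lieRel_eq]
  refine Submodule.topologicalClosure_minimal _ (Submodule.span_le.2 ?_) hZ
  rintro F (⟨x, y, hx, hy, rfl⟩ | ⟨x, y, z, hx, hy, hz, rfl⟩)
  · exact h1 x y hx hy
  · exact h2 x y z hx hy hz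

theorem tmul_mem_lieTensor {deg : A → ℤ} {x y : List A → K} (hx : x ∈ freeLie K deg)
    (hy : y ∈ freeLie K deg) : tmul x y ∈ lieTensor K deg :=
  Submodule.le_topologicalClosure _ (Submodule.subset_span ⟨x, hx, y, hy, rfl⟩)

theorem symm_mem_lieRel {deg : A → ℤ} {x y : List A → K} (hx : x ∈ freeLie K deg)
    (hy : y ∈ freeLie K deg) : tmul x y - swap deg (tmul x y) ∈ lieRel K deg :=
  Submodule.le_topologicalClosure _ (Submodule.subset_span (Or.inl ⟨x, hx, y, hy, rfl⟩))

theorem invariance_mem_lieRel {deg : A → ℤ} {x y z : List A → K} (hx : x ∈ freeLie K deg)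
    (hy : y ∈ freeLie K deg) (hz : z ∈ freeLie K deg) :
    tmul x (bracket deg y z) - tmul (bracket deg x y) z ∈ lieRel K deg :=
  Submodule.le_topologicalClosure _
    (Submodule.subset_span (Or.inr ⟨x, hx, y, hy, z, hz, rfl⟩))

theorem swap_mem_lieRel {deg : A → ℤ} {p q : ℤ} {x y : List A → K} (hx : x ∈ freeLie K deg)
    (hy : y ∈ freeLie K deg) (px : HasPar deg p x) (py : HasPar deg q y) :
    tmul x y - (p * q).negOnePow • tmul y x ∈ lieRel K deg := by
  rw [← px.swap_tmul py]
  exact symm_mem_lieRel hx hy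

end Density

/-! ### Odd derivations -/

section OddDer

variable {K A B : Type*} [CommRing K]

/-- Every word occurs in only finitely many of the series `δ x`: the family `δ` tends to `0` along
the cofinite filter. -/
def Adm {X : Type*} (δ : X → List A → K) : Prop := ∀ v, {a | δ a v ≠ 0}.Finite

theorem Adm.mem_lettersAt {δ : A → List A → K} (hδ : Adm δ) {v : List A} {a : A} :
    a ∈ lettersAt δ v ↔ δ a v ≠ 0 := by
  simp [lettersAt, hδ v]

theorem oddDer_apply (deg : A → ℤ) (δ : A → List A → K) (f : List A → K) (w : List A) :
    oddDer deg δ f w = splitSum w fun u r => splitSum r fun v u' =>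
      ∑ a ∈ lettersAt δ v, (wdeg deg u).negOnePow • (f (u ++ a :: u') * δ a v) := by
  simp only [splitSum, List.length_drop]
  rfl

theorem oddDer_mem_homog {𝒬 : ℤ → AddSubgroup K} (h𝒬 : IsMul 𝒬) {wt deg : A → ℤ} {n s : ℤ}
    {δ : A → List A → K} (hδ : ∀ a, δ a ∈ homog 𝒬 wt (wt a + s)) {f : List A → K}
    (hf : f ∈ homog 𝒬 wt n) : oddDer deg δ f ∈ homog 𝒬 wt (n + s) := by
  intro w
  rw [oddDer_apply]
  refine splitSum_mem fun u r h => splitSum_mem fun v u' h' => sum_mem fun a _ => usmul_mem _ ?_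
  have := h𝒬 (hf (u ++ a :: u')) (hδ a v)
  rw [← h, ← h']
  simp only [wdeg_append, wdeg_cons] at this ⊢
  rwa [show n + s - (wdeg wt u + (wdeg wt v + wdeg wt u')) =
    n - (wdeg wt u + (wt a + wdeg wt u')) + (wt a + s - wdeg wt v) by ring]

variable {deg : A → ℤ} {δ : A → List A → K}

/-- The Leibniz rule for a letter; the general rule follows from it by density. -/
theorem oddDer_letter_mul (hδ : Adm δ) (a : A) (g : List A → K) :
    oddDer deg δ (mul (letter K a) g) =
      mul (δ a) g + (deg a).negOnePow • mul (letter K a) (oddDer deg δ g) := by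
  have key : ∀ v u' : List A, ∑ b ∈ lettersAt δ v, mul (letter K a) g (b :: u') * δ b v =
      δ a v * g u' := by
    intro v u'
    rw [Finset.sum_eq_single a]
    · rw [letter_mul_cons_self, mul_comm]
    · intro b _ hb
      rw [letter_mul_cons_of_ne hb, zero_mul]
    · intro ha
      rw [hδ.mem_lettersAt, not_not] at ha
      rw [ha, mul_zero]
  funext w
  cases w with
  | nil =>
    rw [oddDer_apply, splitSum_nil, splitSum_nil, Pi.add_apply, Pi.smul_apply, letter_mul_nil,
      smul_zero, add_zero, mul_apply, splitSum_nil, ← key]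
    simp [wdeg_nil]
  | cons c w =>
    rw [oddDer_apply, splitSum_cons, Pi.add_apply, Pi.smul_apply]
    simp only [wdeg_nil, Int.negOnePow_zero, one_smul, List.nil_append, key]
    rw [← mul_apply]
    congr 1
    by_cases h : c = a
    · subst h
      rw [letter_mul_cons_self, oddDer_apply, smul_splitSum]
      refine splitSum_congr fun u r _ => ?_
      rw [smul_splitSum]
      refine splitSum_congr fun v u' _ => ?_
      rw [Finset.smul_sum]
      refine Finset.sum_congr rfl fun b _ => ?_
      rw [List.cons_append, letter_mul_cons_self, wdeg_cons, Int.negOnePow_add, smul_smul]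
    · rw [letter_mul_cons_of_ne h, smul_zero]
      refine splitSum_eq_zero fun u r _ => splitSum_eq_zero fun v u' _ =>
        Finset.sum_eq_zero fun b _ => ?_
      rw [List.cons_append, letter_mul_cons_of_ne h, zero_mul, smul_zero]

theorem oddDer_word_nil : oddDer deg δ (word K []) = 0 := by
  funext w
  rw [oddDer_apply]
  refine splitSum_eq_zero fun u r _ => splitSum_eq_zero fun v u' _ =>
    Finset.sum_eq_zero fun b _ => ?_
  rw [word_apply_of_ne (by simp), zero_mul, smul_zero]

theorem oddDer_letter (hδ : Adm δ) (a : A) : oddDer deg δ (letter K a) = δ a := by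
  have := oddDer_letter_mul (deg := deg) hδ a (word K [])
  rwa [mul_word_nil, mul_word_nil, oddDer_word_nil, mul_zero', smul_zero, add_zero] at this

theorem parity_letter (a : A) : parity deg (letter K a) = (deg a).negOnePow • letter K a :=
  (letter_hasPar a).parity_eq

theorem parity_word_nil : parity deg (word K ([] : List A)) = word K [] := by
  have : HasPar deg 0 (word K ([] : List A)) := word_mem_homog one_mem_evenSub []
  rw [this.parity_eq, Int.negOnePow_zero, one_smul]

theorem parity_oddDer (hδ : ∀ a, HasPar deg (deg a + 1) (δ a)) (f : List A → K) :
    oddDer deg δ (parity deg f) = -parity deg (oddDer deg δ f) := by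
  funext w
  rw [Pi.neg_apply, parity, oddDer_apply, oddDer_apply, smul_splitSum, neg_splitSum]
  refine splitSum_congr fun u r h => ?_
  rw [smul_splitSum, neg_splitSum]
  refine splitSum_congr fun v u' h' => ?_
  rw [Finset.smul_sum, ← Finset.sum_neg_distrib]
  refine Finset.sum_congr rfl fun a _ => ?_
  by_cases hv : δ a v = 0
  · simp [hv]
  have := (hδ a).negOnePow_eq hv
  rw [parity, ← h, ← h', wdeg_append, wdeg_append, wdeg_append, wdeg_cons]
  simp only [Int.negOnePow_add, this, smul_mul_assoc, smul_smul, Int.negOnePow_one]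
  generalize (wdeg deg u).negOnePow = x
  generalize (wdeg deg u').negOnePow = y
  generalize (deg a).negOnePow = z
  rcases Int.units_eq_one_or x with rfl | rfl <;> rcases Int.units_eq_one_or y with rfl | rfl <;>
  rcases Int.units_eq_one_or z with rfl | rfl <;> simp

section Topology

variable [TopologicalSpace K] [DiscreteTopology K]

theorem adm_iff_tendsto {X : Type*} {δ : X → List A → K} :
    Adm δ ↔ Filter.Tendsto δ Filter.cofinite (nhds 0) := by
  rw [tendsto_pi_nhds]
  refine forall_congr' fun v => ?_
  rw [nhds_discrete, Filter.tendsto_pure, Filter.eventually_cofinite]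
  rfl

theorem continuous_oddDer (deg : A → ℤ) (δ : A → List A → K) : Continuous (oddDer deg δ) := by
  refine continuous_pi fun w => ?_
  simp only [oddDer_apply]
  exact continuous_splitSum fun u r => continuous_splitSum fun v u' =>
    continuous_finsetSum _ fun a _ => continuous_usmul ((continuous_apply _).mul continuous_const) _

theorem map_usmul {E F : Type*} [AddCommGroup E] [AddCommGroup F] [Module K E] [Module K F]
    (φ : E →ₗ[K] F) (c : ℤˣ) (x : E) : φ (c • x) = c • φ x := by
  rcases Int.units_eq_one_or c with rfl | rfl <;> simp

/-- Continuous odd derivations of the algebra of power series. -/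
structure IsOddDer (deg : A → ℤ) (D : (List A → K) →ₗ[K] (List A → K)) : Prop where
  cont : Continuous D
  leib : ∀ f g, D (mul f g) = mul (D f) g + mul (parity deg f) (D g)
  par : ∀ f, D (parity deg f) = -parity deg (D f)
  hasPar : ∀ {p f}, HasPar deg p f → HasPar deg (p + 1) (D f)

theorem isOddDer_oddDer (hδ : Adm δ) (hp : ∀ a, HasPar deg (deg a + 1) (δ a)) :
    IsOddDer deg (oddDer deg δ) where
  cont := continuous_oddDer _ _
  leib f g := by
    refine eq_of_words (Φ := oddDer deg δ ∘ₗ mulB.flip g)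
      (Ψ := mulB.flip g ∘ₗ oddDer deg δ + mulB.flip (oddDer deg δ g) ∘ₗ parityL deg) ?_ ?_ ?_ f
    · exact (continuous_oddDer deg δ).comp (continuous_mul_left g)
    · exact ((continuous_mul_left g).comp (continuous_oddDer deg δ)).add
        ((continuous_mul_left _).comp (continuous_parityL deg))
    · intro w
      change oddDer deg δ (mul (word K w) g) = mul (oddDer deg δ (word K w)) g +
        mul (parity deg (word K w)) (oddDer deg δ g)
      induction w with
      | nil => rw [parity_word_nil, word_nil_mul, word_nil_mul, oddDer_word_nil, zero_mul',
          zero_add]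
      | cons a w ih =>
        rw [← letter_mul_word, mul_assoc', oddDer_letter_mul hδ, ih, oddDer_letter_mul hδ,
          parity_mul, parity_letter]
        simp only [add_mul', mul_add', mul_assoc', usmul_mul, smul_add, add_assoc]
  par := parity_oddDer hp
  hasPar := oddDer_mem_homog evenSub_isMul hp

namespace IsOddDer

variable {D D₁ D₂ : (List A → K) →ₗ[K] (List A → K)}

theorem map_one (h : IsOddDer deg D) : D (word K []) = 0 := by
  have := h.leib (word K []) (word K [])
  rw [word_nil_mul, mul_word_nil, parity_word_nil, word_nil_mul] at this
  simpa using this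

theorem letter_mul (h : IsOddDer deg D) (a : A) (g : List A → K) :
    D (mul (letter K a) g) =
      mul (D (letter K a)) g + (deg a).negOnePow • mul (letter K a) (D g) := by
  rw [h.leib, parity_letter, usmul_mul]

/-- The graded commutator of two odd derivations is a derivation, so it vanishes as soon as it
vanishes on letters. -/
theorem anticomm (h₁ : IsOddDer deg D₁) (h₂ : IsOddDer deg D₂)
    (h : ∀ a, D₁ (D₂ (letter K a)) + D₂ (D₁ (letter K a)) = 0) (f : List A → K) :
    D₁ (D₂ f) + D₂ (D₁ f) = 0 := by
  refine eq_of_words (Φ := D₁ ∘ₗ D₂ + D₂ ∘ₗ D₁) (Ψ := 0)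
    ((h₁.cont.comp h₂.cont).add (h₂.cont.comp h₁.cont)) continuous_zero ?_ f
  intro w
  change D₁ (D₂ (word K w)) + D₂ (D₁ (word K w)) = 0
  induction w with
  | nil => rw [h₁.map_one, h₂.map_one, map_zero, map_zero, add_zero]
  | cons a w ih =>
    have e1 : D₁ (parity deg (letter K a)) = -parity deg (D₁ (letter K a)) := h₁.par _
    have e2 : D₂ (parity deg (letter K a)) = -parity deg (D₂ (letter K a)) := h₂.par _
    rw [← letter_mul_word, h₁.leib, h₂.leib, map_add, map_add, h₁.leib, h₁.leib, h₂.leib, h₂.leib,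
      e1, e2, parity_parity, neg_mul', neg_mul']
    have : mul (D₁ (D₂ (letter K a))) (word K w) + mul (letter K a) (D₁ (D₂ (word K w))) +
        (mul (D₂ (D₁ (letter K a))) (word K w) + mul (letter K a) (D₂ (D₁ (word K w)))) = 0 := by
      rw [add_add_add_comm, ← add_mul', ← mul_add', ih, h, zero_mul', mul_zero', add_zero]
    rw [← this]
    abel

theorem bracket {f g : List A → K} {p q : ℤ} (h : IsOddDer deg D) (hf : HasPar deg p f)
    (hg : HasPar deg q g) :
    D (CInf.bracket deg f g) = CInf.bracket deg (D f) g +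
      p.negOnePow • CInf.bracket deg f (D g) := by
  rw [hf.bracket_eq hg, (h.hasPar hf).bracket_eq hg, hf.bracket_eq (h.hasPar hg), map_sub, h.leib,
    hf.parity_eq, add_mul, mul_add, Int.negOnePow_add, Int.negOnePow_add, one_mul, mul_one]
  have : D ((p * q).negOnePow • mul g f) = (p * q).negOnePow • (mul (D g) f +
      q.negOnePow • mul g (D f)) := by
    rw [map_usmul, h.leib, hg.parity_eq, usmul_mul]
  rw [this]
  generalize (p * q).negOnePow = a
  generalize p.negOnePow = b
  generalize q.negOnePow = c
  simp only [usmul_mul, smul_sub, smul_smul]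
  rcases Int.units_eq_one_or a with rfl | rfl <;> rcases Int.units_eq_one_or b with rfl | rfl <;>
  rcases Int.units_eq_one_or c with rfl | rfl <;> simp <;> abel

theorem mem_freeLie (h : IsOddDer deg D) (hD : ∀ a, D (letter K a) ∈ freeLie K deg)
    {f : List A → K} (hf : f ∈ freeLie K deg) : D f ∈ freeLie K deg := by
  refine freeLie_le (Z := (freeLie K deg).comap D) ((isClosed_freeLie deg).preimage h.cont) ?_ hf
  intro f hf
  change D f ∈ freeLie K deg
  induction hf with
  | letter a => exact hD a
  | bracket hf hg h1 h2 =>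
    obtain ⟨p, hp⟩ := hf.exists_hasPar
    obtain ⟨q, hq⟩ := hg.exists_hasPar
    rw [h.bracket hp hq]
    exact add_mem (bracket_mem h1 hg.mem_freeLie)
      (usmul_mem (S := (freeLie K deg).toAddSubgroup) _ (bracket_mem hf.mem_freeLie h2))

end IsOddDer

/-- Odd derivations are intertwined by a multiplicative map as soon as they are on letters. -/
theorem intertwine {degB : B → ℤ} {D : (List A → K) →ₗ[K] (List A → K)}
    {E : (List B → K) →ₗ[K] (List B → K)} (hD : IsOddDer deg D) (hE : IsOddDer degB E)
    {φ : (List A → K) →ₗ[K] (List B → K)} (hφ : Continuous φ) (h1 : φ (word K []) = word K [])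
    (hmul : ∀ f g, φ (mul f g) = mul (φ f) (φ g))
    (hpar : ∀ f, φ (parity deg f) = parity degB (φ f))
    (h : ∀ a, φ (D (letter K a)) = E (φ (letter K a))) (f : List A → K) : φ (D f) = E (φ f) := by
  refine eq_of_words (Φ := φ ∘ₗ D) (Ψ := E ∘ₗ φ) (hφ.comp hD.cont) (hE.cont.comp hφ) ?_ f
  intro w
  change φ (D (word K w)) = E (φ (word K w))
  induction w with
  | nil => rw [h1, hD.map_one, hE.map_one, map_zero]
  | cons a w ih => rw [← letter_mul_word, hD.leib, hmul, hE.leib, map_add, hmul, hmul, hpar, h, ih]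

/-! ### Odd operators on the completed tensor square -/

variable {D D₁ D₂ : (List A → K) →ₗ[K] (List A → K)}

theorem tensorOdd_tmul (deg : A → ℤ) (D : (List A → K) →ₗ[K] (List A → K)) (x y : List A → K) :
    tensorOdd deg D (tmul x y) = tmul (D x) y + tmul (parity deg x) (D y) := by
  funext p
  have e1 : (fun u => tmul x y (u, p.2)) = y p.2 • x := by
    funext u; simp [tmul, mul_comm]
  have e2 : (fun v => tmul x y (p.1, v)) = x p.1 • y := by
    funext u; simp [tmul]
  change D (fun u => tmul x y (u, p.2)) p.1 +
    (wdeg deg p.1).negOnePow • D (fun v => tmul x y (p.1, v)) p.2 = _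
  rw [e1, e2, map_smul, map_smul]
  simp [tmul, parity, mul_comm, smul_mul_assoc]

theorem continuous_tensorOdd (deg : A → ℤ) (hD : Continuous D) : Continuous (tensorOdd deg D) := by
  refine continuous_pi fun p => ?_
  have h1 : Continuous fun F : List A × List A → K => fun u => F (u, p.2) :=
    continuous_pi fun u => continuous_apply (u, p.2)
  have h2 : Continuous fun F : List A × List A → K => fun v => F (p.1, v) :=
    continuous_pi fun v => continuous_apply (p.1, v)
  exact ((continuous_apply _).comp (hD.comp h1)).add
    (continuous_usmul ((continuous_apply _).comp (hD.comp h2)) _)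

theorem tensorOdd_mem_tensorHomog {𝒬 : ℤ → AddSubgroup K} {wt deg : A → ℤ} {s : ℤ}
    (hD : ∀ n, ∀ f ∈ homog 𝒬 wt n, D f ∈ homog 𝒬 wt (n + s)) {n : ℤ} {F : List A × List A → K}
    (hF : F ∈ tensorHomog 𝒬 wt n) : tensorOdd deg D F ∈ tensorHomog 𝒬 wt (n + s) := by
  intro p
  refine add_mem ?_ (usmul_mem _ ?_)
  · have : (fun u => F (u, p.2)) ∈ homog 𝒬 wt (n - wdeg wt p.2) := fun u => by
      rw [sub_right_comm]; exact hF (u, p.2)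
    have := hD _ _ this p.1
    rwa [show n - wdeg wt p.2 + s - wdeg wt p.1 = n + s - wdeg wt p.1 - wdeg wt p.2 by ring] at this
  · have : (fun v => F (p.1, v)) ∈ homog 𝒬 wt (n - wdeg wt p.1) := fun v => hF (p.1, v)
    have := hD _ _ this p.2
    rwa [show n - wdeg wt p.1 + s - wdeg wt p.2 = n + s - wdeg wt p.1 - wdeg wt p.2 by ring] at this

theorem tensorMul_tensorOdd (h : IsOddDer deg D) (F : List A × List A → K) :
    tensorMul (tensorOdd deg D F) = D (tensorMul F) := by
  refine eq_of_tmul (Φ := tensorMul ∘ₗ tensorOdd deg D) (Ψ := D ∘ₗ tensorMul)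
    (continuous_tensorMul.comp (continuous_tensorOdd deg h.cont))
    (h.cont.comp continuous_tensorMul) (fun x y => ?_) F
  change tensorMul (tensorOdd deg D (tmul x y)) = D (tensorMul (tmul x y))
  rw [tensorOdd_tmul, map_add, tensorMul_tmul, tensorMul_tmul, tensorMul_tmul, h.leib]

theorem tmul_neg_left (x y : List A → K) : tmul (-x) y = -tmul x y := LinearMap.map_neg₂ tmulB x y
theorem tmul_add_left (x x' y : List A → K) : tmul (x + x') y = tmul x y + tmul x' y :=
  LinearMap.map_add₂ tmulB x x' y
theorem tmul_add_right (x y y' : List A → K) : tmul x (y + y') = tmul x y + tmul x y' :=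
  (tmulB x).map_add y y'
theorem tmul_sub_left (x x' y : List A → K) : tmul (x - x') y = tmul x y - tmul x' y :=
  LinearMap.map_sub₂ tmulB x x' y
theorem tmul_usmul_left (c : ℤˣ) (x y : List A → K) : tmul (c • x) y = c • tmul x y := by
  rcases Int.units_eq_one_or c with rfl | rfl <;> simp [tmul_neg_left]
theorem tmul_usmul_right (c : ℤˣ) (x y : List A → K) : tmul x (c • y) = c • tmul x y := by
  rcases Int.units_eq_one_or c with rfl | rfl
  · simp
  · rw [Units.neg_smul, one_smul, Units.neg_smul, one_smul]
    exact (tmulB x).map_neg y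

theorem tensorOdd_anticomm (h₁ : IsOddDer deg D₁) (h₂ : IsOddDer deg D₂)
    (h : ∀ f, D₁ (D₂ f) + D₂ (D₁ f) = 0) (F : List A × List A → K) :
    tensorOdd deg D₁ (tensorOdd deg D₂ F) + tensorOdd deg D₂ (tensorOdd deg D₁ F) = 0 := by
  have c1 := continuous_tensorOdd deg h₁.cont
  have c2 := continuous_tensorOdd deg h₂.cont
  refine eq_of_tmul (Φ := tensorOdd deg D₁ ∘ₗ tensorOdd deg D₂ +
    tensorOdd deg D₂ ∘ₗ tensorOdd deg D₁) (Ψ := 0) ((c1.comp c2).add (c2.comp c1))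
    continuous_zero (fun x y => ?_) F
  change tensorOdd deg D₁ (tensorOdd deg D₂ (tmul x y)) +
    tensorOdd deg D₂ (tensorOdd deg D₁ (tmul x y)) = 0
  simp only [tensorOdd_tmul, map_add, h₁.par, h₂.par, parity_parity, tmul_neg_left]
  have : tmul (D₁ (D₂ x) + D₂ (D₁ x)) y + tmul x (D₁ (D₂ y) + D₂ (D₁ y)) = 0 := by
    rw [h, h, ← tmulB_apply, ← tmulB_apply, map_zero, map_zero, LinearMap.zero_apply, add_zero]
  rw [tmul_add_left, tmul_add_right] at this
  rw [← this]
  abel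

theorem parity_mem_freeLie {f : List A → K} (hf : f ∈ freeLie K deg) :
    parity deg f ∈ freeLie K deg := by
  refine freeLie_le (Z := (freeLie K deg).comap (parityL deg))
    ((isClosed_freeLie deg).preimage (continuous_parityL deg)) (fun f hf => ?_) hf
  obtain ⟨p, hp⟩ := hf.exists_hasPar
  change parity deg f ∈ freeLie K deg
  rw [hp.parity_eq]
  exact usmul_mem (S := (freeLie K deg).toAddSubgroup) _ hf.mem_freeLie

theorem tensorOdd_mem_lieTensor (h : IsOddDer deg D) (hD : ∀ a, D (letter K a) ∈ freeLie K deg)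
    {F : List A × List A → K} (hF : F ∈ lieTensor K deg) : tensorOdd deg D F ∈ lieTensor K deg := by
  refine lieTensor_le (Z := (lieTensor K deg).comap (tensorOdd deg D))
    ((isClosed_lieTensor deg).preimage (continuous_tensorOdd deg h.cont)) (fun x y hx hy => ?_) hF
  change tensorOdd deg D (tmul x y) ∈ lieTensor K deg
  rw [tensorOdd_tmul]
  exact add_mem (tmul_mem_lieTensor (h.mem_freeLie hD hx.mem_freeLie) hy.mem_freeLie)
    (tmul_mem_lieTensor (parity_mem_freeLie hx.mem_freeLie) (h.mem_freeLie hD hy.mem_freeLie))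

theorem tensorOdd_mem_lieRel (h : IsOddDer deg D) (hD : ∀ a, D (letter K a) ∈ freeLie K deg)
    {F : List A × List A → K} (hF : F ∈ lieRel K deg) : tensorOdd deg D F ∈ lieRel K deg := by
  refine lieRel_le (Z := (lieRel K deg).comap (tensorOdd deg D))
    ((isClosed_lieRel deg).preimage (continuous_tensorOdd deg h.cont))
    (fun x y hx hy => ?_) (fun x y z hx hy hz => ?_) hF
  · change tensorOdd deg D (tmul x y - swap deg (tmul x y)) ∈ lieRel K deg
    obtain ⟨p, px⟩ := hx.exists_hasPar
    obtain ⟨q, py⟩ := hy.exists_hasPar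
    have r1 := swap_mem_lieRel (h.mem_freeLie hD hx.mem_freeLie) hy.mem_freeLie (h.hasPar px) py
    have r2 := swap_mem_lieRel hx.mem_freeLie (h.mem_freeLie hD hy.mem_freeLie) px (h.hasPar py)
    rw [px.swap_tmul py, map_sub, map_usmul, tensorOdd_tmul, tensorOdd_tmul, px.parity_eq,
      py.parity_eq, tmul_usmul_left, tmul_usmul_left]
    rw [add_mul, one_mul, Int.negOnePow_add] at r1
    rw [mul_add, mul_one, Int.negOnePow_add] at r2
    convert add_mem r1 (usmul_mem (S := (lieRel K deg).toAddSubgroup) p.negOnePow r2) using 1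
    generalize (p * q).negOnePow = a
    generalize p.negOnePow = b
    generalize q.negOnePow = c
    simp only [smul_sub, smul_smul]
    rcases Int.units_eq_one_or a with rfl | rfl <;> rcases Int.units_eq_one_or b with rfl | rfl <;>
    rcases Int.units_eq_one_or c with rfl | rfl <;> simp <;> abel
  · change tensorOdd deg D (tmul x (bracket deg y z) - tmul (bracket deg x y) z) ∈ lieRel K deg
    obtain ⟨p, px⟩ := hx.exists_hasPar
    obtain ⟨q, py⟩ := hy.exists_hasPar
    obtain ⟨r, pz⟩ := hz.exists_hasPar
    have r1 := invariance_mem_lieRel (h.mem_freeLie hD hx.mem_freeLie) hy.mem_freeLie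
      hz.mem_freeLie
    have r2 := invariance_mem_lieRel hx.mem_freeLie (h.mem_freeLie hD hy.mem_freeLie)
      hz.mem_freeLie
    have r3 := invariance_mem_lieRel hx.mem_freeLie hy.mem_freeLie
      (h.mem_freeLie hD hz.mem_freeLie)
    rw [map_sub, tensorOdd_tmul, tensorOdd_tmul, px.parity_eq, (px.bracket py).parity_eq,
      h.bracket px py, h.bracket py pz]
    simp only [tmul_usmul_left, tmul_add_left, tmul_add_right, tmul_usmul_right,
      Int.negOnePow_add]
    convert add_mem r1 (add_mem (usmul_mem (S := (lieRel K deg).toAddSubgroup) p.negOnePow r2)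
      (usmul_mem (S := (lieRel K deg).toAddSubgroup) (p.negOnePow * q.negOnePow) r3)) using 1
    generalize p.negOnePow = b
    generalize q.negOnePow = c
    simp only [smul_sub, smul_smul]
    rcases Int.units_eq_one_or b with rfl | rfl <;>
    rcases Int.units_eq_one_or c with rfl | rfl <;> simp <;> abel

end Topology

end OddDer

/-! ### Functions and forms -/

section Forms

variable {K I : Type*} [CommRing K] {d : I → ℤ}

theorem wdeg_fdeg_map_inl (w : List I) : wdeg (fdeg d) (w.map Sum.inl) = wdeg (tdeg d) w := by
  simp [wdeg, fdeg, Function.comp_def]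

theorem formDeg_map_inl (w : List I) : formDeg (w.map (Sum.inl : I → I ⊕ I)) = 0 := by
  simp [formDeg, List.countP_eq_zero]

theorem exists_eq_map_inl {w : List (I ⊕ I)} (h : formDeg w = 0) :
    ∃ v : List I, w = v.map Sum.inl := by
  induction w with
  | nil => exact ⟨[], rfl⟩
  | cons a w ih =>
    rw [formDeg, List.countP_cons] at h
    obtain ⟨v, rfl⟩ := ih (by rw [formDeg]; omega)
    cases a with
    | inl i => exact ⟨i :: v, rfl⟩
    | inr i => simp at h

theorem incl_map (f : List I → K) (w : List I) : incl f (w.map Sum.inl) = f w := by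
  rw [incl, if_pos (formDeg_map_inl w), List.filterMap_map]
  congr 1
  exact List.filterMap_some

theorem incl_of_ne (f : List I → K) {w : List (I ⊕ I)} (h : formDeg w ≠ 0) : incl f w = 0 :=
  if_neg h

theorem formDeg_append (v w : List (I ⊕ I)) : formDeg (v ++ w) = formDeg v + formDeg w :=
  List.countP_append

theorem formDeg_cons_inl (i : I) (w : List (I ⊕ I)) : formDeg (Sum.inl i :: w) = formDeg w := by
  simp [formDeg]

theorem formDeg_cons_inr (i : I) (w : List (I ⊕ I)) :
    formDeg (Sum.inr i :: w) = formDeg w + 1 := by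
  rw [formDeg, formDeg, List.countP_cons, if_pos (by rfl)]

/-- The form degree, as a weight of letters. -/
def formWt : I ⊕ I → ℤ := Sum.elim (fun _ => 0) fun _ => 1

theorem wdeg_formWt (w : List (I ⊕ I)) : wdeg formWt w = formDeg w := by
  induction w with
  | nil => rfl
  | cons a w ih =>
    rw [wdeg_cons, ih]
    cases a with
    | inl i => simp [formDeg_cons_inl, formWt]
    | inr i => simp [formDeg_cons_inr, formWt, add_comm]

/-- The inclusion of functions into forms, as a linear map. -/
def inclL : (List I → K) →ₗ[K] (List (I ⊕ I) → K) where
  toFun := incl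
  map_add' f g := by
    funext w; simp only [incl, Pi.add_apply]; split_ifs <;> simp
  map_smul' c f := by
    funext w; simp only [incl, Pi.smul_apply, RingHom.id_apply]; split_ifs <;> simp

theorem inclL_apply (f : List I → K) : inclL f = incl f := rfl

theorem incl_add (f g : List I → K) : incl (f + g) = incl f + incl g := inclL.map_add f g
theorem incl_smul (c : K) (f : List I → K) : incl (c • f) = c • incl f := inclL.map_smul c f
theorem incl_zero : incl (0 : List I → K) = 0 := inclL.map_zero
theorem incl_neg (f : List I → K) : incl (-f) = -incl f := inclL.map_neg f

theorem incl_mul (f g : List I → K) : incl (mul f g) = mul (incl f) (incl g) := by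
  funext w
  by_cases h : formDeg w = 0
  · obtain ⟨v, rfl⟩ := exists_eq_map_inl h
    rw [incl_map, mul_apply, mul_apply, splitSum_map]
    simp only [incl_map]
  · rw [incl_of_ne _ h, mul_apply]
    refine (splitSum_eq_zero fun u v huv => ?_).symm
    rw [← huv, formDeg_append] at h
    by_cases hu : formDeg u = 0
    · rw [incl_of_ne g (w := v) (by omega), mul_zero]
    · rw [incl_of_ne f hu, zero_mul]

theorem incl_parity (f : List I → K) : incl (parity (tdeg d) f) = parity (fdeg d) (incl f) := by
  funext w
  by_cases h : formDeg w = 0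
  · obtain ⟨v, rfl⟩ := exists_eq_map_inl h
    rw [incl_map, parity, parity, incl_map, wdeg_fdeg_map_inl]
  · rw [incl_of_ne _ h, parity, incl_of_ne _ h, smul_zero]

theorem incl_word (w : List I) : incl (word K w) = word K (w.map Sum.inl) := by
  funext v
  by_cases h : formDeg v = 0
  · obtain ⟨v, rfl⟩ := exists_eq_map_inl h
    rw [incl_map]
    by_cases hv : v = w
    · rw [hv, word_apply_self, word_apply_self]
    · rw [word_apply_of_ne hv, word_apply_of_ne]
      exact fun h => hv (List.map_injective_iff.2 Sum.inl_injective h)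
  · rw [incl_of_ne _ h, word_apply_of_ne]
    rintro rfl
    exact h (formDeg_map_inl w)

theorem incl_letter (i : I) : incl (letter K i) = letter K (Sum.inl i) := by
  rw [letter_eq_word, incl_word, letter_eq_word]; rfl

theorem incl_mem_homog {𝒬 : ℤ → AddSubgroup K} {wt : I ⊕ I → ℤ} {n : ℤ} {f : List I → K}
    (hf : f ∈ homog 𝒬 (fun i => wt (Sum.inl i)) n) : incl f ∈ homog 𝒬 wt n := by
  intro w
  by_cases h : formDeg w = 0
  · obtain ⟨v, rfl⟩ := exists_eq_map_inl h
    rw [incl_map]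
    convert hf v using 3
    simp [wdeg, Function.comp_def]
  · rw [incl_of_ne _ h]
    exact zero_mem _

theorem incl_mem_formWt (f : List I → K) : incl f ∈ homog (zeroSub K) formWt 0 := by
  intro w hw
  rw [wdeg_formWt] at hw
  exact incl_of_ne f (by omega)

theorem incl_bracket (f g : List I → K) :
    incl (bracket (tdeg d) f g) = bracket (fdeg d) (incl f) (incl g) := by
  funext w
  rw [bracket_eq_tensorMul (fdeg d), Pi.sub_apply]
  by_cases h : formDeg w = 0
  · obtain ⟨v, rfl⟩ := exists_eq_map_inl h
    rw [incl_map, bracket_eq_tensorMul, Pi.sub_apply]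
    simp only [tensorMul_apply, splitSum_map, tmul, swap, incl_map, wdeg_fdeg_map_inl]
  · rw [incl_of_ne _ h, tensorMul_apply, tensorMul_apply, splitSum_eq_zero, splitSum_eq_zero,
      sub_zero]
    · intro u v huv
      rw [← huv, formDeg_append] at h
      by_cases hu : formDeg u = 0
      · simp [swap, tmul, incl_of_ne f (w := v) (by omega)]
      · simp [swap, tmul, incl_of_ne g hu]
    · intro u v huv
      rw [← huv, formDeg_append] at h
      by_cases hu : formDeg u = 0
      · simp [tmul, incl_of_ne g (w := v) (by omega)]
      · simp [tmul, incl_of_ne f hu]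

/-- Forms of degree `0` among Lie monomials are functions. -/
theorem MonOf.eq_incl {s : Multiset (I ⊕ I)} {x : List (I ⊕ I) → K} (hx : MonOf K (fdeg d) s x)
    (hs : s.countP (fun a => a.isRight = true) = 0) :
    ∃ t y, MonOf K (tdeg d) t y ∧ x = incl y ∧ s.card = t.card := by
  induction hx with
  | letter a =>
    cases a with
    | inl i => exact ⟨_, _, .letter i, (incl_letter i).symm, rfl⟩
    | inr i =>
      rw [Multiset.countP_eq_zero] at hs
      exact absurd rfl (hs (Sum.inr i) (by simp))
  | bracket _ _ h1 h2 =>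
    rw [Multiset.countP_add] at hs
    obtain ⟨t, y, hy, rfl, e1⟩ := h1 (by omega)
    obtain ⟨t', y', hy', rfl, e2⟩ := h2 (by omega)
    exact ⟨_, _, hy.bracket hy', (incl_bracket _ _).symm, by simp [e1, e2]⟩

section Topology

variable [TopologicalSpace K] [DiscreteTopology K]

theorem continuous_inclL : Continuous (inclL : (List I → K) →ₗ[K] _) := by
  refine continuous_pi fun w => ?_
  by_cases h : formDeg w = 0
  · have : (fun f : List I → K => inclL f w) = fun f => f (w.filterMap Sum.getLeft?) := by
      funext f
      exact if_pos h
    rw [this]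
    exact continuous_apply _
  · have : (fun f : List I → K => inclL f w) = fun _ => 0 := by
      funext f
      exact if_neg h
    rw [this]
    exact continuous_const

theorem incl_mem_freeLie {f : List I → K} (hf : f ∈ freeLie K (tdeg d)) :
    incl f ∈ freeLie K (fdeg d) := by
  refine freeLie_le (Z := (freeLie K (fdeg d)).comap inclL)
    ((isClosed_freeLie _).preimage continuous_inclL) (fun f hf => ?_) hf
  change incl f ∈ freeLie K (fdeg d)
  induction hf with
  | letter a => rw [incl_letter]; exact letter_mem _ _
  | bracket _ _ h1 h2 => rw [incl_bracket]; exact bracket_mem h1 h2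

theorem adm_dForm : Adm (Sum.elim (fun i => letter K (Sum.inr i)) fun _ => 0 :
    I ⊕ I → List (I ⊕ I) → K) := by
  intro v
  refine Set.Subsingleton.finite ?_
  rintro (i | i) hi (j | j) hj
  · have e : ∀ k : I, letter K (Sum.inr k : I ⊕ I) v ≠ 0 → v = [Sum.inr k] := fun k h => by
      by_contra h'
      exact h (letter_apply_of_ne h')
    have := (e i hi).symm.trans (e j hj)
    simpa using this
  · exact absurd rfl hj
  · exact absurd rfl hi
  · exact absurd rfl hi

theorem dForm_letter_mem {𝒬 : ℤ → AddSubgroup K} {wt : I ⊕ I → ℤ} {s : ℤ} (h1 : (1 : K) ∈ 𝒬 0)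
    (hwt : ∀ i, wt (Sum.inr i) = wt (Sum.inl i) + s) (a : I ⊕ I) :
    (Sum.elim (fun i => letter K (Sum.inr i)) fun _ => 0 : I ⊕ I → List (I ⊕ I) → K) a ∈
      homog 𝒬 wt (wt a + s) := by
  cases a with
  | inl i => rw [← hwt]; exact letter_mem_homog h1 (Sum.inr i)
  | inr i => exact zero_mem _

theorem isOddDer_dForm : IsOddDer (fdeg d) (dForm K d) :=
  isOddDer_oddDer adm_dForm (dForm_letter_mem one_mem_evenSub fun _ => rfl)

theorem dForm_letter_inl (i : I) : dForm K d (letter K (Sum.inl i)) = letter K (Sum.inr i) :=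
  oddDer_letter adm_dForm _

theorem dForm_letter_inr (i : I) : dForm K d (letter K (Sum.inr i)) = 0 :=
  oddDer_letter adm_dForm _

theorem dForm_letter_mem_freeLie (a : I ⊕ I) : dForm K d (letter K a) ∈ freeLie K (fdeg d) := by
  cases a with
  | inl i => rw [dForm_letter_inl]; exact letter_mem _ _
  | inr i => rw [dForm_letter_inr]; exact zero_mem _

theorem dForm_mem_homog {𝒬 : ℤ → AddSubgroup K} (h𝒬 : IsMul 𝒬) (h1 : (1 : K) ∈ 𝒬 0)
    {wt : I ⊕ I → ℤ} {s : ℤ} (hwt : ∀ i, wt (Sum.inr i) = wt (Sum.inl i) + s) (n : ℤ)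
    (f : List (I ⊕ I) → K) (hf : f ∈ homog 𝒬 wt n) : dForm K d f ∈ homog 𝒬 wt (n + s) :=
  oddDer_mem_homog h𝒬 (dForm_letter_mem h1 hwt) hf

theorem eq_zero_of_add_self [Algebra ℚ K] {X : Type*} {f : X → K} (h : f + f = 0) : f = 0 := by
  funext x
  have h2 := congrFun h x
  simp only [Pi.add_apply, Pi.zero_apply] at h2
  rw [← two_smul ℚ] at h2
  have := congrArg (fun y => (2 : ℚ)⁻¹ • y) h2
  simpa using this

theorem dForm_dForm [Algebra ℚ K] (f : List (I ⊕ I) → K) : dForm K d (dForm K d f) = 0 := by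
  refine eq_zero_of_add_self (isOddDer_dForm.anticomm isOddDer_dForm (fun a => ?_) f)
  cases a with
  | inl i => rw [dForm_letter_inl, dForm_letter_inr, add_zero]
  | inr i => rw [dForm_letter_inr, map_zero, add_zero]

end Topology

end Forms

/-! ### The vector field and its Lie derivative -/

section VectorField

variable {K I : Type*} [CommRing K] [TopologicalSpace K] [DiscreteTopology K]
  {𝒜 : ℤ → AddSubgroup K} {d : I → ℤ}

theorem tendsto_gen (d : I → ℤ) :
    Filter.Tendsto (gen (K := K) (tdeg d)) Filter.cofinite (nhds 0) := by
  rw [tendsto_subtype_rng]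
  refine adm_iff_tendsto.1 fun v => ?_
  refine Set.Subsingleton.finite fun i hi j hj => ?_
  have e : ∀ k : I, letter K k v ≠ 0 → v = [k] := fun k h => by
    by_contra h'
    exact h (letter_apply_of_ne h')
  simpa using (e i hi).symm.trans (e j hj)

theorem adm_onGen (M : CInftyStructure 𝒜 d) : Adm M.onGen := by
  rw [adm_iff_tendsto]
  have h1 := (M.m.continuous.tendsto 0).comp (tendsto_gen (K := K) d)
  rw [map_zero] at h1
  exact (continuous_subtype_val.tendsto _).comp h1

theorem le_evenSub (h_even : ∀ n : ℤ, Odd n → 𝒜 n = ⊥) (n : ℤ) : 𝒜 n ≤ evenSub K n := by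
  intro x hx hn
  rw [Int.not_even_iff_odd] at hn
  rw [h_even n hn] at hx
  exact hx

theorem hasPar_of_mem_homog {A : Type*} {deg : A → ℤ} (h_even : ∀ n : ℤ, Odd n → 𝒜 n = ⊥) {n : ℤ}
    {f : List A → K} (hf : f ∈ homog 𝒜 deg n) : HasPar deg n f :=
  fun w => le_evenSub h_even _ (hf w)

variable [GradedRing 𝒜]

theorem one_mem_zero : (1 : K) ∈ 𝒜 0 := SetLike.GradedOne.one_mem

theorem onGen_mem_homog (M : CInftyStructure 𝒜 d) (i : I) :
    M.onGen i ∈ homog 𝒜 (tdeg d) (tdeg d i + 1) :=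
  M.degree_one _ _ (letter_mem_homog one_mem_zero i)

/-- The extension of the vector field to a continuous derivation of the algebra of power series. -/
def CInftyStructure.der (M : CInftyStructure 𝒜 d) : (List I → K) →ₗ[K] (List I → K) :=
  oddDer (tdeg d) M.onGen

theorem isOddDer_der (M : CInftyStructure 𝒜 d) (h_even : ∀ n : ℤ, Odd n → 𝒜 n = ⊥) :
    IsOddDer (tdeg d) M.der :=
  isOddDer_oddDer (adm_onGen M) fun i => hasPar_of_mem_homog h_even (onGen_mem_homog M i)

theorem der_letter (M : CInftyStructure 𝒜 d) (i : I) : M.der (letter K i) = M.onGen i :=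
  oddDer_letter (adm_onGen M) i

/-- The given continuous derivation is the restriction to Lie series of the derivation of the
algebra of all power series with the same values on letters. -/
theorem der_eq (M : CInftyStructure 𝒜 d) (h_even : ∀ n : ℤ, Odd n → 𝒜 n = ⊥)
    (x : freeLie K (tdeg d)) : (M.m x : List I → K) = M.der x := by
  have hD := isOddDer_der M h_even
  have hcl : IsClosed {x : freeLie K (tdeg d) | (M.m x : List I → K) = M.der x} :=
    isClosed_eq (continuous_subtype_val.comp M.m.continuous)
      (hD.cont.comp continuous_subtype_val)
  have hmon : ∀ f (hf : LieMonomial K (tdeg d) f),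
      (M.m ⟨f, hf.mem_freeLie⟩ : List I → K) = M.der f := by
    intro f hf
    induction hf with
    | letter a => exact (der_letter M a).symm
    | @bracket f g hf hg h1 h2 =>
      obtain ⟨p, hp⟩ := hf.exists_hasPar
      obtain ⟨q, hq⟩ := hg.exists_hasPar
      have := M.leibniz ⟨f, hf.mem_freeLie⟩ ⟨g, hg.mem_freeLie⟩
      rw [hD.bracket hp hq, ← h1, ← h2]
      refine Eq.trans this ?_
      change _ + bracket (tdeg d) (parity (tdeg d) f) _ = _
      rw [hp.parity_eq, bracket_usmul_left]
  have hspan : ∀ f (hf : f ∈ Submodule.span K {f | LieMonomial K (tdeg d) f}),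
      (M.m ⟨f, Submodule.le_topologicalClosure _ hf⟩ : List I → K) = M.der f := by
    intro f hf
    induction hf using Submodule.span_induction with
    | mem f hf => exact hmon f hf
    | zero => rw [map_zero]; exact congrArg Subtype.val (map_zero M.m)
    | add f g hf hg h1 h2 =>
      rw [map_add, ← h1, ← h2]
      exact congrArg Subtype.val (map_add M.m ⟨f, Submodule.le_topologicalClosure _ hf⟩
        ⟨g, Submodule.le_topologicalClosure _ hg⟩)
    | smul c f hf h1 =>
      rw [map_smul, ← h1]
      exact congrArg Subtype.val (map_smul M.m c ⟨f, Submodule.le_topologicalClosure _ hf⟩)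
  -- The linear combinations of Lie monomials are dense in the pro-free Lie algebra.
  have hx : x ∈ closure {x : freeLie K (tdeg d) | (M.m x : List I → K) = M.der x} := by
    rw [closure_subtype]
    refine closure_mono ?_ x.2
    intro f hf
    exact ⟨⟨f, Submodule.le_topologicalClosure _ hf⟩, hspan f hf, rfl⟩
  rwa [hcl.closure_eq] at hx

theorem onGen_mem_freeLie (M : CInftyStructure 𝒜 d) (i : I) :
    M.onGen i ∈ freeLie K (tdeg d) := (M.m (gen (tdeg d) i)).2

theorem der_mem_freeLie (M : CInftyStructure 𝒜 d) (h_even : ∀ n : ℤ, Odd n → 𝒜 n = ⊥)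
    {x : List I → K} (hx : x ∈ freeLie K (tdeg d)) : M.der x ∈ freeLie K (tdeg d) := by
  rw [← der_eq M h_even ⟨x, hx⟩]
  exact (M.m ⟨x, hx⟩).2

theorem der_der (M : CInftyStructure 𝒜 d) (h_even : ∀ n : ℤ, Odd n → 𝒜 n = ⊥)
    {x : List I → K} (hx : x ∈ freeLie K (tdeg d)) : M.der (M.der x) = 0 := by
  rw [← der_eq M h_even ⟨x, hx⟩, ← der_eq M h_even, M.sq_zero]
  rfl

theorem der_mem_homog (M : CInftyStructure 𝒜 d) {n : ℤ} {x : List I → K}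
    (hx : x ∈ homog 𝒜 (tdeg d) n) : M.der x ∈ homog 𝒜 (tdeg d) (n + 1) :=
  oddDer_mem_homog (isMul_of_gradedRing 𝒜) (onGen_mem_homog M) hx

/-! #### The Lie derivative on forms -/

/-- The values of the Lie derivative on the letters. -/
def CInftyStructure.lieDerOn (M : CInftyStructure 𝒜 d) : I ⊕ I → List (I ⊕ I) → K :=
  Sum.elim (fun i => incl (M.onGen i)) fun i => - dForm K d (incl (M.onGen i))

theorem adm_lieDerOn (M : CInftyStructure 𝒜 d) : Adm M.lieDerOn := by
  have h0 : Filter.Tendsto (fun i => incl (M.onGen i)) Filter.cofinite (nhds 0) := by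
    have := (continuous_inclL.tendsto 0).comp (adm_iff_tendsto.1 (adm_onGen M))
    rwa [map_zero] at this
  have h1 : Adm fun i => incl (M.onGen i) := adm_iff_tendsto.2 h0
  have h2 : Adm fun i => -dForm K d (incl (M.onGen i)) := by
    refine adm_iff_tendsto.2 ?_
    have := ((isOddDer_dForm (K := K) (d := d)).cont.tendsto 0).comp h0
    rw [map_zero] at this
    simpa using this.neg
  intro v
  refine (((h1 v).image Sum.inl).union ((h2 v).image Sum.inr)).subset ?_
  rintro (i | i) hi
  · exact Or.inl ⟨i, hi, rfl⟩
  · exact Or.inr ⟨i, hi, rfl⟩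

theorem lieDerOn_mem_homog (M : CInftyStructure 𝒜 d) (a : I ⊕ I) :
    M.lieDerOn a ∈ homog 𝒜 (fdeg d) (fdeg d a + 1) := by
  have h : ∀ i, incl (M.onGen i) ∈ homog 𝒜 (fdeg d) (tdeg d i + 1) := fun i =>
    incl_mem_homog (onGen_mem_homog M i)
  cases a with
  | inl i => exact h i
  | inr i =>
    have := dForm_mem_homog (d := d) (isMul_of_gradedRing 𝒜) one_mem_zero (wt := fdeg d) (s := 1)
      (fun _ => rfl) _ _ (h i)
    exact neg_mem this

theorem lieDerOn_mem_formWt (M : CInftyStructure 𝒜 d) (a : I ⊕ I) :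
    M.lieDerOn a ∈ homog (zeroSub K) formWt (formWt a + 0) := by
  cases a with
  | inl i => exact incl_mem_formWt _
  | inr i =>
    have := dForm_mem_homog (d := d) zeroSub_isMul one_mem_zeroSub (wt := formWt) (s := 1)
      (fun _ => rfl) _ _ (incl_mem_formWt (M.onGen i))
    exact neg_mem this

theorem isOddDer_lieDer (M : CInftyStructure 𝒜 d) (h_even : ∀ n : ℤ, Odd n → 𝒜 n = ⊥) :
    IsOddDer (fdeg d) M.lieDer :=
  isOddDer_oddDer (adm_lieDerOn M) fun a => hasPar_of_mem_homog h_even (lieDerOn_mem_homog M a)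

theorem lieDer_letter_inl (M : CInftyStructure 𝒜 d) (i : I) :
    M.lieDer (letter K (Sum.inl i)) = incl (M.onGen i) := oddDer_letter (adm_lieDerOn M) _

theorem lieDer_letter_inr (M : CInftyStructure 𝒜 d) (i : I) :
    M.lieDer (letter K (Sum.inr i)) = -dForm K d (incl (M.onGen i)) :=
  oddDer_letter (adm_lieDerOn M) _

theorem lieDer_incl (M : CInftyStructure 𝒜 d) (h_even : ∀ n : ℤ, Odd n → 𝒜 n = ⊥)
    (f : List I → K) : M.lieDer (incl f) = incl (M.der f) :=
  (intertwine (isOddDer_der M h_even) (isOddDer_lieDer M h_even) (φ := inclL) continuous_inclL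
    (incl_word []) incl_mul incl_parity (fun i => by
      rw [der_letter, inclL_apply, inclL_apply, incl_letter, lieDer_letter_inl]) f).symm

theorem dForm_lieDer (M : CInftyStructure 𝒜 d) [Algebra ℚ K]
    (h_even : ∀ n : ℤ, Odd n → 𝒜 n = ⊥) (f : List (I ⊕ I) → K) :
    dForm K d (M.lieDer f) + M.lieDer (dForm K d f) = 0 := by
  refine isOddDer_dForm.anticomm (isOddDer_lieDer M h_even) (fun a => ?_) f
  cases a with
  | inl i => rw [lieDer_letter_inl, dForm_letter_inl, lieDer_letter_inr, add_neg_cancel]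
  | inr i => rw [lieDer_letter_inr, dForm_letter_inr, map_zero, map_neg, dForm_dForm, neg_zero,
      add_zero]

theorem lieDer_lieDer (M : CInftyStructure 𝒜 d) [Algebra ℚ K]
    (h_even : ∀ n : ℤ, Odd n → 𝒜 n = ⊥) (f : List (I ⊕ I) → K) :
    M.lieDer (M.lieDer f) = 0 := by
  have h0 : ∀ i, M.lieDer (incl (M.onGen i)) = 0 := fun i => by
    rw [lieDer_incl M h_even, ← der_letter, der_der M h_even (letter_mem _ i), incl_zero]
  refine eq_zero_of_add_self ((isOddDer_lieDer M h_even).anticomm (isOddDer_lieDer M h_even)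
    (fun a => ?_) f)
  cases a with
  | inl i => rw [lieDer_letter_inl, h0, add_zero]
  | inr i =>
    have := dForm_lieDer M h_even (incl (M.onGen i))
    rw [h0, map_zero, zero_add] at this
    rw [lieDer_letter_inr, map_neg, this, neg_zero, add_zero]

theorem lieDer_letter_mem_freeLie (M : CInftyStructure 𝒜 d) (a : I ⊕ I) :
    M.lieDer (letter K a) ∈ freeLie K (fdeg d) := by
  cases a with
  | inl i => rw [lieDer_letter_inl]; exact incl_mem_freeLie (onGen_mem_freeLie M i)
  | inr i =>
    rw [lieDer_letter_inr]
    exact neg_mem (isOddDer_dForm.mem_freeLie dForm_letter_mem_freeLie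
      (incl_mem_freeLie (onGen_mem_freeLie M i)))

/-! #### The Lie de Rham complex -/

variable {M : CInftyStructure 𝒜 d}

theorem mem_bihomog_iff {p : ℕ} {N : ℤ} {F : List (I ⊕ I) × List (I ⊕ I) → K} :
    F ∈ bihomog 𝒜 d p N ↔
      F ∈ tensorHomog (zeroSub K) formWt p ∧ F ∈ tensorHomog 𝒜 (fdeg d) N := by
  have h : ∀ u v : List (I ⊕ I), ((p : ℤ) - wdeg formWt u - wdeg formWt v ≠ 0) ↔
      formDeg u + formDeg v ≠ p := fun u v => by
    rw [wdeg_formWt, wdeg_formWt]; omega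
  constructor
  · exact fun hF => ⟨fun q hq => (hF q.1 q.2).1 ((h _ _).1 hq), fun q => (hF q.1 q.2).2⟩
  · exact fun hF u v => ⟨fun hq => hF.1 (u, v) ((h u v).2 hq), hF.2 (u, v)⟩

theorem lieDR_mem_bihomog (M : CInftyStructure 𝒜 d) {p : ℕ} {N : ℤ}
    {F : List (I ⊕ I) × List (I ⊕ I) → K}
    (hF : F ∈ bihomog 𝒜 d p N) : M.lieDR F ∈ bihomog 𝒜 d p (N + 1) := by
  rw [mem_bihomog_iff] at hF ⊢
  refine ⟨?_, ?_⟩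
  · have := tensorOdd_mem_tensorHomog (deg := fdeg d) (D := M.lieDer) (s := 0)
      (fun n f hf => oddDer_mem_homog zeroSub_isMul (lieDerOn_mem_formWt M) hf) hF.1
    rwa [add_zero] at this
  · exact tensorOdd_mem_tensorHomog (fun n f hf =>
      oddDer_mem_homog (isMul_of_gradedRing 𝒜) (lieDerOn_mem_homog M) hf) hF.2

theorem dDR_mem_bihomog {p : ℕ} {N : ℤ} {F : List (I ⊕ I) × List (I ⊕ I) → K}
    (hF : F ∈ bihomog 𝒜 d p N) : dDR K d F ∈ bihomog 𝒜 d (p + 1) (N + 1) := by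
  rw [mem_bihomog_iff] at hF ⊢
  refine ⟨?_, ?_⟩
  · have := tensorOdd_mem_tensorHomog (deg := fdeg d) (D := dForm K d) (s := 1)
      (dForm_mem_homog zeroSub_isMul one_mem_zeroSub fun _ => rfl) hF.1
    exact_mod_cast this
  · exact tensorOdd_mem_tensorHomog
      (dForm_mem_homog (isMul_of_gradedRing 𝒜) one_mem_zero fun _ => rfl) hF.2

theorem lieDR_mem_lieTensor (h_even : ∀ n : ℤ, Odd n → 𝒜 n = ⊥)
    {F : List (I ⊕ I) × List (I ⊕ I) → K} (hF : F ∈ lieTensor K (fdeg d)) :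
    M.lieDR F ∈ lieTensor K (fdeg d) :=
  tensorOdd_mem_lieTensor (isOddDer_lieDer M h_even) (lieDer_letter_mem_freeLie M) hF

theorem lieDR_mem_lieRel (h_even : ∀ n : ℤ, Odd n → 𝒜 n = ⊥)
    {F : List (I ⊕ I) × List (I ⊕ I) → K} (hF : F ∈ lieRel K (fdeg d)) :
    M.lieDR F ∈ lieRel K (fdeg d) :=
  tensorOdd_mem_lieRel (isOddDer_lieDer M h_even) (lieDer_letter_mem_freeLie M) hF

theorem dDR_mem_lieTensor {F : List (I ⊕ I) × List (I ⊕ I) → K}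
    (hF : F ∈ lieTensor K (fdeg d)) : dDR K d F ∈ lieTensor K (fdeg d) :=
  tensorOdd_mem_lieTensor isOddDer_dForm dForm_letter_mem_freeLie hF

theorem dDR_mem_lieRel {F : List (I ⊕ I) × List (I ⊕ I) → K} (hF : F ∈ lieRel K (fdeg d)) :
    dDR K d F ∈ lieRel K (fdeg d) :=
  tensorOdd_mem_lieRel isOddDer_dForm dForm_letter_mem_freeLie hF

theorem lieDR_mem_drCochains (h_even : ∀ n : ℤ, Odd n → 𝒜 n = ⊥) {p : ℕ} {N : ℤ}
    {F : List (I ⊕ I) × List (I ⊕ I) → K} (hF : F ∈ drCochains 𝒜 d p N) :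
    M.lieDR F ∈ drCochains 𝒜 d p (N + 1) :=
  ⟨lieDR_mem_lieTensor h_even hF.1, lieDR_mem_bihomog M hF.2⟩

theorem dDR_mem_drCochains {p : ℕ} {N : ℤ} {F : List (I ⊕ I) × List (I ⊕ I) → K}
    (hF : F ∈ drCochains 𝒜 d p N) : dDR K d F ∈ drCochains 𝒜 d (p + 1) (N + 1) :=
  ⟨dDR_mem_lieTensor hF.1, dDR_mem_bihomog hF.2⟩

theorem dDR_lieDR [Algebra ℚ K] (h_even : ∀ n : ℤ, Odd n → 𝒜 n = ⊥)
    (F : List (I ⊕ I) × List (I ⊕ I) → K) : dDR K d (M.lieDR F) = -M.lieDR (dDR K d F) :=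
  eq_neg_of_add_eq_zero_left
    (tensorOdd_anticomm isOddDer_dForm (isOddDer_lieDer M h_even) (dForm_lieDer M h_even) F)

theorem lieDR_lieDR [Algebra ℚ K] (h_even : ∀ n : ℤ, Odd n → 𝒜 n = ⊥)
    (F : List (I ⊕ I) × List (I ⊕ I) → K) : M.lieDR (M.lieDR F) = 0 :=
  eq_zero_of_add_self (tensorOdd_anticomm (isOddDer_lieDer M h_even) (isOddDer_lieDer M h_even)
    (fun f => by rw [lieDer_lieDer M h_even, add_zero]) F)

end VectorField

/-! ### Coefficients of one-forms -/

section Coefficients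

variable {K I : Type*} [CommRing K] {d : I → ℤ}

theorem negOnePow_congr {a b : ℤ} (h : Even (a - b)) : a.negOnePow = b.negOnePow :=
  (Int.negOnePow_eq_iff a b).2 h

/-- The coefficient of `dt i` in a form of degree one, computed up to cyclic rotation: the part
`∑ u dt_i v` of a form is rotated into `∑ ± dt_i v u`, and `∑ ± v u` is returned. -/
def cycCoeff (d : I → ℤ) (i : I) : (List (I ⊕ I) → K) →ₗ[K] (List I → K) where
  toFun f w := splitSum w fun v u =>
    (wdeg (tdeg d) u * (tdeg d i + 1 + wdeg (tdeg d) v)).negOnePow •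
      f (u.map Sum.inl ++ Sum.inr i :: v.map Sum.inl)
  map_add' f g := by funext w; simp [smul_add, splitSum_add]
  map_smul' c f := by funext w; simp [mul_splitSum, mul_smul_comm]

theorem cycCoeff_apply (i : I) (f : List (I ⊕ I) → K) (w : List I) :
    cycCoeff d i f w = splitSum w fun v u =>
      (wdeg (tdeg d) u * (tdeg d i + 1 + wdeg (tdeg d) v)).negOnePow •
        f (u.map Sum.inl ++ Sum.inr i :: v.map Sum.inl) := rfl

/-- The coefficient of `dt i` in an element of form degree one of the Lie de Rham complex. -/
def coeff (d : I → ℤ) (i : I) : (List (I ⊕ I) × List (I ⊕ I) → K) →ₗ[K] (List I → K) :=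
  cycCoeff d i ∘ₗ tensorMul

theorem coeff_apply (i : I) (F : List (I ⊕ I) × List (I ⊕ I) → K) (w : List I) :
    coeff d i F w = splitSum w fun x r => splitSum r fun y z =>
      (wdeg (tdeg d) (y ++ z) * (tdeg d i + 1 + wdeg (tdeg d) x)).negOnePow •
        F (y.map Sum.inl, z.map Sum.inl ++ Sum.inr i :: x.map Sum.inl) +
      (wdeg (tdeg d) z * (tdeg d i + 1 + wdeg (tdeg d) (x ++ y))).negOnePow •
        F (z.map Sum.inl ++ Sum.inr i :: x.map Sum.inl, y.map Sum.inl) := by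
  simp only [splitSum_add]
  rw [← splitSum_assoc w fun x y z =>
      (wdeg (tdeg d) z * (tdeg d i + 1 + wdeg (tdeg d) (x ++ y))).negOnePow •
        F (z.map Sum.inl ++ Sum.inr i :: x.map Sum.inl, y.map Sum.inl), ← splitSum_add]
  rw [coeff, LinearMap.comp_apply, cycCoeff_apply]
  refine splitSum_congr fun v u _ => ?_
  rw [tensorMul_apply, splitSum_append_cons, smul_add, splitSum_map, splitSum_map, smul_splitSum,
    smul_splitSum]
  congr 1
  · exact splitSum_congr fun a b h => by rw [← h]
  · exact splitSum_congr fun a b h => by rw [← h]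

/-- The coefficients of a one-form depend only on its class up to graded commutators. -/
theorem coeff_swap (i : I) (F : List (I ⊕ I) × List (I ⊕ I) → K) :
    coeff d i (swap (fdeg d) F) = coeff d i F := by
  funext w
  rw [coeff_apply, coeff_apply]
  refine splitSum_congr fun x r _ => splitSum_congr fun y z _ => ?_
  rw [add_comm]
  simp only [swap, smul_smul, ← Int.negOnePow_add, wdeg_append, wdeg_cons, wdeg_fdeg_map_inl]
  have e : fdeg d (Sum.inr i) = tdeg d i + 1 := rfl
  rw [e]
  congr 2
  · refine negOnePow_congr ⟨wdeg (tdeg d) z * wdeg (tdeg d) y, ?_⟩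
    ring
  · refine negOnePow_congr
      ⟨wdeg (tdeg d) y * (tdeg d i + 1 + wdeg (tdeg d) x), ?_⟩
    ring

theorem cycCoeff_bracket (i : I) (f g : List (I ⊕ I) → K) :
    cycCoeff d i (bracket (fdeg d) f g) = 0 := by
  rw [bracket_eq_tensorMul, map_sub, sub_eq_zero]
  exact (coeff_swap i (tmul f g)).symm

theorem coeff_mem_homog {𝒬 : ℤ → AddSubgroup K} {n : ℤ} {F : List (I ⊕ I) × List (I ⊕ I) → K}
    (hF : F ∈ tensorHomog 𝒬 (fdeg d) n) (i : I) :
    coeff d i F ∈ homog 𝒬 (tdeg d) (n - tdeg d i - 1) := by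
  intro w
  rw [coeff_apply]
  have e : fdeg d (Sum.inr i) = tdeg d i + 1 := rfl
  refine splitSum_mem fun x r h => splitSum_mem fun y z h' =>
    add_mem (usmul_mem _ ?_) (usmul_mem _ ?_)
  · have := hF (y.map Sum.inl, z.map Sum.inl ++ Sum.inr i :: x.map Sum.inl)
    simp only [wdeg_append, wdeg_cons, wdeg_fdeg_map_inl, e] at this
    rw [← h, ← h', wdeg_append, wdeg_append]
    convert this using 2
    ring
  · have := hF (z.map Sum.inl ++ Sum.inr i :: x.map Sum.inl, y.map Sum.inl)
    simp only [wdeg_append, wdeg_cons, wdeg_fdeg_map_inl, e] at this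
    rw [← h, ← h', wdeg_append, wdeg_append]
    convert this using 2
    ring

/-! ### Sums over the letters -/

/-- The series `∑ i, t i * y i`. -/
def headSum : (I → List I → K) →ₗ[K] (List I → K) where
  toFun y w := match w with
    | [] => 0
    | a :: w => y a w
  map_add' y z := by funext w; cases w <;> simp
  map_smul' c y := by funext w; cases w <;> simp

/-- The series `∑ i, (-1)^{|t i| |y i|} y i * t i`. -/
def lastSum (deg : I → ℤ) : (I → List I → K) →ₗ[K] (List I → K) where
  toFun y w := match w.reverse with
    | [] => 0
    | a :: r => (deg a * wdeg deg r.reverse).negOnePow • y a r.reverse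
  map_add' y z := by funext w; simp only [Pi.add_apply]; cases w.reverse <;> simp
  map_smul' c y := by
    funext w; simp only [Pi.smul_apply, RingHom.id_apply]; cases w.reverse <;> simp [mul_smul_comm]

/-- The series `∑ i, [t i, y i]`. -/
def bsum (deg : I → ℤ) : (I → List I → K) →ₗ[K] (List I → K) := headSum - lastSum deg

theorem headSum_nil (y : I → List I → K) : headSum y [] = 0 := rfl
theorem headSum_cons (y : I → List I → K) (a : I) (w : List I) : headSum y (a :: w) = y a w := rfl

variable {deg : I → ℤ}

theorem lastSum_nil (y : I → List I → K) : lastSum deg y [] = 0 := rfl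
theorem lastSum_concat (y : I → List I → K) (a : I) (w : List I) :
    lastSum deg y (w ++ [a]) = (deg a * wdeg deg w).negOnePow • y a w := by
  change (match (w ++ [a]).reverse with
    | [] => 0
    | a :: r => (deg a * wdeg deg r.reverse).negOnePow • y a r.reverse) = _
  rw [List.reverse_append]
  simp

theorem tensorMul_swap_letter (i : I) (f : List I → K) :
    tensorMul (swap deg (tmul (letter K i) f)) =
      mul (fun u => (deg i * wdeg deg u).negOnePow • f u) (letter K i) := by
  funext w
  rw [tensorMul_apply, mul_apply]
  refine splitSum_congr fun u v _ => ?_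
  by_cases hv : v = [i]
  · subst hv
    simp [swap, tmul, letter_apply_self, wdeg_cons, wdeg_nil, mul_comm]
  · simp [swap, tmul, letter_apply_of_ne hv]

open Classical in
theorem bsum_single (i : I) (f : List I → K) :
    bsum deg (Pi.single i f) = bracket deg (letter K i) f := by
  rw [bracket_eq_tensorMul, tensorMul_swap_letter, tensorMul_tmul]
  rw [bsum, LinearMap.sub_apply]
  congr 1
  · funext w
    cases w with
    | nil => rw [headSum_nil, letter_mul_nil]
    | cons c w =>
      rw [headSum_cons]
      by_cases h : c = i
      · subst h; rw [letter_mul_cons_self, Pi.single_eq_same]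
      · rw [letter_mul_cons_of_ne h, Pi.single_eq_of_ne h]; rfl
  · funext w
    rcases List.eq_nil_or_concat' w with rfl | ⟨w, c, rfl⟩
    · rw [lastSum_nil, mul_letter_nil]
    · rw [lastSum_concat]
      by_cases h : c = i
      · subst h; rw [mul_letter_concat_self, Pi.single_eq_same]
      · rw [mul_letter_concat_of_ne h, Pi.single_eq_of_ne h, Pi.zero_apply, smul_zero]

/-- Only the first and the last letter of a word contribute to its coefficient in `∑ i, [t i, y
i]`. -/
theorem finsum_bracket_letter (y : I → List I → K) (w : List I) :
    ∑ᶠ i, bracket deg (letter K i) (y i) w = bsum deg y w := by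
  have h0 : ∀ i, bracket deg (letter K i) (y i) w = mul (letter K i) (y i) w -
      mul (fun u => (deg i * wdeg deg u).negOnePow • y i u) (letter K i) w := fun i => by
    rw [bracket_eq_tensorMul, tensorMul_swap_letter, tensorMul_tmul, Pi.sub_apply]
  simp only [h0]
  have h1 : (Function.support fun i => mul (letter K i) (y i) w).Finite ∧
      ∑ᶠ i, mul (letter K i) (y i) w = headSum y w := by
    cases w with
    | nil => simp [letter_mul_nil, headSum_nil]
    | cons c w =>
      have hs : ∀ i, i ≠ c → mul (letter K i) (y i) (c :: w) = 0 := fun i hi =>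
        letter_mul_cons_of_ne hi.symm _ _
      refine ⟨(Set.finite_singleton c).subset fun i hi => ?_, ?_⟩
      · by_contra h
        exact hi (hs i h)
      · rw [finsum_eq_single _ c hs, letter_mul_cons_self, headSum_cons]
  have h2 : (Function.support fun i => mul (fun u => (deg i * wdeg deg u).negOnePow • y i u)
      (letter K i) w).Finite ∧ ∑ᶠ i, mul (fun u => (deg i * wdeg deg u).negOnePow • y i u)
      (letter K i) w = lastSum deg y w := by
    rcases List.eq_nil_or_concat' w with rfl | ⟨w, c, rfl⟩
    · simp [mul_letter_nil, lastSum_nil]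
    · have hs : ∀ i, i ≠ c → mul (fun u => (deg i * wdeg deg u).negOnePow • y i u)
          (letter K i) (w ++ [c]) = 0 := fun i hi => mul_letter_concat_of_ne hi.symm _ _
      refine ⟨(Set.finite_singleton c).subset fun i hi => ?_, ?_⟩
      · by_contra h
        exact hi (hs i h)
      · rw [finsum_eq_single _ c hs, mul_letter_concat_self, lastSum_concat]
  rw [finsum_sub_distrib h1.1 h2.1, h1.2, h2.2]
  rfl

theorem headSum_mem_homog {𝒬 : ℤ → AddSubgroup K} {wt : I → ℤ} {n : ℤ} {y : I → List I → K}
    (hy : ∀ i, y i ∈ homog 𝒬 wt (n - wt i)) : headSum y ∈ homog 𝒬 wt n := by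
  intro w
  cases w with
  | nil => exact zero_mem _
  | cons a w =>
    have := hy a w
    rwa [sub_sub, ← wdeg_cons] at this

theorem lastSum_mem_homog {𝒬 : ℤ → AddSubgroup K} {wt : I → ℤ} {n : ℤ} {y : I → List I → K}
    (hy : ∀ i, y i ∈ homog 𝒬 wt (n - wt i)) : lastSum deg y ∈ homog 𝒬 wt n := by
  intro w
  rcases List.eq_nil_or_concat' w with rfl | ⟨w, c, rfl⟩
  · exact zero_mem _
  · rw [lastSum_concat]
    have := hy c w
    rw [wdeg_append, wdeg_cons, wdeg_nil, add_zero, add_comm, ← sub_sub]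
    exact usmul_mem _ this

theorem bsum_mem_homog {𝒬 : ℤ → AddSubgroup K} {wt : I → ℤ} {n : ℤ} {y : I → List I → K}
    (hy : ∀ i, y i ∈ homog 𝒬 wt (n - wt i)) : bsum deg y ∈ homog 𝒬 wt n :=
  sub_mem (headSum_mem_homog hy) (lastSum_mem_homog hy)

/-- If `∑ i, [t i, y i] = 0`, then `∑ i, t i * y i` is invariant under signed rotations. -/
theorem headSum_rotate {y : I → List I → K} (hy : bsum deg y = 0) (u v : List I) :
    headSum y (u ++ v) = (wdeg deg u * wdeg deg v).negOnePow • headSum y (v ++ u) := by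
  have h1 : ∀ a w, headSum y (a :: w) =
      (deg a * wdeg deg w).negOnePow • headSum y (w ++ [a]) := by
    intro a w
    have : headSum y = lastSum deg y := sub_eq_zero.1 hy
    conv_rhs => rw [this]
    rw [lastSum_concat, headSum_cons, smul_smul]
    simp
  induction u generalizing v with
  | nil => simp [wdeg_nil]
  | cons a u ih =>
    rw [List.cons_append, h1, List.append_assoc, ih, smul_smul, ← Int.negOnePow_add,
      List.append_assoc, List.singleton_append]
    congr 1
    simp only [wdeg_append, wdeg_cons, wdeg_nil]
    exact negOnePow_congr ⟨deg a * wdeg deg u, by ring⟩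

/-! ### The tensors `∑ i, dt i ⊗ y i` and `∑ i, t i ⊗ y i` -/

open Classical in
/-- The tensor `∑ i, κ i ⊗ y i`, for an injective family `κ` of letters. -/
def tform (κ : I → I ⊕ I) :
    (I → List I → K) →ₗ[K] (List (I ⊕ I) × List (I ⊕ I) → K) where
  toFun y p := if h : ∃ i, p.1 = [κ i] then incl (y h.choose) p.2 else 0
  map_add' y z := by
    funext p; simp only [Pi.add_apply]; split_ifs <;> simp [incl_add]
  map_smul' c y := by
    funext p; simp only [Pi.smul_apply, RingHom.id_apply]; split_ifs <;> simp [incl_smul]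

variable {κ : I → I ⊕ I}

theorem tform_apply_self (hκ : Function.Injective κ) (y : I → List I → K) (i : I)
    (v : List (I ⊕ I)) : tform κ y ([κ i], v) = incl (y i) v := by
  have h : ∃ j, [κ i] = [κ j] := ⟨i, rfl⟩
  have hc : h.choose = i := by
    have := List.head_eq_of_cons_eq h.choose_spec
    exact (hκ this).symm
  refine (dif_pos h).trans ?_
  rw [hc]

theorem tform_apply_of_ne (y : I → List I → K) {p : List (I ⊕ I) × List (I ⊕ I)}
    (h : ∀ i, p.1 ≠ [κ i]) : tform κ y p = 0 :=
  dif_neg (not_exists.2 h)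

theorem tform_eq_finsum (hκ : Function.Injective κ) (y : I → List I → K)
    (p : List (I ⊕ I) × List (I ⊕ I)) :
    tform κ y p = ∑ᶠ i, tmul (letter K (κ i)) (incl (y i)) p := by
  by_cases h : ∃ i, p.1 = [κ i]
  · obtain ⟨i, hi⟩ := h
    obtain ⟨u, v⟩ := p
    dsimp only at hi
    subst hi
    rw [tform_apply_self hκ, finsum_eq_single _ i, tmul, letter_apply_self, one_mul]
    intro j hj
    rw [tmul, letter_apply_of_ne, zero_mul]
    simpa using fun h => hj (hκ h).symm
  · rw [tform_apply_of_ne y (not_exists.1 h)]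
    refine (finsum_eq_zero_of_forall_eq_zero fun i => ?_).symm
    rw [tmul, letter_apply_of_ne (not_exists.1 h i), zero_mul]

open Classical in
theorem tform_single (hκ : Function.Injective κ) (i : I) (f : List I → K) :
    tform κ (Pi.single i f) = tmul (letter K (κ i)) (incl f) := by
  funext p
  rw [tform_eq_finsum hκ, finsum_eq_single _ i, Pi.single_eq_same]
  intro j hj
  rw [Pi.single_eq_of_ne hj, incl_zero]
  simp [tmul]

/-- One-forms of the shape `∑ i, dt i ⊗ y i` are determined by the series `y i`. -/
theorem coeff_tform (y : I → List I → K) (j : I) : coeff d j (tform Sum.inr y) = y j := by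
  funext w
  rw [coeff_apply, splitSum_eq_single_left, splitSum_eq_single_right]
  · rw [tform_apply_of_ne, smul_zero, zero_add]
    · simp only [List.map_nil, List.nil_append]
      rw [tform_apply_self Sum.inr_injective, incl_map]
      simp [wdeg_nil]
    · intro i h
      have := congrArg formDeg h
      rw [formDeg_map_inl, formDeg_cons_inr] at this
      omega
  · intro u v _ hv
    rw [tform_apply_of_ne, tform_apply_of_ne, smul_zero, smul_zero, add_zero]
    · intro i h
      have := congrArg List.length h
      simp at this
      exact hv this
    · intro i h
      have := congrArg formDeg h
      rw [formDeg_map_inl, formDeg_cons_inr] at this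
      omega
  · intro x r _ hx
    refine splitSum_eq_zero fun u v _ => ?_
    rw [tform_apply_of_ne, tform_apply_of_ne, smul_zero, smul_zero, add_zero]
    · intro i h
      have := congrArg List.length h
      simp at this
      exact hx (List.length_eq_zero_iff.1 (by omega))
    · intro i h
      have := congrArg formDeg h
      rw [formDeg_map_inl, formDeg_cons_inr] at this
      omega

theorem tform_mem_tensorHomog {𝒬 : ℤ → AddSubgroup K} {wt : I ⊕ I → ℤ} {n : ℤ}
    (hκ : Function.Injective κ) {y : I → List I → K}
    (hy : ∀ i, incl (y i) ∈ homog 𝒬 wt (n - wt (κ i))) : tform κ y ∈ tensorHomog 𝒬 wt n := by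
  rintro ⟨u, v⟩
  by_cases h : ∃ i, u = [κ i]
  · obtain ⟨i, rfl⟩ := h
    rw [tform_apply_self hκ]
    have := hy i v
    rwa [wdeg_cons, wdeg_nil, add_zero]
  · rw [tform_apply_of_ne y (not_exists.1 h)]
    exact zero_mem _

/-- The product of the two factors of `∑ i, t i ⊗ y i`. -/
theorem tensorMul_tform_inl (y : I → List I → K) :
    tensorMul (tform Sum.inl y) = incl (headSum y) := by
  funext w
  rw [tensorMul_apply]
  cases w with
  | nil =>
    rw [splitSum_nil, tform_apply_of_ne _ (by simp)]
    exact (incl_map (headSum y) []).symm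
  | cons a w =>
    rw [splitSum_cons, tform_apply_of_ne _ (by simp), zero_add, splitSum_eq_single_left]
    · cases a with
      | inl i =>
        rw [tform_apply_self Sum.inl_injective]
        by_cases h : formDeg w = 0
        · obtain ⟨v, rfl⟩ := exists_eq_map_inl h
          rw [incl_map, ← List.map_cons, incl_map, headSum_cons]
        · rw [incl_of_ne _ h, incl_of_ne]
          rwa [formDeg_cons_inl]
      | inr i =>
        rw [tform_apply_of_ne _ (by simp), incl_of_ne]
        rw [formDeg_cons_inr]
        omega
    · intro u v _ hu
      rw [tform_apply_of_ne]
      intro i h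
      simp at h
      exact hu h.2

theorem oneForm_eq [TopologicalSpace K] [DiscreteTopology K] (y : I → freeLie K (tdeg d)) :
    oneForm y = tform Sum.inr fun i => (y i : List I → K) := by
  funext p
  exact (tform_eq_finsum Sum.inr_injective _ p).symm

theorem bracketSum_eq [TopologicalSpace K] [DiscreteTopology K] (y : I → freeLie K (tdeg d)) :
    bracketSum y = bsum (tdeg d) fun i => (y i : List I → K) := by
  funext p
  exact finsum_bracket_letter _ p

section Topology

variable [TopologicalSpace K] [DiscreteTopology K]

theorem continuous_coeff (i : I) : Continuous (coeff (K := K) d i) := by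
  refine continuous_pi fun w => ?_
  have : ∀ F : List (I ⊕ I) × List (I ⊕ I) → K, coeff d i F w = _ := fun F => coeff_apply i F w
  refine (continuous_congr this).2 ?_
  exact continuous_splitSum fun u r => continuous_splitSum fun v u' =>
    (continuous_usmul (continuous_apply _) _).add (continuous_usmul (continuous_apply _) _)

theorem continuous_headSum : Continuous (headSum : (I → List I → K) →ₗ[K] _) := by
  refine continuous_pi fun w => ?_
  cases w with
  | nil => exact continuous_const
  | cons a w => exact (continuous_apply w).comp (continuous_apply a)

theorem continuous_lastSum (deg : I → ℤ) :
    Continuous (lastSum deg : (I → List I → K) →ₗ[K] _) := by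
  refine continuous_pi fun w => ?_
  rcases List.eq_nil_or_concat' w with rfl | ⟨w, c, rfl⟩
  · exact continuous_const
  · simp only [lastSum_concat]
    exact continuous_usmul ((continuous_apply w).comp (continuous_apply c)) _

theorem continuous_bsum (deg : I → ℤ) : Continuous (bsum deg : (I → List I → K) →ₗ[K] _) :=
  continuous_headSum.sub (continuous_lastSum deg)

theorem continuous_tform (hκ : Function.Injective κ) :
    Continuous (tform κ : (I → List I → K) →ₗ[K] _) := by
  refine continuous_pi fun p => ?_
  obtain ⟨u, v⟩ := p
  by_cases h : ∃ i, u = [κ i]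
  · obtain ⟨i, rfl⟩ := h
    simp only [tform_apply_self hκ]
    exact (continuous_apply v).comp (continuous_inclL.comp (continuous_apply i))
  · simp only [tform_apply_of_ne (p := (u, v)) _ (not_exists.1 h)]
    exact continuous_const

/-- A closed submodule contains `∑ i, κ i ⊗ y i` if it contains all the summands. -/
theorem tform_mem (hκ : Function.Injective κ)
    {Z : Submodule K (List (I ⊕ I) × List (I ⊕ I) → K)}
    (hZ : IsClosed (Z : Set (List (I ⊕ I) × List (I ⊕ I) → K))) {y : I → List I → K}
    (h : ∀ i, tmul (letter K (κ i)) (incl (y i)) ∈ Z) : tform κ y ∈ Z := by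
  classical
  have ht : Filter.Tendsto (fun s : Finset I => ∑ i ∈ s, tmul (letter K (κ i)) (incl (y i)))
      Filter.atTop (nhds (tform κ y)) := by
    rw [tendsto_pi_nhds]
    rintro ⟨u, v⟩
    refine tendsto_const_nhds.congr' ?_
    by_cases hu : ∃ i, u = [κ i]
    · obtain ⟨i, rfl⟩ := hu
      filter_upwards [Filter.eventually_ge_atTop {i}] with s hs
      rw [Finset.sum_apply, Finset.sum_eq_single i]
      · rw [tform_apply_self hκ, tmul, letter_apply_self, one_mul]
      · intro j _ hj
        rw [tmul, letter_apply_of_ne, zero_mul]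
        simpa using fun h => hj (hκ h).symm
      · intro hi
        exact absurd (hs (Finset.mem_singleton_self i)) hi
    · refine Filter.Eventually.of_forall fun s => ?_
      dsimp only
      rw [tform_apply_of_ne _ (not_exists.1 hu), Finset.sum_apply]
      refine (Finset.sum_eq_zero fun i _ => ?_).symm
      rw [tmul, letter_apply_of_ne (not_exists.1 hu i), zero_mul]
  exact hZ.mem_of_tendsto ht (Filter.Eventually.of_forall fun s => sum_mem fun i _ => h i)

theorem tform_mem_lieTensor (hκ : Function.Injective κ) {y : I → List I → K}
    (hy : ∀ i, y i ∈ freeLie K (tdeg d)) : tform κ y ∈ lieTensor K (fdeg d) :=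
  tform_mem hκ (isClosed_lieTensor _) fun i =>
    tmul_mem_lieTensor (letter_mem _ _) (incl_mem_freeLie (hy i))

/-- The coefficients of a one-form are well defined in the Lie de Rham complex. -/
theorem coeff_eq_zero_of_mem_lieRel {F : List (I ⊕ I) × List (I ⊕ I) → K}
    (hF : F ∈ lieRel K (fdeg d)) (i : I) : coeff d i F = 0 := by
  refine lieRel_le (Z := LinearMap.ker (coeff d i))
    (isClosed_singleton.preimage (continuous_coeff i)) (fun x y _ _ => ?_)
    (fun x y z hx hy hz => ?_) hF
  · rw [LinearMap.mem_ker, map_sub, coeff_swap, sub_self]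
  · obtain ⟨p, px⟩ := hx.exists_hasPar
    obtain ⟨q, py⟩ := hy.exists_hasPar
    obtain ⟨r, pz⟩ := hz.exists_hasPar
    rw [LinearMap.mem_ker, coeff, LinearMap.comp_apply, map_sub, tensorMul_tmul, tensorMul_tmul,
      px.mul_bracket_sub py pz, map_usmul, cycCoeff_bracket, smul_zero]

end Topology

end Coefficients

/-! ### Operators that depend on the length -/

section Length

variable {K A : Type*} [CommRing K]

theorem MonOf.length_eq {deg : A → ℤ} {s : Multiset A} {x : List A → K} (hx : MonOf K deg s x)
    {w : List A} (hw : x w ≠ 0) : w.length = s.card := by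
  have h := hx.mem_homog (wt := fun _ => 1) zeroSub_isMul one_mem_zeroSub w
  by_contra hne
  refine hw (h ?_)
  simp only [Multiset.map_const', Multiset.sum_replicate, wdeg, List.map_const', List.sum_replicate]
  simp only [nsmul_eq_mul, mul_one]
  omega

theorem MonOf.card_pos {deg : A → ℤ} {s : Multiset A} {x : List A → K} (hx : MonOf K deg s x) :
    0 < s.card := by
  induction hx with
  | letter a => simp
  | bracket _ _ h1 _ => rw [Multiset.card_add]; omega

/-- Multiplication of the coefficient of each word `w` by `g |w|`. -/
def lenMul (g : ℕ → K) : (List A → K) →ₗ[K] (List A → K) where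
  toFun f w := g w.length * f w
  map_add' f f' := by funext w; simp [mul_add]
  map_smul' c f := by funext w; simp [mul_left_comm]

/-- Multiplication of the coefficient of each pair `(u, v)` of words by `g (|u| + |v|)`. -/
def lenMul₂ (g : ℕ → K) : (List A × List A → K) →ₗ[K] (List A × List A → K) where
  toFun F p := g (p.1.length + p.2.length) * F p
  map_add' f f' := by funext w; simp [mul_add]
  map_smul' c f := by funext w; simp [mul_left_comm]

theorem lenMul_apply (g : ℕ → K) (f : List A → K) (w : List A) :
    lenMul g f w = g w.length * f w := rfl

theorem lenMul₂_apply (g : ℕ → K) (F : List A × List A → K) (p : List A × List A) :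
    lenMul₂ g F p = g (p.1.length + p.2.length) * F p := rfl

theorem lenMul_mem_homog {𝒬 : ℤ → AddSubgroup K} {wt : A → ℤ} {n : ℤ} {g : ℕ → K}
    (hg : ∀ k n, ∀ x ∈ 𝒬 n, g k * x ∈ 𝒬 n) {f : List A → K} (hf : f ∈ homog 𝒬 wt n) :
    lenMul g f ∈ homog 𝒬 wt n := fun w => hg _ _ _ (hf w)

theorem lenMul₂_mem_tensorHomog {𝒬 : ℤ → AddSubgroup K} {wt : A → ℤ} {n : ℤ} {g : ℕ → K}
    (hg : ∀ k n, ∀ x ∈ 𝒬 n, g k * x ∈ 𝒬 n) {F : List A × List A → K}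
    (hF : F ∈ tensorHomog 𝒬 wt n) : lenMul₂ g F ∈ tensorHomog 𝒬 wt n := fun p => hg _ _ _ (hF p)

theorem tensorMul_lenMul₂ (g : ℕ → K) (F : List A × List A → K) :
    tensorMul (lenMul₂ g F) = lenMul g (tensorMul F) := by
  funext w
  rw [lenMul_apply, tensorMul_apply, tensorMul_apply, mul_splitSum]
  refine splitSum_congr fun u v h => ?_
  rw [lenMul₂_apply, ← h, List.length_append]

/-- All words of `f` have length `n`. -/
def OfLen (n : ℕ) (f : List A → K) : Prop := ∀ w, f w ≠ 0 → w.length = n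

/-- All pairs of words of `F` have total length `n`. -/
def OfLen₂ (n : ℕ) (F : List A × List A → K) : Prop :=
  ∀ p, F p ≠ 0 → p.1.length + p.2.length = n

theorem OfLen.lenMul_eq {n : ℕ} {f : List A → K} (hf : OfLen n f) (g : ℕ → K) :
    lenMul g f = g n • f := by
  funext w
  by_cases h : f w = 0
  · simp [lenMul_apply, h]
  · simp [lenMul_apply, hf w h]

theorem OfLen₂.lenMul₂_eq {n : ℕ} {F : List A × List A → K} (hF : OfLen₂ n F) (g : ℕ → K) :
    lenMul₂ g F = g n • F := by
  funext w
  by_cases h : F w = 0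
  · simp [lenMul₂_apply, h]
  · simp [lenMul₂_apply, hF w h]

theorem OfLen₂.sub {n : ℕ} {F G : List A × List A → K} (hF : OfLen₂ n F) (hG : OfLen₂ n G) :
    OfLen₂ n (F - G) := by
  intro p hp
  by_cases h : F p = 0
  · refine hG p fun h' => hp ?_
    rw [Pi.sub_apply, h, h', sub_zero]
  · exact hF p h

theorem MonOf.ofLen {deg : A → ℤ} {s : Multiset A} {x : List A → K} (hx : MonOf K deg s x) :
    OfLen s.card x := fun _ => hx.length_eq

theorem OfLen.tmul {m n : ℕ} {x y : List A → K} (hx : OfLen m x) (hy : OfLen n y) :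
    OfLen₂ (m + n) (tmul x y) := by
  intro p hp
  rw [hx p.1 fun h => hp (by simp [CInf.tmul, h]), hy p.2 fun h => hp (by simp [CInf.tmul, h])]

theorem OfLen₂.swap {n : ℕ} {F : List A × List A → K} (hF : OfLen₂ n F) (deg : A → ℤ) :
    OfLen₂ n (swap deg F) := by
  intro p hp
  rw [add_comm]
  refine hF (p.2, p.1) fun h => hp ?_
  simp [CInf.swap, h]

section Topology

variable [TopologicalSpace K] [DiscreteTopology K]

theorem continuous_lenMul (g : ℕ → K) : Continuous (lenMul (A := A) g) :=
  continuous_pi fun w => continuous_const.mul (continuous_apply w)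

theorem continuous_lenMul₂ (g : ℕ → K) : Continuous (lenMul₂ (A := A) g) :=
  continuous_pi fun w => continuous_const.mul (continuous_apply w)

theorem lenMul_mem_freeLie (g : ℕ → K) {deg : A → ℤ} {f : List A → K} (hf : f ∈ freeLie K deg) :
    lenMul g f ∈ freeLie K deg := by
  refine freeLie_le (Z := (freeLie K deg).comap (lenMul g))
    ((isClosed_freeLie deg).preimage (continuous_lenMul g)) (fun f hf => ?_) hf
  obtain ⟨s, hs⟩ := hf.exists_monOf
  rw [Submodule.mem_comap, hs.ofLen.lenMul_eq]
  exact Submodule.smul_mem _ _ hf.mem_freeLie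

theorem lenMul₂_mem_lieTensor (g : ℕ → K) {deg : A → ℤ} {F : List A × List A → K}
    (hF : F ∈ lieTensor K deg) : lenMul₂ g F ∈ lieTensor K deg := by
  refine lieTensor_le (Z := (lieTensor K deg).comap (lenMul₂ g))
    ((isClosed_lieTensor deg).preimage (continuous_lenMul₂ g)) (fun x y hx hy => ?_) hF
  obtain ⟨s, hs⟩ := hx.exists_monOf
  obtain ⟨t, ht⟩ := hy.exists_monOf
  rw [Submodule.mem_comap, (hs.ofLen.tmul ht.ofLen).lenMul₂_eq]
  exact Submodule.smul_mem _ _ (tmul_mem_lieTensor hx.mem_freeLie hy.mem_freeLie)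

theorem lenMul₂_mem_lieRel (g : ℕ → K) {deg : A → ℤ} {F : List A × List A → K}
    (hF : F ∈ lieRel K deg) : lenMul₂ g F ∈ lieRel K deg := by
  refine lieRel_le (Z := (lieRel K deg).comap (lenMul₂ g))
    ((isClosed_lieRel deg).preimage (continuous_lenMul₂ g)) (fun x y hx hy => ?_)
    (fun x y z hx hy hz => ?_) hF
  · obtain ⟨s, hs⟩ := hx.exists_monOf
    obtain ⟨t, ht⟩ := hy.exists_monOf
    have := hs.ofLen.tmul ht.ofLen
    rw [Submodule.mem_comap, (this.sub (this.swap deg)).lenMul₂_eq]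
    exact Submodule.smul_mem _ _ (symm_mem_lieRel hx.mem_freeLie hy.mem_freeLie)
  · obtain ⟨s, hs⟩ := hx.exists_monOf
    obtain ⟨t, ht⟩ := hy.exists_monOf
    obtain ⟨r, hr⟩ := hz.exists_monOf
    have h1 := hs.ofLen.tmul (ht.bracket hr).ofLen
    have h2 := (hs.bracket ht).ofLen.tmul hr.ofLen
    rw [Multiset.card_add] at h1 h2
    rw [add_assoc] at h2
    rw [Submodule.mem_comap, (h1.sub h2).lenMul₂_eq]
    exact Submodule.smul_mem _ _
      (invariance_mem_lieRel hx.mem_freeLie hy.mem_freeLie hz.mem_freeLie)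

theorem freeLie_apply_nil {deg : A → ℤ} {f : List A → K} (hf : f ∈ freeLie K deg) : f [] = 0 := by
  refine freeLie_le (Z := LinearMap.ker (LinearMap.proj (R := K) (φ := fun _ : List A => K) []))
    (isClosed_singleton.preimage (continuous_apply [])) (fun f hf => ?_) hf
  obtain ⟨s, hs⟩ := hf.exists_monOf
  rw [LinearMap.mem_ker, LinearMap.proj_apply]
  by_contra h
  have := hs.length_eq h
  have := hs.card_pos
  simp_all

theorem lieTensor_apply_nil {deg : A → ℤ} {F : List A × List A → K} (hF : F ∈ lieTensor K deg)
    (v : List A) : F ([], v) = 0 := by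
  refine lieTensor_le (Z := LinearMap.ker
    (LinearMap.proj (R := K) (φ := fun _ : List A × List A => K) ([], v)))
    (isClosed_singleton.preimage (continuous_apply ([], v))) (fun x y hx hy => ?_) hF
  rw [LinearMap.mem_ker, LinearMap.proj_apply, tmul, freeLie_apply_nil hx.mem_freeLie, zero_mul]

end Topology

/-- The inverse of the natural number `n`, in a `ℚ`-algebra. -/
def natInv (K : Type*) [CommRing K] [Algebra ℚ K] (n : ℕ) : K := algebraMap ℚ K (n : ℚ)⁻¹

theorem natInv_mul [Algebra ℚ K] {n : ℕ} (hn : n ≠ 0) : natInv K n * (n : K) = 1 := by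
  rw [natInv, ← map_natCast (algebraMap ℚ K), ← map_mul, inv_mul_cancel₀ (by exact_mod_cast hn),
    map_one]

/-- Homogeneous elements of a graded `ℚ`-algebra remain homogeneous after division by a natural
number. -/
theorem natInv_mul_mem [Algebra ℚ K] {𝒜 : ℤ → AddSubgroup K} [GradedRing 𝒜] (k : ℕ) (n : ℤ)
    (x : K) (hx : x ∈ 𝒜 n) : natInv K k * x ∈ 𝒜 n := by
  by_cases hk : k = 0
  · subst hk
    simp [natInv]
  set y := natInv K k * x with hy
  have hxy : x = k • y := by
    rw [hy, nsmul_eq_mul, ← mul_assoc, mul_comm (k : K), natInv_mul hk, one_mul]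
  have h0 : ∀ j, j ≠ n → (DirectSum.decompose 𝒜 y j : K) = 0 := by
    intro j hj
    have h1 : (DirectSum.decompose 𝒜 x j : K) = 0 := DirectSum.decompose_of_mem_ne 𝒜 hx hj.symm
    have h4 : DirectSum.decompose 𝒜 (k • y) = k • DirectSum.decompose 𝒜 y :=
      map_nsmul (DirectSum.decomposeAddEquiv 𝒜) k y
    rw [hxy, h4, DirectSum.smul_apply] at h1
    rw [← one_mul (DirectSum.decompose 𝒜 y j : K), ← natInv_mul (K := K) hk, mul_assoc]
    have h2 : (k : K) * (DirectSum.decompose 𝒜 y j : K) = 0 := by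
      rw [← nsmul_eq_mul]
      exact h1
    rw [h2, mul_zero]
  have h3 : (DirectSum.decompose 𝒜 y n : K) = y := by
    classical
    conv_rhs => rw [← DirectSum.sum_support_decompose 𝒜 y]
    by_cases hn : n ∈ (DirectSum.decompose 𝒜 y).support
    · rw [Finset.sum_eq_single n (fun j _ hj => h0 j hj) fun h => absurd hn h]
    · rw [Finset.sum_eq_zero]
      · rw [DFinsupp.notMem_support_iff] at hn
        rw [hn]; rfl
      · intro j hj
        exact h0 j fun h => hn (h ▸ hj)
  rw [← h3]
  exact SetLike.coe_mem _

end Length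

/-! ### The Lie de Rham complex in form degrees zero and one -/

section DeRham

variable {K I : Type*} [CommRing K] [TopologicalSpace K] [DiscreteTopology K] {d : I → ℤ}

/-- The part of form degree `p`. -/
def formPart (p : ℕ) :
    (List (I ⊕ I) × List (I ⊕ I) → K) →ₗ[K] (List (I ⊕ I) × List (I ⊕ I) → K) where
  toFun F q := if formDeg q.1 + formDeg q.2 = p then F q else 0
  map_add' F G := by funext q; simp only [Pi.add_apply]; split_ifs <;> simp
  map_smul' c F := by funext q; simp only [Pi.smul_apply, RingHom.id_apply]; split_ifs <;> simp

theorem continuous_formPart (p : ℕ) : Continuous (formPart (K := K) (I := I) p) := by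
  refine continuous_pi fun q => ?_
  by_cases h : formDeg q.1 + formDeg q.2 = p
  · exact (continuous_congr fun F => if_pos h).2 (continuous_apply q)
  · exact (continuous_congr fun F => if_neg h).2 continuous_const

theorem formPart_eq_self {p : ℕ} {F : List (I ⊕ I) × List (I ⊕ I) → K}
    (hF : F ∈ tensorHomog (zeroSub K) formWt p) : formPart p F = F := by
  funext q
  by_cases h : formDeg q.1 + formDeg q.2 = p
  · exact if_pos h
  · refine (if_neg h).trans (hF q ?_).symm
    rw [wdeg_formWt, wdeg_formWt]
    omega

theorem formPart_eq_zero {p n : ℕ} {F : List (I ⊕ I) × List (I ⊕ I) → K}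
    (hF : F ∈ tensorHomog (zeroSub K) formWt n) (hn : n ≠ p) : formPart p F = 0 := by
  funext q
  by_cases h : formDeg q.1 + formDeg q.2 = p
  · refine (if_pos h).trans (hF q ?_)
    rw [wdeg_formWt, wdeg_formWt]
    omega
  · exact if_neg h

theorem MonOf.mem_formWt {s : Multiset (I ⊕ I)} {x : List (I ⊕ I) → K}
    (hx : MonOf K (fdeg d) s x) :
    x ∈ homog (zeroSub K) formWt (s.countP fun a => a.isRight = true : ℕ) := by
  have h := hx.mem_homog (wt := formWt) zeroSub_isMul one_mem_zeroSub
  have key : ∀ s : Multiset (I ⊕ I), ((s.countP fun a => a.isRight = true : ℕ) : ℤ) =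
      (s.map formWt).sum := by
    intro s
    induction s using Multiset.induction_on with
    | empty => simp
    | cons a s ih =>
      rw [Multiset.countP_cons, Multiset.map_cons, Multiset.sum_cons, ← ih]
      cases a <;> simp [formWt, add_comm]
  rwa [key]

theorem mem_lieRel_of_sub {F G : List (I ⊕ I) × List (I ⊕ I) → K}
    (h : F - G ∈ lieRel K (fdeg d)) (hG : G ∈ lieRel K (fdeg d)) : F ∈ lieRel K (fdeg d) := by
  have := add_mem h hG
  rwa [sub_add_cancel] at this

/-- The one-form `∑ i, dt i ⊗ y i`, where `y i` are the coefficients of a given one-form. -/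
def normalForm (d : I → ℤ) :
    (List (I ⊕ I) × List (I ⊕ I) → K) →ₗ[K] (List (I ⊕ I) × List (I ⊕ I) → K) :=
  tform Sum.inr ∘ₗ LinearMap.pi (coeff d)

/-- The zero-form `∑ i, t i ⊗ y i`, where `y i` are the coefficients of a given one-form: the
contraction with the Euler vector field. -/
def euler (d : I → ℤ) :
    (List (I ⊕ I) × List (I ⊕ I) → K) →ₗ[K] (List (I ⊕ I) × List (I ⊕ I) → K) :=
  tform Sum.inl ∘ₗ LinearMap.pi (coeff d)

/-- The series `∑ i, [t i, y i]`, where `y i` are the coefficients of a given one-form. -/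
def moment (d : I → ℤ) : (List (I ⊕ I) × List (I ⊕ I) → K) →ₗ[K] (List I → K) :=
  bsum (tdeg d) ∘ₗ LinearMap.pi (coeff d)

theorem continuous_coeffs : Continuous (LinearMap.pi (coeff (K := K) d)) :=
  continuous_pi fun i => continuous_coeff i

theorem continuous_normalForm : Continuous (normalForm (K := K) d) :=
  (continuous_tform Sum.inr_injective).comp continuous_coeffs

theorem continuous_euler : Continuous (euler (K := K) d) :=
  (continuous_tform Sum.inl_injective).comp continuous_coeffs

theorem continuous_moment : Continuous (moment (K := K) d) :=
  (continuous_bsum _).comp continuous_coeffs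

theorem coeffs_eq_zero {F : List (I ⊕ I) × List (I ⊕ I) → K} (hF : F ∈ lieRel K (fdeg d)) :
    LinearMap.pi (coeff d) F = 0 :=
  funext fun i => coeff_eq_zero_of_mem_lieRel hF i

theorem normalForm_eq_zero {F : List (I ⊕ I) × List (I ⊕ I) → K} (hF : F ∈ lieRel K (fdeg d)) :
    normalForm d F = 0 := by
  rw [normalForm, LinearMap.comp_apply, coeffs_eq_zero hF, map_zero]

theorem euler_eq_zero {F : List (I ⊕ I) × List (I ⊕ I) → K} (hF : F ∈ lieRel K (fdeg d)) :
    euler d F = 0 := by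
  rw [euler, LinearMap.comp_apply, coeffs_eq_zero hF, map_zero]

theorem moment_eq_zero {F : List (I ⊕ I) × List (I ⊕ I) → K} (hF : F ∈ lieRel K (fdeg d)) :
    moment d F = 0 := by
  rw [moment, LinearMap.comp_apply, coeffs_eq_zero hF, map_zero]

theorem moment_congr {F G : List (I ⊕ I) × List (I ⊕ I) → K} (h : F - G ∈ lieRel K (fdeg d)) :
    moment d F = moment d G := by
  rw [← sub_eq_zero, ← map_sub, moment_eq_zero h]

theorem coeffs_tform (y : I → List I → K) :
    LinearMap.pi (coeff d) (tform Sum.inr y) = y :=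
  funext fun i => coeff_tform y i

theorem moment_tform (y : I → List I → K) : moment d (tform Sum.inr y) = bsum (tdeg d) y := by
  rw [moment, LinearMap.comp_apply, coeffs_tform]

/-- The elements that are congruent to their normal form, with coefficients that are Lie
elements. -/
def normalSub (K : Type*) [CommRing K] [TopologicalSpace K] [DiscreteTopology K] (d : I → ℤ) :
    Submodule K (List (I ⊕ I) × List (I ⊕ I) → K) :=
  (lieRel K (fdeg d)).comap (LinearMap.id - normalForm d) ⊓
    ⨅ i, (freeLie K (tdeg d)).comap (coeff d i)

theorem mem_normalSub {F : List (I ⊕ I) × List (I ⊕ I) → K} :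
    F ∈ normalSub K d ↔ F - normalForm d F ∈ lieRel K (fdeg d) ∧
      ∀ i, coeff d i F ∈ freeLie K (tdeg d) := by
  simp [normalSub, Submodule.mem_iInf]

theorem isClosed_normalSub :
    IsClosed (normalSub K d : Set (List (I ⊕ I) × List (I ⊕ I) → K)) := by
  have : (normalSub K d : Set (List (I ⊕ I) × List (I ⊕ I) → K)) =
      {F | F - normalForm d F ∈ lieRel K (fdeg d)} ∩
      ⋂ i, {F | coeff d i F ∈ freeLie K (tdeg d)} := by
    ext F
    simp [mem_normalSub]
  rw [this]
  exact ((isClosed_lieRel _).preimage (continuous_id.sub continuous_normalForm)).inter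
    (isClosed_iInter fun i => (isClosed_freeLie _).preimage (continuous_coeff i))

theorem lieRel_le_normalSub : lieRel K (fdeg d) ≤ normalSub K d := by
  intro F hF
  rw [mem_normalSub, normalForm_eq_zero hF, sub_zero]
  exact ⟨hF, fun i => by rw [coeff_eq_zero_of_mem_lieRel hF]; exact zero_mem _⟩

theorem mem_normalSub_of_sub {F G : List (I ⊕ I) × List (I ⊕ I) → K}
    (h : F - G ∈ lieRel K (fdeg d)) (hG : G ∈ normalSub K d) : F ∈ normalSub K d := by
  have := add_mem (lieRel_le_normalSub h) hG
  rwa [sub_add_cancel] at this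

theorem tform_mem_normalSub {y : I → List I → K} (hy : ∀ i, y i ∈ freeLie K (tdeg d)) :
    tform Sum.inr y ∈ normalSub K d := by
  rw [mem_normalSub]
  refine ⟨?_, fun i => by rw [coeff_tform]; exact hy i⟩
  rw [normalForm, LinearMap.comp_apply, coeffs_tform, sub_self]
  exact zero_mem _

/-- Moving all brackets into the second factor. -/
theorem MonOf.tmul_mem_normalSub {s : Multiset (I ⊕ I)} {x : List (I ⊕ I) → K}
    (hx : MonOf K (fdeg d) s x) (hs : s.countP (fun a => a.isRight = true) = 1) :
    ∀ t y, MonOf K (tdeg d) t y → tmul x (incl y) ∈ normalSub K d := by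
  classical
  induction hx with
  | letter a =>
    intro t y hy
    cases a with
    | inl i =>
      rw [← Multiset.cons_zero, Multiset.countP_cons] at hs
      simp at hs
    | inr i =>
      rw [← tform_single Sum.inr_injective]
      refine tform_mem_normalSub fun j => ?_
      by_cases h : j = i
      · subst h; rw [Pi.single_eq_same]; exact hy.mem_freeLie
      · rw [Pi.single_eq_of_ne h]; exact zero_mem _
  | @bracket s₁ s₂ x₁ x₂ h₁ h₂ ih₁ ih₂ =>
    intro t y hy
    rw [Multiset.countP_add] at hs
    have key : ∀ {s₁ s₂ : Multiset (I ⊕ I)} {x₁ x₂}, MonOf K (fdeg d) s₁ x₁ →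
        MonOf K (fdeg d) s₂ x₂ → s₂.countP (fun a => a.isRight = true) = 0 →
        (∀ t y, MonOf K (tdeg d) t y → tmul x₁ (incl y) ∈ normalSub K d) →
        tmul (CInf.bracket (fdeg d) x₁ x₂) (incl y) ∈ normalSub K d := by
      intro s₁ s₂ x₁ x₂ h₁ h₂ h0 ih
      obtain ⟨t', x', hx', rfl, -⟩ := h₂.eq_incl h0
      have h := neg_mem (invariance_mem_lieRel h₁.mem_freeLie h₂.mem_freeLie
        (incl_mem_freeLie hy.mem_freeLie))
      rw [neg_sub, ← incl_bracket] at h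
      exact mem_normalSub_of_sub h (ih _ _ (hx'.bracket hy))
    by_cases h0 : s₂.countP (fun a => a.isRight = true) = 0
    · exact key h₁ h₂ h0 (ih₁ (by omega))
    · rw [h₁.hasPar.bracket_symm h₂.hasPar, tmul_neg_left, tmul_usmul_left]
      exact neg_mem (usmul_mem (S := (normalSub K d).toAddSubgroup) _
        (key h₂ h₁ (by omega) (ih₂ (by omega))))

/-- Every element of form degree one of the Lie de Rham complex has the form
`∑ i, dt i ⊗ y i` with Lie elements `y i`. -/
theorem mem_normalSub_of_formDeg_one {F : List (I ⊕ I) × List (I ⊕ I) → K}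
    (hF : F ∈ lieTensor K (fdeg d)) (h1 : F ∈ tensorHomog (zeroSub K) formWt (1 : ℕ)) :
    F ∈ normalSub K d := by
  rw [← formPart_eq_self h1]
  refine lieTensor_le (Z := (normalSub K d).comap (formPart 1))
    (isClosed_normalSub.preimage (continuous_formPart 1)) (fun x y hx hy => ?_) hF
  obtain ⟨s, hs⟩ := hx.exists_monOf
  obtain ⟨t, ht⟩ := hy.exists_monOf
  rw [Submodule.mem_comap]
  have h := tmul_mem_tensorHomog zeroSub_isMul hs.mem_formWt ht.mem_formWt
  rw [← Nat.cast_add] at h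
  by_cases hst : s.countP (fun a => a.isRight = true) + t.countP (fun a => a.isRight = true) = 1
  · rw [hst] at h
    rw [formPart_eq_self h]
    by_cases ht0 : t.countP (fun a => a.isRight = true) = 0
    · obtain ⟨t', y', hy', rfl, -⟩ := ht.eq_incl ht0
      exact hs.tmul_mem_normalSub (by omega) _ _ hy'
    · obtain ⟨s', x', hx', rfl, -⟩ := hs.eq_incl (by omega)
      exact mem_normalSub_of_sub (swap_mem_lieRel hs.mem_freeLie ht.mem_freeLie hs.hasPar ht.hasPar)
        (usmul_mem (S := (normalSub K d).toAddSubgroup) _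
          (ht.tmul_mem_normalSub (by omega) _ _ hx'))
  · rw [formPart_eq_zero h hst]
    exact zero_mem _

/-- One-forms with the same coefficients are equal in the Lie de Rham complex. -/
theorem sub_mem_lieRel_of_coeff_eq {F G : List (I ⊕ I) × List (I ⊕ I) → K}
    (hF : F ∈ normalSub K d) (hG : G ∈ normalSub K d) (h : ∀ i, coeff d i F = coeff d i G) :
    F - G ∈ lieRel K (fdeg d) := by
  have h1 := sub_mem (mem_normalSub.1 hF).1 (mem_normalSub.1 hG).1
  have h2 : normalForm d F = normalForm d G := by
    rw [normalForm, LinearMap.comp_apply, LinearMap.comp_apply]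
    congr 1
    exact funext h
  rwa [h2, sub_sub_sub_cancel_right] at h1

end DeRham

/-! ### Exactness of the de Rham differential -/

section DeRham

variable {K I : Type*} [CommRing K] [TopologicalSpace K] [DiscreteTopology K] {d : I → ℤ}

theorem dForm_incl_mem_freeLie {x : List I → K} (hx : x ∈ freeLie K (tdeg d)) :
    dForm K d (incl x) ∈ freeLie K (fdeg d) :=
  isOddDer_dForm.mem_freeLie dForm_letter_mem_freeLie (incl_mem_freeLie hx)

theorem hasPar_incl {p : ℤ} {x : List I → K} (hx : HasPar (tdeg d) p x) :
    HasPar (fdeg d) p (incl x) := incl_mem_homog hx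

/-- The Leibniz rule for `d [x₁, x₂] ⊗ y` in the Lie de Rham complex. -/
theorem dForm_bracket_rel {p q : ℤ} {x₁ x₂ y : List I → K} (h₁ : x₁ ∈ freeLie K (tdeg d))
    (h₂ : x₂ ∈ freeLie K (tdeg d)) (hy : y ∈ freeLie K (tdeg d)) (p₁ : HasPar (tdeg d) p x₁)
    (p₂ : HasPar (tdeg d) q x₂) :
    tmul (dForm K d (incl (bracket (tdeg d) x₁ x₂))) (incl y) -
      (tmul (dForm K d (incl x₁)) (incl (bracket (tdeg d) x₂ y)) - (p * q).negOnePow •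
        tmul (dForm K d (incl x₂)) (incl (bracket (tdeg d) x₁ y))) ∈ lieRel K (fdeg d) := by
  have r1 := invariance_mem_lieRel (dForm_incl_mem_freeLie h₁) (incl_mem_freeLie h₂)
    (incl_mem_freeLie hy)
  have r2 := invariance_mem_lieRel (dForm_incl_mem_freeLie h₂) (incl_mem_freeLie h₁)
    (incl_mem_freeLie hy)
  have e : dForm K d (incl (bracket (tdeg d) x₁ x₂)) =
      bracket (fdeg d) (dForm K d (incl x₁)) (incl x₂) -
        (p * q).negOnePow • bracket (fdeg d) (dForm K d (incl x₂)) (incl x₁) := by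
    rw [incl_bracket, isOddDer_dForm.bracket (hasPar_incl p₁) (hasPar_incl p₂),
      (hasPar_incl p₁).bracket_symm (isOddDer_dForm.hasPar (hasPar_incl p₂)), mul_add, mul_one,
      Int.negOnePow_add]
    generalize (p * q).negOnePow = a
    generalize p.negOnePow = b
    simp only [smul_neg, smul_smul, sub_eq_add_neg]
    congr 3
    rcases Int.units_eq_one_or a with rfl | rfl <;> rcases Int.units_eq_one_or b with rfl | rfl <;>
    simp
  rw [e, tmul_sub_left, tmul_usmul_left, incl_bracket, incl_bracket]
  have r3 : (p * q).negOnePow • _ ∈ lieRel K (fdeg d) :=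
    usmul_mem (S := (lieRel K (fdeg d)).toAddSubgroup) (p * q).negOnePow r2
  convert sub_mem r3 r1 using 1
  rw [smul_sub]
  abel

theorem bsum_coeff_tmul_letter (i : I) (y : List I → K) :
    moment d (tmul (letter K (Sum.inr i)) (incl y)) = bracket (tdeg d) (letter K i) y := by
  classical
  rw [← tform_single Sum.inr_injective, moment_tform, bsum_single]

theorem moment_dForm_mon {s : Multiset I} {x : List I → K} (hx : MonOf K (tdeg d) s x) :
    ∀ t y, MonOf K (tdeg d) t y →
      moment d (tmul (dForm K d (incl x)) (incl y)) = bracket (tdeg d) x y := by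
  induction hx with
  | letter i =>
    intro t y hy
    rw [incl_letter, dForm_letter_inl, bsum_coeff_tmul_letter]
  | bracket h₁ h₂ ih₁ ih₂ =>
    intro t y hy
    rw [moment_congr (dForm_bracket_rel h₁.mem_freeLie h₂.mem_freeLie hy.mem_freeLie h₁.hasPar
      h₂.hasPar), map_sub, map_usmul, ih₁ _ _ (h₂.bracket hy), ih₂ _ _ (h₁.bracket hy),
      h₁.hasPar.jacobi h₂.hasPar hy.hasPar]

/-- The moment of `dx ⊗ y` is `[x, y]`. -/
theorem moment_dForm_tmul {x y : List I → K} (hx : x ∈ freeLie K (tdeg d))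
    (hy : y ∈ freeLie K (tdeg d)) :
    moment d (tmul (dForm K d (incl x)) (incl y)) = bracket (tdeg d) x y := by
  rw [← bracketB_apply]
  have cd : Continuous (dForm K d ∘ₗ (inclL : (List I → K) →ₗ[K] _)) :=
    isOddDer_dForm.cont.comp continuous_inclL
  have h1 : ∀ x, LieMonomial K (tdeg d) x → ∀ y ∈ freeLie K (tdeg d),
      moment d (tmul (dForm K d (incl x)) (incl y)) = bracketB (tdeg d) x y := by
    intro x hx y hy
    refine eq_of_lieMonomial (Φ := moment d ∘ₗ tmulB (dForm K d (incl x)) ∘ₗ inclL)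
      (Ψ := bracketB (tdeg d) x) ?_ ?_ ?_ hy
    · exact continuous_moment.comp ((continuous_tmul_right _).comp continuous_inclL)
    · simpa only [← bracketB_apply] using continuous_bracket_right (tdeg d) x
    · intro y hy
      obtain ⟨s, hs⟩ := hx.exists_monOf
      obtain ⟨t, ht⟩ := hy.exists_monOf
      rw [bracketB_apply]
      exact moment_dForm_mon hs _ _ ht
  refine eq_of_lieMonomial (Φ := moment d ∘ₗ tmulB.flip (incl y) ∘ₗ dForm K d ∘ₗ inclL)
    (Ψ := (bracketB (tdeg d)).flip y) ?_ ?_ (fun x hx => h1 x hx y hy) hx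
  · exact continuous_moment.comp ((continuous_tmul_left _).comp cd)
  · simpa only [← bracketB_apply] using! continuous_bracket_left (tdeg d) y

/-- The contraction of `dx ⊗ y` with the Euler vector field is `|x| x ⊗ y`. -/
theorem euler_dForm_mon {s : Multiset I} {x : List I → K} (hx : MonOf K (tdeg d) s x) :
    ∀ t y, MonOf K (tdeg d) t y → euler d (tmul (dForm K d (incl x)) (incl y)) -
      (s.card : K) • tmul (incl x) (incl y) ∈ lieRel K (fdeg d) := by
  classical
  induction hx with
  | letter i =>
    intro t y hy
    have : euler d (tmul (letter K (Sum.inr i)) (incl y)) =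
        tmul (letter K (Sum.inl i)) (incl y) := by
      rw [← tform_single Sum.inr_injective, euler, LinearMap.comp_apply, coeffs_tform,
        tform_single Sum.inl_injective]
    rw [incl_letter, dForm_letter_inl, this]
    simp
  | @bracket s₁ s₂ x₁ x₂ h₁ h₂ ih₁ ih₂ =>
    intro t y hy
    have e := euler_eq_zero (dForm_bracket_rel h₁.mem_freeLie h₂.mem_freeLie hy.mem_freeLie
      h₁.hasPar h₂.hasPar)
    rw [map_sub, sub_eq_zero, map_sub, map_usmul] at e
    have i1 := ih₁ _ _ (h₂.bracket hy)
    have i2 := ih₂ _ _ (h₁.bracket hy)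
    have r1 := invariance_mem_lieRel (incl_mem_freeLie h₁.mem_freeLie)
      (incl_mem_freeLie h₂.mem_freeLie) (incl_mem_freeLie hy.mem_freeLie)
    have r2 := invariance_mem_lieRel (incl_mem_freeLie h₂.mem_freeLie)
      (incl_mem_freeLie h₁.mem_freeLie) (incl_mem_freeLie hy.mem_freeLie)
    simp only [← incl_bracket] at r1 r2
    rw [h₂.hasPar.bracket_symm h₁.hasPar, mul_comm] at r2
    rw [e]
    set ε := ((s₁.map (tdeg d)).sum * (s₂.map (tdeg d)).sum).negOnePow with hε
    set X := tmul (incl (bracket (tdeg d) x₁ x₂)) (incl y) with hX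
    have e3 : tmul (incl (-(ε • bracket (tdeg d) x₁ x₂))) (incl y) = -(ε • X) := by
      rw [incl_neg, ← inclL_apply, map_usmul, tmul_neg_left, tmul_usmul_left]; rfl
    rw [e3] at r2
    have h3 := add_mem (add_mem i1 (Submodule.smul_mem _ (s₁.card : K) r1))
      (neg_mem (usmul_mem (S := (lieRel K (fdeg d)).toAddSubgroup) ε
        (add_mem i2 (Submodule.smul_mem _ (s₂.card : K) r2))))
    convert h3 using 1
    rw [Multiset.card_add, Nat.cast_add]
    rcases Int.units_eq_one_or ε with h | h <;> rw [h] <;>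
      simp only [one_smul, Units.neg_smul] <;> module

theorem dDR_tmul_incl_rel {p q : ℤ} {x y : List I → K} (hx : x ∈ freeLie K (tdeg d))
    (hy : y ∈ freeLie K (tdeg d)) (px : HasPar (tdeg d) p x) (py : HasPar (tdeg d) q y) :
    dDR K d (tmul (incl x) (incl y)) - (tmul (dForm K d (incl x)) (incl y) +
      (p * q).negOnePow • tmul (dForm K d (incl y)) (incl x)) ∈ lieRel K (fdeg d) := by
  have r := swap_mem_lieRel (incl_mem_freeLie hx) (dForm_incl_mem_freeLie hy) (hasPar_incl px)
    (isOddDer_dForm.hasPar (hasPar_incl py))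
  rw [dDR, tensorOdd_tmul, add_sub_add_left_eq_sub, (hasPar_incl px).parity_eq, tmul_usmul_left]
  convert usmul_mem (S := (lieRel K (fdeg d)).toAddSubgroup) p.negOnePow r using 1
  rw [smul_sub, smul_smul, mul_add, mul_one, Int.negOnePow_add]
  generalize (p * q).negOnePow = a
  generalize p.negOnePow = b
  rcases Int.units_eq_one_or a with rfl | rfl <;> rcases Int.units_eq_one_or b with rfl | rfl <;>
    simp

/-- To check a closed linear condition on the elements of form degree zero, it suffices to check it
on tensors of Lie monomials in the letters `t i`. -/
theorem lieTensor_zero_induction {Z : Submodule K (List (I ⊕ I) × List (I ⊕ I) → K)}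
    (hZ : IsClosed (Z : Set (List (I ⊕ I) × List (I ⊕ I) → K)))
    (h : ∀ s x t y, MonOf K (tdeg d) s x → MonOf K (tdeg d) t y → tmul (incl x) (incl y) ∈ Z)
    {E : List (I ⊕ I) × List (I ⊕ I) → K} (hE : E ∈ lieTensor K (fdeg d))
    (h0 : E ∈ tensorHomog (zeroSub K) formWt (0 : ℕ)) : E ∈ Z := by
  rw [← formPart_eq_self h0]
  refine lieTensor_le (Z := Z.comap (formPart 0)) (hZ.preimage (continuous_formPart 0))
    (fun x y hx hy => ?_) hE
  obtain ⟨s, hs⟩ := hx.exists_monOf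
  obtain ⟨t, ht⟩ := hy.exists_monOf
  rw [Submodule.mem_comap]
  have h' := tmul_mem_tensorHomog zeroSub_isMul hs.mem_formWt ht.mem_formWt
  rw [← Nat.cast_add] at h'
  by_cases hst : s.countP (fun a => a.isRight = true) + t.countP (fun a => a.isRight = true) = 0
  · rw [hst] at h'
    rw [formPart_eq_self h']
    obtain ⟨s', x', hx', rfl, -⟩ := hs.eq_incl (by omega)
    obtain ⟨t', y', hy', rfl, -⟩ := ht.eq_incl (by omega)
    exact h _ _ _ _ hx' hy'
  · rw [formPart_eq_zero h' hst]
    exact zero_mem _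

theorem continuous_dDR : Continuous (dDR K d) := continuous_tensorOdd _ isOddDer_dForm.cont

/-- The moment of an exact one-form vanishes. -/
theorem moment_dDR {E : List (I ⊕ I) × List (I ⊕ I) → K} (hE : E ∈ lieTensor K (fdeg d))
    (h0 : E ∈ tensorHomog (zeroSub K) formWt (0 : ℕ)) : moment d (dDR K d E) = 0 := by
  refine lieTensor_zero_induction (Z := LinearMap.ker (moment d ∘ₗ dDR K d))
    (isClosed_singleton.preimage (continuous_moment.comp continuous_dDR)) ?_ hE h0
  intro s x t y hx hy
  rw [LinearMap.mem_ker, LinearMap.comp_apply,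
    moment_congr (dDR_tmul_incl_rel hx.mem_freeLie hy.mem_freeLie hx.hasPar hy.hasPar), map_add,
    map_usmul, moment_dForm_tmul hx.mem_freeLie hy.mem_freeLie,
    moment_dForm_tmul hy.mem_freeLie hx.mem_freeLie, hx.hasPar.bracket_symm hy.hasPar,
    neg_add_cancel]

/-- The Poincaré lemma in form degree zero: contracting `dE` with the Euler vector field multiplies
`E` by its length. -/
theorem euler_dDR {E : List (I ⊕ I) × List (I ⊕ I) → K} (hE : E ∈ lieTensor K (fdeg d))
    (h0 : E ∈ tensorHomog (zeroSub K) formWt (0 : ℕ)) :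
    euler d (dDR K d E) - lenMul₂ (fun n => (n : K)) E ∈ lieRel K (fdeg d) := by
  set Φ : (List (I ⊕ I) × List (I ⊕ I) → K) →ₗ[K] (List (I ⊕ I) × List (I ⊕ I) → K) :=
    euler d ∘ₗ dDR K d - lenMul₂ (fun n => (n : K)) with hΦ
  have hc : Continuous Φ :=
    (continuous_euler.comp continuous_dDR).sub (continuous_lenMul₂ _)
  refine lieTensor_zero_induction (Z := (lieRel K (fdeg d)).comap Φ)
    ((isClosed_lieRel (K := K) (fdeg d)).preimage hc) ?_ hE h0
  intro s x t y hx hy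
  change euler d (dDR K d (tmul (incl x) (incl y))) -
    lenMul₂ (fun n => (n : K)) (tmul (incl x) (incl y)) ∈ lieRel K (fdeg d)
  have e := euler_eq_zero (dDR_tmul_incl_rel hx.mem_freeLie hy.mem_freeLie hx.hasPar hy.hasPar)
  rw [map_sub, sub_eq_zero, map_add, map_usmul] at e
  have hl : ∀ {s : Multiset I} {x : List I → K}, MonOf K (tdeg d) s x →
      OfLen s.card (incl x) := by
    intro s x hx w hw
    by_cases h : formDeg w = 0
    · obtain ⟨v, rfl⟩ := exists_eq_map_inl h
      rw [incl_map] at hw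
      rw [List.length_map, hx.length_eq hw]
    · exact absurd (incl_of_ne x h) hw
  rw [e, ((hl hx).tmul (hl hy)).lenMul₂_eq]
  have r := swap_mem_lieRel (incl_mem_freeLie hx.mem_freeLie) (incl_mem_freeLie hy.mem_freeLie)
    (hasPar_incl hx.hasPar) (hasPar_incl hy.hasPar)
  set ε := ((s.map (tdeg d)).sum * (t.map (tdeg d)).sum).negOnePow
  have h3 := add_mem (euler_dForm_mon hx _ _ hy) (sub_mem
    (usmul_mem (S := (lieRel K (fdeg d)).toAddSubgroup) ε (euler_dForm_mon hy _ _ hx))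
    (Submodule.smul_mem _ (t.card : K) r))
  convert h3 using 1
  push_cast
  rcases Int.units_eq_one_or ε with h | h <;> rw [h] <;>
    simp only [one_smul, Units.neg_smul] <;> module

variable [Algebra ℚ K]

/-- The de Rham differential is injective on the part of form degree zero. -/
theorem mem_lieRel_of_dDR_mem {E : List (I ⊕ I) × List (I ⊕ I) → K}
    (hE : E ∈ lieTensor K (fdeg d)) (h0 : E ∈ tensorHomog (zeroSub K) formWt (0 : ℕ))
    (h : dDR K d E ∈ lieRel K (fdeg d)) : E ∈ lieRel K (fdeg d) := by
  have h1 := euler_dDR hE h0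
  rw [euler_eq_zero h, zero_sub] at h1
  have h2 := lenMul₂_mem_lieRel (natInv K) (neg_mem h1)
  rw [neg_neg] at h2
  convert h2 using 1
  funext p
  rw [lenMul₂_apply, lenMul₂_apply, ← mul_assoc]
  by_cases hp : p.1.length + p.2.length = 0
  · have : p.1 = [] := List.length_eq_zero_iff.1 (by omega)
    obtain ⟨u, v⟩ := p
    dsimp only at this
    subst this
    rw [lieTensor_apply_nil hE, mul_zero]
  · rw [natInv_mul hp, one_mul]

theorem oddDer_cons {A : Type*} (deg : A → ℤ) (δ : A → List A → K) (f : List A → K) (c : A)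
    (w : List A) : oddDer deg δ f (c :: w) =
      splitSum (c :: w) (fun v u' => ∑ a ∈ lettersAt δ v, f (a :: u') * δ a v) +
        (deg c).negOnePow • oddDer deg δ (fun v => f (c :: v)) w := by
  rw [oddDer_apply, splitSum_cons, oddDer_apply, smul_splitSum]
  simp only [wdeg_nil, Int.negOnePow_zero, one_smul, List.nil_append]
  congr 1
  refine splitSum_congr fun u r _ => ?_
  rw [smul_splitSum]
  refine splitSum_congr fun v u' _ => ?_
  rw [Finset.smul_sum]
  simp only [wdeg_cons, Int.negOnePow_add, smul_smul, List.cons_append]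

theorem splitSum_dForm_inl (f : List (I ⊕ I) → K) (i : I) (w : List (I ⊕ I)) :
    splitSum (Sum.inl i :: w) (fun v u' => ∑ a ∈ lettersAt (Sum.elim
      (fun i => letter K (Sum.inr i)) fun _ => 0 : I ⊕ I → List (I ⊕ I) → K) v, f (a :: u') *
        (Sum.elim (fun i => letter K (Sum.inr i)) fun _ => 0 : I ⊕ I → List (I ⊕ I) → K) a v) =
      0 := by
  refine splitSum_eq_zero fun v u' h => Finset.sum_eq_zero fun a _ => ?_
  cases a with
  | inl k =>
    rw [Sum.elim_inl, letter_apply_of_ne, mul_zero]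
    rintro rfl
    simp at h
  | inr k => simp

theorem splitSum_dForm_inr (f : List (I ⊕ I) → K) (j : I) (w : List (I ⊕ I)) :
    splitSum (Sum.inr j :: w) (fun v u' => ∑ a ∈ lettersAt (Sum.elim
      (fun i => letter K (Sum.inr i)) fun _ => 0 : I ⊕ I → List (I ⊕ I) → K) v, f (a :: u') *
        (Sum.elim (fun i => letter K (Sum.inr i)) fun _ => 0 : I ⊕ I → List (I ⊕ I) → K) a v) =
      f (Sum.inl j :: w) := by
  rw [splitSum_cons, Finset.sum_eq_zero, zero_add, splitSum_eq_single_left]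
  · rw [Finset.sum_eq_single (Sum.inl j)]
    · simp [letter_apply_self]
    · intro a _ ha
      cases a with
      | inl k =>
        rw [Sum.elim_inl, letter_apply_of_ne, mul_zero]
        simpa using fun h => ha (by rw [h])
      | inr k => simp
    · intro h
      rw [adm_dForm.mem_lettersAt, not_not] at h
      rw [h, mul_zero]
  · intro u v _ hu
    refine Finset.sum_eq_zero fun a _ => ?_
    cases a with
    | inl k =>
      rw [Sum.elim_inl, letter_apply_of_ne, mul_zero]
      simp [hu]
    | inr k => simp
  · intro a _
    cases a with
    | inl k => rw [Sum.elim_inl, letter_apply_of_ne (by simp), mul_zero]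
    | inr k => simp

/-- The coefficient of `u dt_j v` in the differential of a function. -/
theorem dForm_incl_apply (h : List I → K) (u : List I) (j : I) (v : List I) :
    dForm K d (incl h) (u.map Sum.inl ++ Sum.inr j :: v.map Sum.inl) =
      (wdeg (tdeg d) u).negOnePow • h (u ++ j :: v) := by
  induction u generalizing h with
  | nil =>
    have h0 : (fun w => incl h (Sum.inr j :: w)) = 0 := by
      funext w
      refine incl_of_ne h ?_
      rw [formDeg_cons_inr]
      omega
    rw [List.map_nil, List.nil_append, dForm, oddDer_cons, splitSum_dForm_inr, h0, map_zero]
    have := incl_map h (j :: v)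
    simpa [wdeg_nil] using this
  | cons i u ih =>
    have h0 : (fun w => incl h (Sum.inl i :: w)) = incl fun w => h (i :: w) := by
      funext w
      by_cases hw : formDeg w = 0
      · obtain ⟨v, rfl⟩ := exists_eq_map_inl hw
        rw [incl_map, ← List.map_cons, incl_map]
      · rw [incl_of_ne _ hw, incl_of_ne]
        rwa [formDeg_cons_inl]
    rw [List.map_cons, List.cons_append, dForm, oddDer_cons, splitSum_dForm_inl, h0, zero_add]
    have := ih fun w => h (i :: w)
    rw [dForm] at this
    rw [this, smul_smul, ← Int.negOnePow_add, wdeg_cons]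
    rfl

/-- The coefficients of the differential of a function are its signed cyclic derivatives. -/
theorem cycCoeff_dForm_incl (h : List I → K) (j : I) (w : List I) :
    cycCoeff d j (dForm K d (incl h)) w = splitSum w fun v u =>
      (wdeg (tdeg d) u * (tdeg d j + wdeg (tdeg d) v)).negOnePow • h (u ++ j :: v) := by
  rw [cycCoeff_apply]
  refine splitSum_congr fun v u _ => ?_
  rw [dForm_incl_apply, smul_smul, ← Int.negOnePow_add]
  congr 1
  exact negOnePow_congr ⟨wdeg (tdeg d) u, by ring⟩

theorem coeff_dDR (E : List (I ⊕ I) × List (I ⊕ I) → K) (j : I) :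
    coeff d j (dDR K d E) = cycCoeff d j (dForm K d (tensorMul E)) := by
  rw [coeff, LinearMap.comp_apply, dDR, tensorMul_tensorOdd isOddDer_dForm]

/-- A zero-form whose differential is a given one-form of vanishing moment. -/
def primitive (d : I → ℤ) :
    (List (I ⊕ I) × List (I ⊕ I) → K) →ₗ[K] (List (I ⊕ I) × List (I ⊕ I) → K) :=
  lenMul₂ (natInv K) ∘ₗ euler d

theorem primitive_apply (F : List (I ⊕ I) × List (I ⊕ I) → K) :
    primitive d F = lenMul₂ (natInv K) (euler d F) := rfl

/-- If `∑ i, [t i, y i] = 0`, then `f = ∑ i, t i * y i` is invariant under signed rotations, so that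
the `j`-th cyclic derivative of a word of length `n` in `f` is `n` times the contribution of
that word to `y j`. -/
theorem coeff_dDR_primitive {F : List (I ⊕ I) × List (I ⊕ I) → K} (hF : moment d F = 0) (j : I) :
    coeff d j (dDR K d (primitive d F)) = coeff d j F := by
  have hl : ∀ f : List I → K, lenMul (natInv K) (incl f) = incl (lenMul (natInv K) f) := by
    intro f
    funext w
    rw [lenMul_apply]
    by_cases hw : formDeg w = 0
    · obtain ⟨v, rfl⟩ := exists_eq_map_inl hw
      rw [incl_map, incl_map, lenMul_apply, List.length_map]
    · rw [incl_of_ne _ hw, incl_of_ne _ hw, mul_zero]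
  rw [coeff_dDR, primitive_apply, tensorMul_lenMul₂, euler, LinearMap.comp_apply,
    tensorMul_tform_inl, hl]
  set y := LinearMap.pi (coeff d) F with hy
  have hb : bsum (tdeg d) y = 0 := hF
  funext w
  have key : cycCoeff d j (dForm K d (incl (lenMul (natInv K) (headSum y)))) w =
      splitSum w fun _ _ => natInv K (w.length + 1) * y j w := by
    rw [cycCoeff_dForm_incl]
    refine splitSum_congr fun v u hvu => ?_
    rw [lenMul_apply, headSum_rotate hb, wdeg_cons, mul_smul_comm, smul_smul,
      ← Int.negOnePow_add, List.cons_append, hvu, headSum_cons]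
    have h1 : (u ++ j :: v).length = w.length + 1 := by
      rw [← hvu]; simp; omega
    rw [h1]
    have h2 : (wdeg (tdeg d) u * (tdeg d j + wdeg (tdeg d) v) +
        wdeg (tdeg d) u * (tdeg d j + wdeg (tdeg d) v)).negOnePow = 1 :=
      Int.negOnePow_even _ ⟨_, rfl⟩
    rw [h2, one_smul]
  rw [key, splitSum_const, nsmul_eq_mul, ← mul_assoc, mul_comm (_ : K) (natInv K _),
    natInv_mul (Nat.succ_ne_zero _), one_mul]
  rfl

theorem primitive_mem_lieTensor {F : List (I ⊕ I) × List (I ⊕ I) → K} (hF : F ∈ normalSub K d) :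
    primitive d F ∈ lieTensor K (fdeg d) := by
  refine lenMul₂_mem_lieTensor _ ?_
  exact tform_mem_lieTensor Sum.inl_injective (mem_normalSub.1 hF).2

theorem primitive_mem_formWt (F : List (I ⊕ I) × List (I ⊕ I) → K) :
    primitive d F ∈ tensorHomog (zeroSub K) formWt (0 : ℕ) := by
  refine lenMul₂_mem_tensorHomog (fun k n x hx => mem_zeroSub.2 fun hn => by rw [hx hn, mul_zero]) ?_
  exact tform_mem_tensorHomog Sum.inl_injective fun i => incl_mem_formWt _

theorem primitive_mem_tensorHomog {𝒜 : ℤ → AddSubgroup K} [GradedRing 𝒜] {n : ℤ}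
    {F : List (I ⊕ I) × List (I ⊕ I) → K} (hF : F ∈ tensorHomog 𝒜 (fdeg d) n) :
    primitive d F ∈ tensorHomog 𝒜 (fdeg d) (n - 1) := by
  refine lenMul₂_mem_tensorHomog natInv_mul_mem ?_
  refine tform_mem_tensorHomog Sum.inl_injective fun i => ?_
  have h := incl_mem_homog (wt := fdeg d) (coeff_mem_homog hF i)
  rwa [sub_right_comm] at h

/-- The de Rham complex is exact in form degree one: one-forms of vanishing moment are exact. -/
theorem sub_dDR_primitive_mem {F : List (I ⊕ I) × List (I ⊕ I) → K} (hF : F ∈ normalSub K d)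
    (hm : moment d F = 0) : F - dDR K d (primitive d F) ∈ lieRel K (fdeg d) := by
  refine sub_mem_lieRel_of_coeff_eq hF ?_ fun j => (coeff_dDR_primitive hm j).symm
  refine mem_normalSub_of_formDeg_one (dDR_mem_lieTensor (primitive_mem_lieTensor hF)) ?_
  have := tensorOdd_mem_tensorHomog (deg := fdeg d) (D := dForm K d) (s := 1)
    (dForm_mem_homog zeroSub_isMul one_mem_zeroSub fun _ => rfl) (primitive_mem_formWt (d := d) F)
  exact_mod_cast this

end DeRham

/-! ### The moment map intertwines the Lie derivative with the vector field -/

section Moment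

variable {K I : Type*} [CommRing K] [TopologicalSpace K] [DiscreteTopology K]
  {𝒜 : ℤ → AddSubgroup K} [GradedRing 𝒜] {d : I → ℤ} (M : CInftyStructure 𝒜 d)

theorem continuous_lieDR (h_even : ∀ n : ℤ, Odd n → 𝒜 n = ⊥) : Continuous M.lieDR :=
  continuous_tensorOdd _ (isOddDer_lieDer M h_even).cont

theorem der_bracket_letter (h_even : ∀ n : ℤ, Odd n → 𝒜 n = ⊥) (i : I) {y : List I → K}
    (hy : y ∈ freeLie K (tdeg d)) :
    M.der (bracket (tdeg d) (letter K i) y) = bracket (tdeg d) (M.onGen i) y +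
      (tdeg d i).negOnePow • bracket (tdeg d) (letter K i) (M.der y) := by
  have hD := isOddDer_der M h_even
  have hc : ∀ f, Continuous (bracketB (K := K) (tdeg d) f) := fun f => by
    simpa only [← bracketB_apply] using continuous_bracket_right (tdeg d) f
  have := eq_of_lieMonomial (deg := tdeg d) (Φ := M.der ∘ₗ bracketB (tdeg d) (letter K i))
    (Ψ := bracketB (tdeg d) (M.onGen i) +
      bracketB (tdeg d) (parityL (tdeg d) (letter K i)) ∘ₗ M.der)
    (hD.cont.comp (hc _)) ((hc _).add ((hc _).comp hD.cont)) (fun y hy => ?_) hy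
  · simp only [LinearMap.comp_apply, LinearMap.add_apply, bracketB_apply, parityL_apply,
      parity_letter, bracket_usmul_left] at this
    exact this
  · obtain ⟨q, hq⟩ := hy.exists_hasPar
    simp only [LinearMap.comp_apply, LinearMap.add_apply, bracketB_apply, parityL_apply,
      parity_letter, bracket_usmul_left]
    rw [hD.bracket (letter_hasPar i) hq, der_letter]

/-- The moment map anticommutes with the differentials. -/
theorem moment_lieDR (h_even : ∀ n : ℤ, Odd n → 𝒜 n = ⊥)
    {F : List (I ⊕ I) × List (I ⊕ I) → K} (hF : F ∈ normalSub K d) :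
    moment d (M.lieDR F) = -M.der (moment d F) := by
  obtain ⟨h1, h2⟩ := mem_normalSub.1 hF
  have e1 := lieDR_mem_lieRel (M := M) h_even h1
  rw [map_sub] at e1
  rw [moment_congr e1, moment_congr h1]
  have hD := isOddDer_der M h_even
  refine tform_mem (Z := LinearMap.eqLocus (moment d ∘ₗ M.lieDR) (-(M.der ∘ₗ moment d)))
    Sum.inr_injective (isClosed_eqLocus (continuous_moment.comp (continuous_lieDR M h_even))
      (hD.cont.comp continuous_moment).neg) (fun i => ?_)
  set y := LinearMap.pi (coeff d) F i with hy
  have hyL : y ∈ freeLie K (tdeg d) := h2 i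
  change moment d (M.lieDR (tmul (letter K (Sum.inr i)) (incl y))) =
    -M.der (moment d (tmul (letter K (Sum.inr i)) (incl y)))
  have e : fdeg d (Sum.inr i) = tdeg d i + 1 := rfl
  rw [CInftyStructure.lieDR, tensorOdd_tmul, lieDer_letter_inr, parity_letter, lieDer_incl M h_even,
    tmul_neg_left, tmul_usmul_left, map_add, map_neg, map_usmul,
    moment_dForm_tmul (onGen_mem_freeLie M i) hyL, bsum_coeff_tmul_letter, bsum_coeff_tmul_letter,
    der_bracket_letter M h_even i hyL, e, Int.negOnePow_succ, Units.neg_smul]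
  abel

theorem moment_mem_homog {n : ℤ} {F : List (I ⊕ I) × List (I ⊕ I) → K}
    (hF : F ∈ tensorHomog 𝒜 (fdeg d) n) : moment d F ∈ homog 𝒜 (tdeg d) (n - 1) :=
  bsum_mem_homog fun i => by
    have := coeff_mem_homog hF i
    rwa [sub_right_comm] at this

end Moment

/-! ### The Dynkin operator -/

section Dynkin

variable {K A : Type*} [CommRing K]

/-- The family of the series `f a` with `f = f₀ + ∑ a, a * f a`. -/
def tails : (List A → K) →ₗ[K] (A → List A → K) where
  toFun f a w := f (a :: w)
  map_add' _ _ := rfl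
  map_smul' _ _ := rfl

theorem tails_apply (f : List A → K) (a : A) (w : List A) : tails f a w = f (a :: w) := rfl

/-- The length-one part of a series. -/
def linPart : (List A → K) →ₗ[K] (List A → K) := lenMul fun n => if n = 1 then 1 else 0

theorem linPart_apply (f : List A → K) (w : List A) :
    linPart f w = (if w.length = 1 then 1 else 0) * f w := rfl

open Classical in
theorem tails_letter_mul (a : A) (g : List A → K) :
    tails (mul (letter K a) g) = Pi.single a g := by
  funext b w
  rw [tails_apply]
  by_cases h : b = a
  · subst h
    rw [letter_mul_cons_self, Pi.single_eq_same]
  · rw [letter_mul_cons_of_ne h, Pi.single_eq_of_ne h]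
    rfl

theorem linPart_letter_mul (a : A) (g : List A → K) :
    linPart (mul (letter K a) g) = g [] • letter K a := by
  funext w
  rw [linPart_apply, Pi.smul_apply, smul_eq_mul]
  rcases w with _ | ⟨b, _ | ⟨c, w⟩⟩
  · rw [letter_apply_of_ne (by simp)]; simp
  · by_cases h : b = a
    · subst h
      rw [letter_mul_cons_self, letter_apply_self]; simp
    · rw [letter_mul_cons_of_ne h, letter_apply_of_ne (by simpa using h)]; simp
  · rw [letter_apply_of_ne (by simp)]; simp

variable (deg : A → ℤ)

/-- The Dynkin operator on words of length at most `n`. -/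
def dynkinAux : ℕ → (List A → K) →ₗ[K] (List A → K)
  | 0 => 0
  | n + 1 => linPart + bsum deg ∘ₗ (LinearMap.pi fun a => dynkinAux n ∘ₗ LinearMap.proj a) ∘ₗ tails

/-- The Dynkin operator, which sends a word `a b ⋯ c` to the iterated commutator
`[a, [b, ⋯ c]]`. -/
def dynkin : (List A → K) →ₗ[K] (List A → K) where
  toFun f w := dynkinAux deg w.length f w
  map_add' f g := by funext w; rw [map_add]; rfl
  map_smul' c f := by funext w; rw [map_smul]; rfl

variable {deg}

/-- The recursion `[a, [b, ⋯ c]]` for the Dynkin operator. -/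
theorem dynkin_eq (f : List A → K) :
    dynkin deg f = linPart f + bsum deg fun a => dynkin deg (tails f a) := by
  funext w
  change dynkinAux deg w.length f w = linPart f w + (headSum _ w - lastSum deg _ w)
  cases hw : w.length with
  | zero =>
    obtain rfl := List.length_eq_zero_iff.1 hw
    rw [linPart_apply, headSum_nil, lastSum_nil]
    simp [dynkinAux]
  | succ n =>
    change linPart f w + (headSum (fun a => dynkinAux deg n (tails f a)) w -
      lastSum deg (fun a => dynkinAux deg n (tails f a)) w) = _
    congr 2
    · cases w with
      | nil => simp at hw
      | cons a w =>
        rw [headSum_cons, headSum_cons]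
        rw [List.length_cons, add_left_inj] at hw
        subst hw
        rfl
    · rcases List.eq_nil_or_concat' w with rfl | ⟨w, a, rfl⟩
      · simp at hw
      · rw [lastSum_concat, lastSum_concat]
        rw [List.length_append, List.length_singleton, add_left_inj] at hw
        subst hw
        rfl

theorem dynkin_letter_mul (a : A) (g : List A → K) :
    dynkin deg (mul (letter K a) g) =
      g [] • letter K a + bracket deg (letter K a) (dynkin deg g) := by
  classical
  rw [dynkin_eq, linPart_letter_mul, tails_letter_mul, ← bsum_single]
  congr 2
  funext b
  by_cases h : b = a
  · subst h
    rw [Pi.single_eq_same, Pi.single_eq_same]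
  · rw [Pi.single_eq_of_ne h, Pi.single_eq_of_ne h, map_zero]

theorem dynkin_word_nil : dynkin deg (word K []) = 0 := by
  rw [dynkin_eq]
  have h1 : linPart (word K ([] : List A)) = 0 := by
    funext w
    rw [linPart_apply]
    cases w <;> simp [word_apply_of_ne]
  have h2 : tails (word K ([] : List A)) = 0 := by
    funext a w
    exact word_apply_of_ne (List.cons_ne_nil a w)
  rw [h1, h2, zero_add]
  have : (fun a : A => dynkin deg ((0 : A → List A → K) a)) = 0 := by
    funext a
    exact map_zero _
  rw [this, map_zero]

theorem dynkin_mem_homog {𝒬 : ℤ → AddSubgroup K} {wt : A → ℤ} {n : ℤ} {f : List A → K}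
    (hf : f ∈ homog 𝒬 wt n) : dynkin deg f ∈ homog 𝒬 wt n := by
  suffices h : ∀ k n, ∀ f : List A → K, f ∈ homog 𝒬 wt n → dynkinAux deg k f ∈ homog 𝒬 wt n from
    fun w => h _ _ _ hf w
  intro k
  induction k with
  | zero => intro n f _; exact zero_mem _
  | succ k ih =>
    intro n f hf
    refine add_mem (lenMul_mem_homog (fun k n x hx => ?_) hf) (bsum_mem_homog fun a => ?_)
    · split_ifs
      · rwa [one_mul]
      · rw [zero_mul]; exact zero_mem _
    · refine ih _ _ fun w => ?_
      have := hf (a :: w)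
      rwa [wdeg_cons, ← sub_sub] at this

section Topology

variable [TopologicalSpace K] [DiscreteTopology K]

/-- The Dynkin operator turns multiplication by a Lie element into the commutator with it. -/
theorem MonOf.dynkin_mul {s : Multiset A} {x : List A → K} (hx : MonOf K deg s x) :
    ∀ q y, HasPar deg q y → y [] = 0 →
      CInf.dynkin deg (CInf.mul x y) = CInf.bracket deg x (CInf.dynkin deg y) := by
  induction hx with
  | letter a =>
    intro q y _ h0
    rw [dynkin_letter_mul, h0, zero_smul, zero_add]
  | @bracket s₁ s₂ x₁ x₂ h₁ h₂ ih₁ ih₂ =>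
    intro q y hy h0
    have nil : ∀ x : List A → K, CInf.mul x y [] = 0 := by
      intro x
      rw [mul_apply, splitSum_nil, h0, mul_zero]
    have hD := dynkin_mem_homog (deg := deg) hy
    rw [h₁.hasPar.bracket_eq h₂.hasPar, sub_mul', usmul_mul, mul_assoc', mul_assoc', map_sub,
      ih₁ _ _ (h₂.hasPar.mul hy) (nil _), ih₂ _ _ hy h0, map_usmul,
      ih₂ _ _ (h₁.hasPar.mul hy) (nil _), ih₁ _ _ hy h0, ← h₁.hasPar.bracket_eq h₂.hasPar,
      h₁.hasPar.jacobi h₂.hasPar hD]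

theorem MonOf.dynkin {s : Multiset A} {x : List A → K} (hx : MonOf K deg s x) :
    CInf.dynkin deg x = (s.card : K) • x := by
  induction hx with
  | letter a =>
    rw [← mul_word_nil (CInf.letter K a), dynkin_letter_mul, dynkin_word_nil, bracket_zero_right,
      mul_word_nil, word_apply_self]
    simp
  | @bracket s₁ s₂ x₁ x₂ h₁ h₂ ih₁ ih₂ =>
    have nil : ∀ {s : Multiset A} {x : List A → K}, MonOf K deg s x → x [] = 0 := by
      intro s x hx
      by_contra h
      exact hx.card_pos.ne (hx.length_eq h)
    conv_lhs => rw [h₁.hasPar.bracket_eq h₂.hasPar, map_sub, map_usmul,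
      h₁.dynkin_mul _ _ h₂.hasPar (nil h₂), h₂.dynkin_mul _ _ h₁.hasPar (nil h₁), ih₁, ih₂,
      bracket_smul_right, bracket_smul_right, h₂.hasPar.bracket_symm h₁.hasPar, mul_comm]
    rw [Multiset.card_add, Nat.cast_add]
    rcases Int.units_eq_one_or ((s₂.map deg).sum * (s₁.map deg).sum).negOnePow with h | h <;>
      rw [h] <;> simp only [one_smul, Units.neg_smul] <;> module

theorem continuous_tails (a : A) : Continuous fun f : List A → K => tails f a :=
  continuous_pi fun w => continuous_apply (a :: w)

theorem continuous_dynkin : Continuous (dynkin (K := K) deg) := by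
  suffices h : ∀ n, Continuous (dynkinAux (K := K) deg n) from
    continuous_pi fun w => ((continuous_apply w).comp (h w.length) :)
  intro n
  induction n with
  | zero => exact continuous_const
  | succ n ih =>
    exact (continuous_lenMul _).add ((continuous_bsum deg).comp (continuous_pi fun a =>
      ih.comp (continuous_tails a)))

/-- The Dynkin operator takes values in the Lie series. -/
theorem dynkin_mem_freeLie (f : List A → K) : dynkin deg f ∈ freeLie K deg := by
  refine mem_of_word_mem (Z := (freeLie K deg).comap (dynkin deg))
    ((isClosed_freeLie (K := K) deg).preimage continuous_dynkin) fun w hw => ?_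
  rw [Submodule.mem_comap]
  clear hw
  induction w with
  | nil => rw [dynkin_word_nil]; exact zero_mem _
  | cons a w ih =>
    rw [← letter_mul_word, dynkin_letter_mul]
    exact add_mem (Submodule.smul_mem _ _ (letter_mem _ _)) (bracket_mem (letter_mem _ _) ih)

/-- The Dynkin–Specht–Wever theorem. -/
theorem dynkin_eq_lenMul {z : List A → K} (hz : z ∈ freeLie K deg) :
    dynkin deg z = lenMul (fun n => (n : K)) z := by
  refine eq_of_lieMonomial continuous_dynkin (continuous_lenMul _) (fun f hf => ?_) hz
  obtain ⟨s, hs⟩ := hf.exists_monOf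
  rw [hs.dynkin, hs.ofLen.lenMul_eq]

theorem bsum_lenMul_succ (g : ℕ → K) (y : A → List A → K) :
    (bsum deg fun a => lenMul (fun n => g (n + 1)) (y a)) = lenMul g (bsum deg y) := by
  funext w
  change headSum _ w - lastSum deg _ w = g w.length * (headSum _ w - lastSum deg _ w)
  rw [mul_sub]
  congr 1
  · cases w with
    | nil => rw [headSum_nil, headSum_nil, mul_zero]
    | cons a w => rw [headSum_cons, headSum_cons]; rfl
  · rcases List.eq_nil_or_concat' w with rfl | ⟨w, a, rfl⟩
    · rw [lastSum_nil, lastSum_nil, mul_zero]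
    · rw [lastSum_concat, lastSum_concat, lenMul_apply, List.length_append, mul_smul_comm]
      rfl

variable [Algebra ℚ K]

/-- Lie series `y a` such that `z = ∑ a, [a, y a]`, if `z` is a Lie series without linear part. -/
def lieTails (deg : A → ℤ) : (List A → K) →ₗ[K] (A → List A → K) :=
  (LinearMap.pi fun a => lenMul (fun n => natInv K (n + 1)) ∘ₗ dynkin deg ∘ₗ LinearMap.proj a) ∘ₗ
    tails

theorem lieTails_apply (z : List A → K) (a : A) : lieTails deg z a =
    lenMul (fun n => natInv K (n + 1)) (dynkin deg (tails z a)) := rfl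

theorem lieTails_mem_freeLie (z : List A → K) (a : A) : lieTails deg z a ∈ freeLie K deg := by
  rw [lieTails_apply]
  exact lenMul_mem_freeLie _ (dynkin_mem_freeLie _)

theorem lieTails_mem_homog {𝒜 : ℤ → AddSubgroup K} [GradedRing 𝒜] {wt : A → ℤ} {n : ℤ}
    {z : List A → K} (hz : z ∈ homog 𝒜 wt n) (a : A) :
    lieTails deg z a ∈ homog 𝒜 wt (n - wt a) := by
  rw [lieTails_apply]
  refine lenMul_mem_homog (fun k => natInv_mul_mem (k + 1)) (dynkin_mem_homog fun w => ?_)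
  have := hz (a :: w)
  rwa [wdeg_cons, ← sub_sub] at this

/-- A Lie series without linear part is a sum of commutators of letters with Lie series, by the
Dynkin–Specht–Wever theorem. -/
theorem bsum_lieTails {z : List A → K} (hz : z ∈ freeLie K deg) (h1 : ∀ a, z [a] = 0) :
    bsum deg (lieTails deg z) = z := by
  have hl : linPart z = 0 := by
    funext w
    rw [linPart_apply]
    rcases w with _ | ⟨a, _ | ⟨b, w⟩⟩ <;> simp [h1]
  have h := dynkin_eq (deg := deg) z
  rw [hl, zero_add, dynkin_eq_lenMul hz] at h
  change bsum deg (fun a => lenMul (fun n => natInv K (n + 1)) (dynkin deg (tails z a))) = z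
  rw [bsum_lenMul_succ, ← h]
  funext w
  rw [lenMul_apply, lenMul_apply, ← mul_assoc]
  by_cases hw : w.length = 0
  · obtain rfl := List.length_eq_zero_iff.1 hw
    rw [freeLie_apply_nil hz, mul_zero]
  · rw [natInv_mul hw, one_mul]

end Topology

end Dynkin

/-! ### Contraction with a letter of odd degree -/

section Contraction

variable {K A : Type*} [CommRing K]

/-- The operator that multiplies the coefficient of every word `w` by `g w`. -/
def wordMul (g : List A → K) : (List A → K) →ₗ[K] (List A → K) where
  toFun f w := g w * f w
  map_add' f h := by funext w; exact mul_add _ _ _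
  map_smul' c f := by funext w; exact mul_left_comm _ _ _

theorem wordMul_apply (g f : List A → K) (w : List A) : wordMul g f w = g w * f w := rfl

/-- The operator that sends a word to the sum of `(-1)^{|x|} g y * x y` over its factorisations
`x e y`.  For `g = 1` it is the derivative with respect to the letter `e`, if `e` has odd degree. -/
def contract (deg : A → ℤ) (e : A) (g : List A → K) : (List A → K) →ₗ[K] (List A → K) where
  toFun f w := splitSum w fun x y => (wdeg deg x).negOnePow • (g y * f (x ++ e :: y))
  map_add' f h := by
    funext w
    rw [Pi.add_apply, ← splitSum_add]
    refine splitSum_congr fun x y _ => ?_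
    rw [Pi.add_apply, mul_add, smul_add]
  map_smul' c f := by
    funext w
    rw [RingHom.id_apply, Pi.smul_apply, smul_splitSum]
    refine splitSum_congr fun x y _ => ?_
    rw [Pi.smul_apply, smul_eq_mul, smul_eq_mul, mul_left_comm, mul_smul_comm]

variable {deg : A → ℤ} {e : A}

theorem contract_apply (g f : List A → K) (w : List A) : contract deg e g f w =
    splitSum w fun x y => (wdeg deg x).negOnePow • (g y * f (x ++ e :: y)) := rfl

theorem contract_congr {g f f' : List A → K} (h : ∀ w, e ∈ w → f w = f' w) :
    contract deg e g f = contract deg e g f' := by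
  funext w
  rw [contract_apply, contract_apply]
  refine splitSum_congr fun x y _ => ?_
  rw [h _ (by simp)]

theorem contract_mem_homog {𝒬 : ℤ → AddSubgroup K} {wt : A → ℤ} {n : ℤ} {g f : List A → K}
    (hg : ∀ w, ∀ n, ∀ x ∈ 𝒬 n, g w * x ∈ 𝒬 n) (hf : f ∈ homog 𝒬 wt n) :
    contract deg e g f ∈ homog 𝒬 wt (n - wt e) := by
  intro w
  rw [contract_apply]
  refine splitSum_mem fun x y hxy => usmul_mem _ (hg _ _ _ ?_)
  have := hf (x ++ e :: y)
  rw [wdeg_append, wdeg_cons] at this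
  rw [← hxy, wdeg_append]
  convert this using 2
  ring

/-- A Leibniz rule: if the weight `g` of the right factor is additive, then contraction in the first
factor of a product has an additional term in which the weight is carried by the second. -/
theorem contract_mul {g g₁ g₂ : List A → K} (hg : ∀ x y, g (x ++ y) = g₁ x + g₂ y)
    (f h : List A → K) :
    contract deg e g (mul f h) = mul (contract deg e g₁ f) h +
      mul (contract deg e (fun _ => 1) f) (wordMul g₂ h) +
      mul (parity deg f) (contract deg e g h) := by
  funext w
  -- The letter `e` is removed from the second factor in the first sum, from the first in the second.
  have key : contract deg e g (mul f h) w =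
      (splitSum w fun p q => splitSum p fun a b =>
        (wdeg deg (a ++ b)).negOnePow • (g q * (f a * h (b ++ e :: q)))) +
      splitSum w fun x q => splitSum q fun a b =>
        (wdeg deg x).negOnePow • ((g₁ a + g₂ b) * (f (x ++ e :: a) * h b)) := by
    rw [contract_apply, ← splitSum_add]
    refine splitSum_congr fun p q _ => ?_
    rw [mul_apply, splitSum_append_cons, mul_add, smul_add, mul_splitSum, mul_splitSum,
      smul_splitSum, smul_splitSum]
    congr 1
    · exact splitSum_congr fun a b hab => by rw [hab]
    · exact splitSum_congr fun a b hab => by rw [← hab, hg]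
  rw [key, splitSum_assoc w fun a b q =>
    (wdeg deg (a ++ b)).negOnePow • (g q * (f a * h (b ++ e :: q))),
    ← splitSum_assoc w fun x a b =>
      (wdeg deg x).negOnePow • ((g₁ a + g₂ b) * (f (x ++ e :: a) * h b)), add_comm,
    Pi.add_apply, Pi.add_apply]
  congr 1
  · rw [mul_apply, mul_apply, ← splitSum_add]
    refine splitSum_congr fun p b _ => ?_
    rw [contract_apply, contract_apply, splitSum_mul, splitSum_mul, ← splitSum_add]
    refine splitSum_congr fun x a _ => ?_
    rw [wordMul_apply]
    rcases Int.units_eq_one_or (wdeg deg x).negOnePow with h | h <;> rw [h] <;>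
      simp only [one_smul, Units.neg_smul] <;> ring
  · rw [mul_apply]
    refine splitSum_congr fun a r _ => ?_
    rw [contract_apply, mul_splitSum]
    refine splitSum_congr fun b q _ => ?_
    rw [wdeg_append, Int.negOnePow_add, parity]
    rcases Int.units_eq_one_or (wdeg deg a).negOnePow with h | h <;>
    rcases Int.units_eq_one_or (wdeg deg b).negOnePow with h' | h' <;> rw [h, h'] <;>
      simp only [one_smul, Units.neg_smul, mul_one, mul_neg, neg_mul] <;> ring

theorem contract_letter {g : List A → K} (hg : g [] = 0) (a : A) :
    contract deg e g (letter K a) = 0 := by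
  funext w
  rw [contract_apply]
  refine splitSum_eq_zero fun x y hxy => ?_
  by_cases h : y = []
  · rw [h, hg, zero_mul, smul_zero]
  · rw [letter_apply_of_ne, mul_zero, smul_zero]
    intro h'
    have := congrArg List.length h'
    have := List.length_pos_of_ne_nil h
    simp at *
    omega

open Classical in
theorem contract_one_letter (a : A) : contract deg e (fun _ => 1) (letter K a) =
    if a = e then word K [] else 0 := by
  funext w
  cases w with
  | nil =>
    rw [contract_apply, splitSum_nil, wdeg_nil, Int.negOnePow_zero, one_smul, one_mul,
      List.nil_append]
    split_ifs with h
    · rw [h, letter_apply_self, word_apply_self]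
    · exact letter_apply_of_ne (by simpa using fun h' => h h'.symm)
  | cons b w =>
    have : (if a = e then word K [] else 0 : List A → K) (b :: w) = 0 := by
      split_ifs
      · exact word_apply_of_ne (List.cons_ne_nil _ _)
      · rfl
    rw [this, contract_apply]
    refine splitSum_eq_zero fun x y hxy => ?_
    rw [letter_apply_of_ne, mul_zero, smul_zero]
    intro h'
    have h1 := congrArg List.length h'
    have h2 := congrArg List.length hxy
    simp at h1 h2
    omega

theorem continuous_contract [TopologicalSpace K] [DiscreteTopology K] (g : List A → K) :
    Continuous (contract deg e g) := by
  refine continuous_pi fun w => ?_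
  simp only [contract_apply]
  exact continuous_splitSum fun x y =>
    continuous_usmul (continuous_const.mul (continuous_apply (x ++ e :: y))) _

theorem continuous_wordMul [TopologicalSpace K] [DiscreteTopology K] (g : List A → K) :
    Continuous (wordMul g) :=
  continuous_pi fun w => continuous_const.mul (continuous_apply w)

open Classical in
/-- The weight that counts the letters other than `e`. -/
def offWt (e : A) (a : A) : ℤ := if a = e then 0 else 1

theorem wdeg_offWt_nonneg (w : List A) : 0 ≤ wdeg (offWt e) w := by
  induction w with
  | nil => rfl
  | cons a w ih =>
    rw [wdeg_cons, offWt]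
    split_ifs <;> omega

theorem wdeg_offWt_eq_zero {w : List A} (h : wdeg (offWt e) w = 0) :
    w = List.replicate w.length e := by
  induction w with
  | nil => rfl
  | cons a w ih =>
    have h1 := wdeg_offWt_nonneg (e := e) w
    rw [wdeg_cons, offWt] at h
    split_ifs at h with ha
    · rw [List.length_cons, List.replicate_succ, ← ih (by omega), ha]
    · omega

/-- The number of letters other than `e`, as a scalar. -/
def offCount (K : Type*) [CommRing K] (e : A) (w : List A) : K := (wdeg (offWt e) w : ℤ)

theorem offCount_append (v w : List A) :
    offCount K e (v ++ w) = offCount K e v + offCount K e w := by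
  rw [offCount, wdeg_append, Int.cast_add]; rfl

theorem offCount_nil : offCount K e [] = 0 := by simp [offCount, wdeg_nil]

theorem MonOf.wordMul_offCount {s : Multiset A} {x : List A → K} (hx : MonOf K deg s x) :
    wordMul (offCount K e) x = (((s.map (offWt e)).sum : ℤ) : K) • x := by
  funext w
  rw [wordMul_apply, Pi.smul_apply, smul_eq_mul]
  by_cases hw : x w = 0
  · rw [hw, mul_zero, mul_zero]
  · have := hx.mem_homog (wt := offWt e) zeroSub_isMul one_mem_zeroSub w
    rw [offCount, ← sub_eq_zero.1 (not_not.1 fun h => hw (mem_zeroSub.1 this h))]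

variable (deg e) in
/-- The contracting homotopy. -/
abbrev homotopy : (List A → K) →ₗ[K] (List A → K) := contract deg e (offCount K e)

theorem homotopy_mul (f h : List A → K) :
    homotopy deg e (mul f h) = mul (homotopy deg e f) h +
      mul (contract deg e (fun _ => 1) f) (wordMul (offCount K e) h) +
      mul (parity deg f) (homotopy deg e h) :=
  contract_mul offCount_append f h

theorem contract_one_mul (f h : List A → K) :
    contract deg e (fun _ => 1) (mul f h) = mul (contract deg e (fun _ => 1) f) h +
      mul (parity deg f) (contract deg e (fun _ => 1) h) := by
  rw [contract_mul (g₁ := fun _ => 1) (g₂ := 0) fun _ _ => by simp]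
  have : wordMul (0 : List A → K) h = 0 := by
    funext w
    exact zero_mul _
  rw [this, mul_zero', add_zero]

/-- The derivative of a Lie monomial with respect to `e` is a scalar, which vanishes unless the
monomial is odd. -/
theorem MonOf.contract_one (he : Odd (deg e)) {s : Multiset A} {x : List A → K}
    (hx : MonOf K deg s x) : ∃ c : K, contract deg e (fun _ => 1) x = c • word K [] ∧
      (c = 0 ∨ Odd (s.map deg).sum) := by
  classical
  induction hx with
  | letter a =>
    rw [contract_one_letter]
    split_ifs with h
    · exact ⟨1, by rw [one_smul], Or.inr (by simpa [h] using he)⟩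
    · exact ⟨0, by rw [zero_smul], Or.inl rfl⟩
  | @bracket s t x y hx hy ihx ihy =>
    obtain ⟨a, hxa, ha⟩ := ihx
    obtain ⟨b, hyb, hb⟩ := ihy
    refine ⟨0, ?_, Or.inl rfl⟩
    have hu : ∀ c : ℤˣ, contract deg e (fun _ => 1) (c • CInf.mul y x) =
        c • contract deg e (fun _ => 1) (CInf.mul y x) := by
      intro c
      rcases Int.units_eq_one_or c with h | h <;> rw [h] <;> simp [Units.neg_smul]
    rw [hx.hasPar.bracket_eq hy.hasPar, map_sub, hu, contract_one_mul, contract_one_mul,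
      hx.hasPar.parity_eq, hy.hasPar.parity_eq, hxa, hyb]
    simp only [smul_mul', mul_smul', word_nil_mul, mul_word_nil, zero_smul]
    set p := (s.map deg).sum
    set q := (t.map deg).sum
    -- The scalar `a` vanishes unless `p` is odd, in which case the signs agree; likewise for `b`.
    have h1 : (p * q).negOnePow • (q.negOnePow • (a • y)) = a • y := by
      rcases ha with ha | ha
      · simp [ha]
      · rw [smul_smul, ← Int.negOnePow_add, Int.negOnePow_even, one_smul]
        rw [show p * q + q = (p + 1) * q by ring]
        exact (ha.add_odd odd_one).mul_right _
    have h2 : (p * q).negOnePow • (b • x) = p.negOnePow • (b • x) := by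
      rcases hb with hb | hb
      · simp [hb]
      · rw [negOnePow_congr]
        rw [show p * q - p = p * (q - 1) by ring]
        exact (hb.sub_odd odd_one).mul_left _
    rw [smul_add, h2]
    have h3 : a • q.negOnePow • y = q.negOnePow • a • y := smul_comm _ _ _
    have h4 : b • p.negOnePow • x = p.negOnePow • b • x := smul_comm _ _ _
    simp only [h3, h4, h1]
    abel

theorem homotopy_letter (a : A) : homotopy deg e (letter K a) = 0 :=
  contract_letter offCount_nil a

section Topology

variable [TopologicalSpace K] [DiscreteTopology K]

/-- The additional term in the Leibniz rule for the homotopy involves the derivative of a Lie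
monomial with respect to `e`, which is a scalar; hence on brackets the homotopy is expressed by
brackets. -/
theorem MonOf.homotopy_mem (he : Odd (deg e)) {s : Multiset A} {x : List A → K}
    (hx : MonOf K deg s x) : homotopy deg e x ∈ freeLie K deg := by
  induction hx with
  | letter a => rw [homotopy_letter]; exact zero_mem _
  | @bracket s t x y hx hy ihx ihy =>
    obtain ⟨a, hxa, -⟩ := hx.contract_one he
    obtain ⟨b, hyb, -⟩ := hy.contract_one he
    have hH : ∀ {s : Multiset A} {x : List A → K}, MonOf K deg s x →
        HasPar deg ((s.map deg).sum - deg e) (homotopy deg e x) := fun hx =>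
      contract_mem_homog (fun w n x hx h => by rw [hx h, mul_zero]) hx.hasPar
    -- The last two terms come from the additional term of the Leibniz rule for the two products.
    have key : homotopy deg e (CInf.bracket deg x y) = CInf.bracket deg (homotopy deg e x) y +
        ((s.map deg).sum).negOnePow • CInf.bracket deg x (homotopy deg e y) +
        (a * ((t.map (offWt e)).sum : ℤ)) • y -
        ((s.map deg).sum * (t.map deg).sum).negOnePow • ((b * ((s.map (offWt e)).sum : ℤ)) • x) := by
      rw [(hH hx).bracket_eq hy.hasPar, hx.hasPar.bracket_eq (hH hy), hx.hasPar.bracket_eq hy.hasPar,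
        map_sub, map_usmul, homotopy_mul, homotopy_mul, hxa, hyb, hx.wordMul_offCount,
        hy.wordMul_offCount, hx.hasPar.parity_eq, hy.hasPar.parity_eq]
      simp only [smul_mul', mul_smul', usmul_mul, word_nil_mul, smul_smul]
      set p := (s.map deg).sum
      set q := (t.map deg).sum
      have h1 : ((p - deg e) * q).negOnePow = (p * q).negOnePow * q.negOnePow := by
        rw [← Int.negOnePow_add]
        refine negOnePow_congr ?_
        rw [show (p - deg e) * q - (p * q + q) = -((deg e + 1) * q) by ring]
        exact ((he.add_odd odd_one).mul_right _).neg
      have h2 : (p * (q - deg e)).negOnePow = (p * q).negOnePow * p.negOnePow := by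
        rw [← Int.negOnePow_add]
        refine negOnePow_congr ?_
        rw [show p * (q - deg e) - (p * q + p) = -((deg e + 1) * p) by ring]
        exact ((he.add_odd odd_one).mul_right _).neg
      rw [h1, h2]
      rcases Int.units_eq_one_or p.negOnePow with h | h <;>
      rcases Int.units_eq_one_or q.negOnePow with h' | h' <;>
      rcases Int.units_eq_one_or (p * q).negOnePow with h'' | h'' <;> rw [h, h', h''] <;>
      simp only [one_smul, Units.neg_smul, mul_one, mul_neg, neg_neg] <;> module
    rw [key]
    exact sub_mem (add_mem (add_mem (bracket_mem ihx hy.mem_freeLie)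
      (usmul_mem (S := (freeLie K deg).toAddSubgroup) _ (bracket_mem hx.mem_freeLie ihy)))
      (Submodule.smul_mem _ _ hy.mem_freeLie))
      (usmul_mem (S := (freeLie K deg).toAddSubgroup) _ (Submodule.smul_mem _ _ hx.mem_freeLie))

/-- The homotopy preserves the Lie series. -/
theorem homotopy_mem_freeLie (he : Odd (deg e)) {x : List A → K} (hx : x ∈ freeLie K deg) :
    homotopy deg e x ∈ freeLie K deg := by
  refine freeLie_le (Z := (freeLie K deg).comap (homotopy deg e))
    ((isClosed_freeLie (K := K) deg).preimage (continuous_contract _)) (fun f hf => ?_) hx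
  obtain ⟨s, hs⟩ := hf.exists_monOf
  exact hs.homotopy_mem he

/-- The graded commutator of two series in one variable without terms other than those of degree
one and two has no term of another degree: the terms of degree three and four cancel. -/
theorem sum_commutator_eq_zero {F G : ℕ → K} {s : ℕ → ℕ → ℤˣ}
    (hs : ∀ i j, Even i ∨ Even j → s i j = 1) (hF : ∀ k, k ≠ 1 → k ≠ 2 → F k = 0)
    (hG : ∀ k, k ≠ 1 → k ≠ 2 → G k = 0) {k : ℕ} (h1 : k ≠ 1) (h2 : k ≠ 2) :
    ∑ i ∈ Finset.range (k + 1), (F i * G (k - i) - s i (k - i) • (G i * F (k - i))) = 0 := by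
  have hF0 := hF 0 (by omega) (by omega)
  have hG0 := hG 0 (by omega) (by omega)
  have hF3 := hF 3 (by omega) (by omega)
  have hG3 := hG 3 (by omega) (by omega)
  have s12 := hs 1 2 (by decide)
  have s21 := hs 2 1 (by decide)
  have s22 := hs 2 2 (by decide)
  obtain rfl | rfl | rfl | hk : k = 0 ∨ k = 3 ∨ k = 4 ∨ 5 ≤ k := by omega
  · simp [hF0, hG0]
  · simp only [Finset.sum_range_succ, Finset.sum_range_zero, Nat.reduceSub, hF0, hG0, hF3, hG3,
      s12, s21, one_smul]
    simp
    ring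
  · simp only [Finset.sum_range_succ, Finset.sum_range_zero, Nat.reduceSub, hF0, hG0, hF3, hG3,
      s22, one_smul]
    simp
    ring
  · refine Finset.sum_eq_zero fun i hi => ?_
    rcases le_or_gt 3 i with h | h
    · rw [hF i (by omega) (by omega), hG i (by omega) (by omega), zero_mul, zero_mul, smul_zero,
        sub_zero]
    · rw [hF (k - i) (by omega) (by omega), hG (k - i) (by omega) (by omega), mul_zero, mul_zero,
        smul_zero, sub_zero]

/-- A Lie series involves no power of a letter but the first and the second. -/
theorem freeLie_apply_replicate {x : List A → K} (hx : x ∈ freeLie K deg)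
    {k : ℕ} (h1 : k ≠ 1) (h2 : k ≠ 2) : x (List.replicate k e) = 0 := by
  let Z : Submodule K (List A → K) :=
    { carrier := {x | ∀ k, k ≠ 1 → k ≠ 2 → x (List.replicate k e) = 0}
      zero_mem' := fun _ _ _ => rfl
      add_mem' := fun hx hy k h1 h2 => by rw [Pi.add_apply, hx k h1 h2, hy k h1 h2, add_zero]
      smul_mem' := fun c x hx k h1 h2 => by rw [Pi.smul_apply, hx k h1 h2, smul_zero] }
  have hZ : IsClosed (Z : Set (List A → K)) := by
    have : (Z : Set (List A → K)) =
        ⋂ (k : ℕ) (_ : k ≠ 1) (_ : k ≠ 2), {x | x (List.replicate k e) = 0} := by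
      ext x
      simp only [Set.mem_iInter, Set.mem_ofPred_eq]
      rfl
    rw [this]
    exact isClosed_iInter fun k => isClosed_iInter fun _ => isClosed_iInter fun _ =>
      isClosed_singleton.preimage (continuous_apply (List.replicate k e))
  refine freeLie_le hZ (fun f hf => ?_) hx k h1 h2
  induction hf with
  | letter a =>
    intro k h1 h2
    refine letter_apply_of_ne fun h => h1 ?_
    simpa using congrArg List.length h
  | @bracket f g hf hg ihf ihg =>
    intro k h1 h2
    change ∑ i ∈ Finset.range ((List.replicate k e).length + 1), _ = _
    have hw : ∀ i, wdeg deg (List.replicate i e) = i * deg e := by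
      intro i
      simp [wdeg]
    simp only [List.length_replicate, List.take_replicate, List.drop_replicate, hw]
    rw [← sum_commutator_eq_zero (F := fun k => f (List.replicate k e))
      (G := fun k => g (List.replicate k e))
      (s := fun i j => ((i : ℤ) * deg e * (j * deg e)).negOnePow) (fun i j hij => ?_) ihf ihg h1 h2]
    · refine Finset.sum_congr rfl fun i hi => ?_
      rw [min_eq_left (Nat.lt_succ_iff.1 (Finset.mem_range.1 hi))]
    · refine Int.negOnePow_even _ ?_
      rcases hij with h | h
      · exact (((Int.even_coe_nat i).2 h).mul_right _).mul_right _
      · exact (((Int.even_coe_nat j).2 h).mul_right _).mul_left _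

end Topology

end Contraction

/-! ### Acyclicity of the vector field of a unital structure -/

section Acyclic

variable {K I : Type*} [CommRing K] [TopologicalSpace K] [DiscreteTopology K]
  {𝒜 : ℤ → AddSubgroup K} {d : I → ℤ} [GradedRing 𝒜] {M : CInftyStructure 𝒜 d} {e : I}

theorem tdeg_unit (he : M.IsUnital e) : tdeg d e = 1 := by rw [tdeg, he.1, sub_zero]

theorem odd_tdeg_unit (he : M.IsUnital e) : Odd (tdeg d e) := by
  rw [tdeg_unit he]
  exact odd_one

open Classical in
/-- The part of `m (t i)` that involves the letter of the unit. -/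
theorem onGen_apply_of_mem (he : M.IsUnital e) (i : I) {w : List I} (hw : e ∈ w) :
    M.onGen i w = (mul (letter K e) (letter K i) - if i = e then 0 else
      (tdeg d i).negOnePow • mul (letter K i) (letter K e)) w := by
  have h := he.2 i w hw
  rw [(letter_hasPar (deg := tdeg d) e).bracket_eq (letter_hasPar i), tdeg_unit he, one_mul] at h
  by_cases hi : i = e
  · subst hi
    rw [if_pos rfl, tdeg_unit he, Int.negOnePow_one] at h
    simp only [Pi.add_apply, Pi.sub_apply, Units.neg_smul, one_smul, Pi.neg_apply] at h
    rw [if_pos rfl, sub_zero, ← sub_eq_zero, ← h]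
    ring
  · rw [if_neg hi, add_zero] at h
    rw [if_neg hi]
    exact sub_eq_zero.1 h

theorem homotopy_mul_letter (deg : I → ℤ) (i j : I) :
    homotopy deg e (mul (letter K i) (letter K j)) =
      mul (contract deg e (fun _ => 1) (letter K i)) (wordMul (offCount K e) (letter K j)) := by
  rw [homotopy_mul, homotopy_letter, homotopy_letter, zero_mul', mul_zero', zero_add, add_zero]

open Classical in
theorem wordMul_offCount_letter (i : I) :
    wordMul (offCount K e) (letter K i) = if i = e then 0 else letter K i := by
  rw [(MonOf.letter (deg := fun _ => 0) i).wordMul_offCount, Multiset.map_singleton,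
    Multiset.sum_singleton, offWt]
  split_ifs <;> simp

open Classical in
/-- The homotopy picks the component `τ t i` of `m (t i)`, and returns `t i` for `i ≠ e`. -/
theorem homotopy_onGen (he : M.IsUnital e) (i : I) :
    homotopy (tdeg d) e (M.onGen i) = if i = e then 0 else letter K i := by
  rw [homotopy, contract_congr fun w hw => onGen_apply_of_mem he i hw, map_sub,
    homotopy_mul_letter, wordMul_offCount_letter, contract_one_letter, if_pos rfl, word_nil_mul]
  split_ifs with h
  · rw [map_zero, sub_zero]
  · rw [map_usmul, homotopy_mul_letter, contract_one_letter, if_neg h, zero_mul', smul_zero,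
      sub_zero]

/-- The derivatives with respect to `τ` of the commutator `[τ, t i]` and of `τ²` vanish. -/
theorem contract_one_onGen (he : M.IsUnital e) (i : I) :
    contract (tdeg d) e (fun _ => 1) (M.onGen i) = 0 := by
  classical
  rw [contract_congr fun w hw => onGen_apply_of_mem he i hw, map_sub, contract_one_mul,
    contract_one_letter, if_pos rfl, word_nil_mul, contract_one_letter, parity_letter,
    tdeg_unit he]
  split_ifs with h
  · rw [h, map_zero, usmul_mul, mul_word_nil]
    simp
  · rw [map_usmul, contract_one_mul, contract_one_letter, contract_one_letter, if_neg h,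
      if_pos rfl, parity_letter, usmul_mul, mul_word_nil, smul_add, smul_smul,
      ← Int.negOnePow_add, Int.negOnePow_even (tdeg d i + tdeg d i) ⟨_, rfl⟩]
    simp [mul_zero', zero_mul']

theorem onGen_apply_unit (he : M.IsUnital e) (i : I) : M.onGen i [e] = 0 := by
  have h : ∀ i j : I, mul (letter K i) (letter K j) [e] = 0 := by
    intro i j
    by_cases h : e = i
    · subst h
      rw [letter_mul_cons_self, letter_apply_of_ne (by simp)]
    · exact letter_mul_cons_of_ne h _ _
  rw [onGen_apply_of_mem he i (by simp), Pi.sub_apply, h]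
  split_ifs
  · rw [Pi.zero_apply, sub_zero]
  · rw [Pi.smul_apply, h, smul_zero, sub_zero]

open Classical in
/-- The coefficient of `τ t j` in `m (t i)`. -/
theorem onGen_apply_unit_pair (he : M.IsUnital e) (i j : I) :
    M.onGen i [e, j] = if i = j then 1 else 0 := by
  have h1 : letter K i [j] = if i = j then 1 else 0 := by
    split_ifs with h
    · rw [h, letter_apply_self]
    · exact letter_apply_of_ne (by simpa using fun h' => h h'.symm)
  rw [onGen_apply_of_mem he i (by simp), Pi.sub_apply, letter_mul_cons_self, h1]
  split_ifs with h h' <;> try rw [Pi.zero_apply, sub_zero]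
  all_goals
    rw [Pi.smul_apply, letter_mul_cons_of_ne (Ne.symm ‹_›), smul_zero, sub_zero]

theorem onGen_apply_nil (i : I) : M.onGen i [] = 0 := freeLie_apply_nil (onGen_mem_freeLie M i)

/-- The coefficients of the words `τ t j` in `m u` are, up to the dual differential, the linear
part of `u`. -/
theorem der_apply_unit_pair (he : M.IsUnital e) (u : List I → K) (j : I) :
    M.der u [e, j] = u [j] - ∑ a ∈ lettersAt M.onGen [j], u [e, a] * M.onGen a [j] := by
  classical
  have hA := adm_onGen M
  have h0 : lettersAt M.onGen [] = ∅ := Finset.eq_empty_of_forall_notMem fun a ha =>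
    (hA.mem_lettersAt.1 ha) (onGen_apply_nil a)
  have h1 : lettersAt M.onGen [e] = ∅ := Finset.eq_empty_of_forall_notMem fun a ha =>
    (hA.mem_lettersAt.1 ha) (onGen_apply_unit he a)
  -- Of the factorisations of `τ t j`, those in which `m` produces the whole word or `t j` remain.
  have h2 : ∑ a ∈ lettersAt M.onGen [e, j], u [a] * M.onGen a [e, j] = u [j] := by
    rw [Finset.sum_eq_single j]
    · rw [onGen_apply_unit_pair he, if_pos rfl, mul_one]
    · intro a _ ha
      rw [onGen_apply_unit_pair he, if_neg ha, mul_zero]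
    · intro h
      rw [hA.mem_lettersAt, not_not] at h
      rw [h, mul_zero]
  rw [CInftyStructure.der, oddDer_apply]
  simp only [splitSum_cons, splitSum_nil, h0, h1, Finset.sum_empty, List.nil_append, zero_add,
    add_zero, wdeg_nil, wdeg_cons, tdeg_unit he, Int.negOnePow_zero, Int.negOnePow_one, one_smul,
    h2, List.cons_append, Units.neg_smul, Finset.sum_neg_distrib, neg_zero]
  rw [sub_eq_add_neg]

theorem der_apply_singleton (u : List I → K) (j : I) :
    M.der u [j] = ∑ a ∈ lettersAt M.onGen [j], u [a] * M.onGen a [j] := by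
  have hA := adm_onGen M
  have h0 : lettersAt M.onGen [] = ∅ := Finset.eq_empty_of_forall_notMem fun a ha =>
    (hA.mem_lettersAt.1 ha) (onGen_apply_nil a)
  rw [CInftyStructure.der, oddDer_apply]
  simp only [splitSum_cons, splitSum_nil, h0, Finset.sum_empty, List.nil_append, zero_add,
    add_zero, wdeg_nil, Int.negOnePow_zero, one_smul]

/-! #### The filtration by the number of letters other than the unit -/

/-- The series all of whose words contain at least `n` letters other than `e`. -/
def offFil (K : Type*) [CommRing K] (e : I) (n : ℤ) : Submodule K (List I → K) where
  carrier := {f | ∀ w, wdeg (offWt e) w < n → f w = 0}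
  zero_mem' _ _ := rfl
  add_mem' hf hg w hw := by rw [Pi.add_apply, hf w hw, hg w hw, add_zero]
  smul_mem' c f hf w hw := by rw [Pi.smul_apply, hf w hw, smul_zero]

theorem mem_offFil_iff {n : ℤ} {f : List I → K} :
    f ∈ offFil K e n ↔ f ∈ homog (nonposSub K) (offWt e) n :=
  forall_congr' fun w => by rw [mem_nonposSub, sub_pos]

theorem isClosed_offFil (n : ℤ) : IsClosed (offFil K e n : Set (List I → K)) := by
  have : (offFil K e n : Set (List I → K)) =
      ⋂ (w : List I) (_ : wdeg (offWt e) w < n), {f | f w = 0} := by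
    ext f
    simp only [Set.mem_iInter]
    rfl
  rw [this]
  exact isClosed_iInter fun w => isClosed_iInter fun _ =>
    isClosed_singleton.preimage (continuous_apply w)

theorem onGen_mem_offFil (he : M.IsUnital e) (i : I) :
    M.onGen i ∈ homog (nonposSub K) (offWt e) (offWt e i + 0) := by
  classical
  rw [add_zero, ← mem_offFil_iff]
  intro w hw
  have h0 := wdeg_offWt_nonneg (e := e) w
  by_cases hi : i = e
  · rw [offWt, if_pos hi] at hw
    omega
  · rw [offWt, if_neg hi] at hw
    have hr := wdeg_offWt_eq_zero (show wdeg (offWt e) w = 0 by omega)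
    rcases w with _ | ⟨a, _ | ⟨b, w⟩⟩
    · exact onGen_apply_nil i
    · rw [List.length_singleton, List.replicate_one] at hr
      rw [hr, onGen_apply_unit he]
    · have ha : a = e := (List.mem_replicate.1 (hr ▸ List.mem_cons_self)).2
      have hb : b = e := (List.mem_replicate.1 (hr ▸ List.mem_cons_of_mem _ List.mem_cons_self)).2
      subst ha
      rw [onGen_apply_of_mem he i (by simp), if_neg hi, Pi.sub_apply, letter_mul_cons_self,
        Pi.smul_apply, letter_mul_cons_of_ne (Ne.symm hi), letter_apply_of_ne, smul_zero, sub_zero]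
      rw [hb]
      simpa using fun h => absurd h.symm hi

theorem der_mem_offFil (he : M.IsUnital e) {n : ℤ} {f : List I → K} (hf : f ∈ offFil K e n) :
    M.der f ∈ offFil K e n := by
  rw [mem_offFil_iff] at *
  have := oddDer_mem_homog (deg := tdeg d) nonposSub_isMul (onGen_mem_offFil he) hf
  rwa [add_zero] at this

theorem homotopy_mem_offFil {n : ℤ} {f : List I → K} (hf : f ∈ offFil K e n) :
    homotopy (tdeg d) e f ∈ offFil K e n := by
  classical
  rw [mem_offFil_iff] at *
  have := contract_mem_homog (deg := tdeg d) (e := e) (g := offCount K e)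
    (fun w n x hx => mem_nonposSub.2 fun h => by rw [mem_nonposSub.1 hx h, mul_zero]) hf
  rwa [offWt, if_pos rfl, sub_zero] at this

/-- The operator `m h + h m - N`, where `h` is the contracting homotopy and `N` counts the letters
other than the unit. -/
def homotopyError (M : CInftyStructure 𝒜 d) (e : I) : (List I → K) →ₗ[K] (List I → K) :=
  M.der ∘ₗ homotopy (tdeg d) e + homotopy (tdeg d) e ∘ₗ M.der - wordMul (offCount K e)

theorem homotopyError_apply (f : List I → K) : homotopyError M e f =
    M.der (homotopy (tdeg d) e f) + homotopy (tdeg d) e (M.der f) - wordMul (offCount K e) f := rfl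

open Classical in
theorem offCount_letter_mul (a : I) (g : List I → K) :
    wordMul (offCount K e) (mul (letter K a) g) =
      (if a = e then 0 else mul (letter K a) g) +
        mul (letter K a) (wordMul (offCount K e) g) := by
  funext w
  rw [wordMul_apply, Pi.add_apply]
  cases w with
  | nil =>
    rw [letter_mul_nil, letter_mul_nil, mul_zero]
    split_ifs <;> simp [letter_mul_nil]
  | cons b w =>
    by_cases h : b = a
    · subst h
      rw [letter_mul_cons_self, letter_mul_cons_self, wordMul_apply, offCount, wdeg_cons, offWt]
      split_ifs with hb
      · simp [offCount]
      · rw [letter_mul_cons_self]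
        push_cast [offCount]
        ring
    · rw [letter_mul_cons_of_ne h, letter_mul_cons_of_ne h, mul_zero]
      split_ifs
      · simp
      · rw [letter_mul_cons_of_ne h, zero_add]

theorem homotopy_letter_mul (a : I) (g : List I → K) [Decidable (a = e)] :
    homotopy (tdeg d) e (mul (letter K a) g) = (if a = e then wordMul (offCount K e) g else 0) +
      (tdeg d a).negOnePow • mul (letter K a) (homotopy (tdeg d) e g) := by
  rw [homotopy_mul, homotopy_letter, zero_mul', zero_add, contract_one_letter, parity_letter,
    usmul_mul]
  split_ifs <;> simp [word_nil_mul, zero_mul']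

open Classical in
/-- The defining property of the homotopy: up to the failure of `m` to preserve the number of
letters other than the unit, the error term is linear for multiplication by letters on the left. -/
theorem homotopyError_letter_mul (h_even : ∀ n : ℤ, Odd n → 𝒜 n = ⊥) (he : M.IsUnital e) (a : I)
    (g : List I → K) : homotopyError M e (mul (letter K a) g) =
      (if a = e then M.der (wordMul (offCount K e) g) - wordMul (offCount K e) (M.der g) else 0) +
        mul (letter K a) (homotopyError M e g) := by
  have hD := isOddDer_der M h_even
  have hp : parity (tdeg d) (M.onGen a) = -((tdeg d a).negOnePow • M.onGen a) := by
    rw [(hasPar_of_mem_homog h_even (onGen_mem_homog M a)).parity_eq, Int.negOnePow_succ,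
      Units.neg_smul]
  have hs : ∀ f : List I → K, (tdeg d a).negOnePow • ((tdeg d a).negOnePow • f) = f := by
    intro f
    rw [smul_smul, ← Int.negOnePow_add, Int.negOnePow_even (tdeg d a + tdeg d a) ⟨_, rfl⟩,
      one_smul]
  rw [homotopyError_apply, homotopyError_apply, homotopy_letter_mul, hD.letter_mul, der_letter,
    map_add, map_add, map_usmul, map_usmul, hD.letter_mul, der_letter, homotopy_letter_mul,
    homotopy_mul, homotopy_onGen he, contract_one_onGen he, zero_mul', hp, offCount_letter_mul,
    neg_mul', usmul_mul, smul_add, smul_add, hs, hs, mul_sub', mul_add']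
  split_ifs with h
  · rw [h, tdeg_unit he, Int.negOnePow_one]
    simp only [Units.neg_smul, one_smul, zero_mul']
    abel
  · simp only [map_zero, smul_zero]
    abel

theorem letter_mul_mem_offFil {n : ℤ} (a : I) {g : List I → K} (hg : g ∈ offFil K e n) :
    mul (letter K a) g ∈ offFil K e (offWt e a + n) := by
  rw [mem_offFil_iff] at *
  exact mul_mem_homog nonposSub_isMul (letter_mem_homog one_mem_nonposSub a) hg

theorem offFil_mono {m n : ℤ} (h : m ≤ n) : offFil K e n ≤ offFil K e m :=
  fun _ hf w hw => hf w (hw.trans_le h)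

/-- The anticommutator of `m` and the homotopy is the count of the letters other than the unit, up
to terms with more such letters. -/
theorem homotopyError_word (h_even : ∀ n : ℤ, Odd n → 𝒜 n = ⊥) (he : M.IsUnital e) (w : List I) :
    homotopyError M e (word K w) ∈ offFil K e (wdeg (offWt e) w + 1) := by
  classical
  have hN : ∀ w, wordMul (offCount K e) (word K w) = offCount K e w • word K w := by
    intro w
    funext v
    rw [wordMul_apply, Pi.smul_apply, smul_eq_mul]
    by_cases h : v = w
    · rw [h]
    · rw [word_apply_of_ne h, mul_zero, mul_zero]
  induction w with
  | nil =>
    have h1 : homotopy (tdeg d) e (word K []) = 0 := by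
      funext w
      rw [contract_apply]
      refine splitSum_eq_zero fun x y _ => ?_
      rw [word_apply_of_ne (by simp), mul_zero, smul_zero]
    rw [homotopyError_apply, (isOddDer_der M h_even).map_one, h1, map_zero, map_zero, hN,
      offCount_nil, zero_smul, add_zero, sub_zero]
    exact zero_mem _
  | cons a w ih =>
    rw [← letter_mul_word, homotopyError_letter_mul h_even he, wdeg_cons]
    refine add_mem ?_ ?_
    · split_ifs with ha
      · rw [offWt, if_pos ha, zero_add, hN, map_smul]
        have hw : word K w ∈ offFil K e (wdeg (offWt e) w) :=
          mem_offFil_iff.2 (word_mem_homog one_mem_nonposSub w)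
        have hDw := der_mem_offFil he hw
        intro v hv
        rw [Pi.sub_apply, Pi.smul_apply, smul_eq_mul, wordMul_apply]
        rcases (Int.lt_add_one_iff.1 hv).lt_or_eq with h | h
        · rw [hDw v h, mul_zero, mul_zero, sub_zero]
        · rw [offCount, offCount, h, sub_self]
      · exact zero_mem _
    · rw [add_assoc]
      exact letter_mul_mem_offFil a ih

theorem continuous_der (h_even : ∀ n : ℤ, Odd n → 𝒜 n = ⊥) : Continuous M.der :=
  (isOddDer_der M h_even).cont

theorem homotopyError_mem_offFil (h_even : ∀ n : ℤ, Odd n → 𝒜 n = ⊥) (he : M.IsUnital e) {n : ℤ}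
    {f : List I → K} (hf : f ∈ offFil K e n) : homotopyError M e f ∈ offFil K e (n + 1) := by
  have hH : Continuous (homotopy (K := K) (tdeg d) e) := continuous_contract _
  have hN : Continuous (wordMul (offCount K e)) := continuous_wordMul _
  have hD : Continuous M.der := continuous_der h_even
  have hc : Continuous (homotopyError M e) := ((hD.comp hH).add (hH.comp hD)).sub hN
  refine mem_of_word_mem (Z := (offFil K e (n + 1)).comap (homotopyError M e))
    ((isClosed_offFil (K := K) (e := e) (n + 1)).preimage hc) fun w hw => ?_
  -- All words of `f` have at least `n` letters other than the unit.
  refine offFil_mono ?_ (homotopyError_word h_even he w)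
  by_contra h
  exact hw (hf w (by omega))

/-! #### Solving `m u = z` -/

variable [Algebra ℚ K]

/-- One step of the approximation: the homotopy improves the filtration of a cocycle by one. -/
theorem sub_der_homotopy_mem (h_even : ∀ n : ℤ, Odd n → 𝒜 n = ⊥) (he : M.IsUnital e) {n : ℕ}
    (hn : n ≠ 0) {z : List I → K} (hz : z ∈ offFil K e n) (h0 : M.der z = 0) :
    z - M.der (natInv K n • homotopy (tdeg d) e z) ∈ offFil K e ((n + 1 : ℕ) : ℤ) := by
  have h : M.der (homotopy (tdeg d) e z) =
      homotopyError M e z + wordMul (offCount K e) z := by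
    rw [homotopyError_apply, h0, map_zero]
    abel
  have h1 : z - M.der (natInv K n • homotopy (tdeg d) e z) =
      (z - natInv K n • wordMul (offCount K e) z) - natInv K n • homotopyError M e z := by
    rw [map_smul, h, smul_add]
    abel
  rw [h1, Nat.cast_add, Nat.cast_one]
  refine sub_mem (fun w hw => ?_)
    (Submodule.smul_mem _ _ (homotopyError_mem_offFil h_even he hz))
  rw [Pi.sub_apply, Pi.smul_apply, smul_eq_mul, wordMul_apply]
  rcases (Int.lt_add_one_iff.1 hw).lt_or_eq with h | h
  · rw [hz w h, mul_zero, mul_zero, sub_zero]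
  · rw [offCount, h, Int.cast_natCast, ← mul_assoc, natInv_mul hn, one_mul, sub_self]

/-- The successive remainders of the approximation. -/
def remainder (M : CInftyStructure 𝒜 d) (e : I) (z : List I → K) : ℕ → List I → K
  | 0 => z
  | n + 1 => remainder M e z n -
      M.der (natInv K (n + 1) • homotopy (tdeg d) e (remainder M e z n))

/-- A closed Lie series without powers of the unit letter is exact: a solution is the sum of the
successive corrections, which converges since the corrections lie in higher and higher steps of the
filtration. -/
theorem exists_der_eq_of_offFil (h_even : ∀ n : ℤ, Odd n → 𝒜 n = ⊥) (he : M.IsUnital e) {n : ℤ}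
    {z : List I → K} (hz : z ∈ freeLie K (tdeg d)) (hn : z ∈ homog 𝒜 (tdeg d) n)
    (h0 : M.der z = 0) (h1 : z ∈ offFil K e 1) :
    ∃ u ∈ freeLie K (tdeg d), u ∈ homog 𝒜 (tdeg d) (n - 1) ∧ M.der u = z := by
  set r := remainder M e z with hr
  have hr0 : r 0 = z := rfl
  have hrs : ∀ k, r (k + 1) = r k - M.der (natInv K (k + 1) • homotopy (tdeg d) e (r k)) :=
    fun _ => rfl
  have hint : ∀ w : List I, ∀ k, ∀ x ∈ 𝒜 k, offCount K e w * x ∈ 𝒜 k := by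
    intro w k x hx
    rw [offCount, ← zsmul_eq_mul]
    exact AddSubgroup.zsmul_mem _ hx _
  -- The `k`-th remainder is closed and lies in step `k + 1` of the filtration.
  have key : ∀ k, r k ∈ freeLie K (tdeg d) ∧ r k ∈ homog 𝒜 (tdeg d) n ∧ M.der (r k) = 0 ∧
      r k ∈ offFil K e ((k + 1 : ℕ) : ℤ) := by
    intro k
    induction k with
    | zero => exact ⟨hz, hn, h0, by rw [hr0]; simpa using h1⟩
    | succ k ih =>
      obtain ⟨i1, i2, i3, i4⟩ := ih
      have j1 : natInv K (k + 1) • homotopy (tdeg d) e (r k) ∈ freeLie K (tdeg d) :=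
        Submodule.smul_mem _ _ (homotopy_mem_freeLie (odd_tdeg_unit he) i1)
      have j2 : M.der (natInv K (k + 1) • homotopy (tdeg d) e (r k)) ∈ homog 𝒜 (tdeg d) n := by
        have := der_mem_homog M (n := n - tdeg d e)
          (x := natInv K (k + 1) • homotopy (tdeg d) e (r k)) fun w =>
            natInv_mul_mem _ _ _ (contract_mem_homog hint i2 w)
        rwa [tdeg_unit he, sub_add_cancel] at this
      rw [hrs]
      refine ⟨sub_mem i1 (der_mem_freeLie M h_even j1), sub_mem i2 j2, ?_, ?_⟩
      · rw [map_sub, i3, der_der M h_even j1, sub_zero]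
      · exact sub_der_homotopy_mem h_even he (Nat.succ_ne_zero k) i4 i3
  set v : ℕ → List I → K := fun k => natInv K (k + 1) • homotopy (tdeg d) e (r k) with hv
  have hvL : ∀ k, v k ∈ freeLie K (tdeg d) := fun k =>
    Submodule.smul_mem _ _ (homotopy_mem_freeLie (odd_tdeg_unit he) (key k).1)
  have hvF : ∀ k, v k ∈ offFil K e ((k + 1 : ℕ) : ℤ) := fun k =>
    Submodule.smul_mem _ _ (homotopy_mem_offFil (key k).2.2.2)
  set U : ℕ → List I → K := fun k => ∑ i ∈ Finset.range k, v i with hU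
  have hUs : ∀ k, U (k + 1) = U k + v k := fun k => Finset.sum_range_succ v k
  have hUD : ∀ k, M.der (U k) = z - r k := by
    intro k
    induction k with
    | zero => simp [hU, hr0]
    | succ k ih =>
      rw [hUs, map_add, hrs, ih]
      abel
  -- The coefficient of `w` in the partial sums is constant once their index reaches the number of
  -- letters of `w` other than `e`.
  let u : List I → K := fun w => U (wdeg (offWt e) w).toNat w
  have hu : ∀ w k, (wdeg (offWt e) w).toNat ≤ k → U k w = u w := by
    intro w k hk
    induction k, hk using Nat.le_induction with
    | base => rfl
    | succ k hk ih =>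
      rw [← ih]
      rw [hUs, Pi.add_apply, hvF k w (by push_cast; omega), add_zero]
  have hlim : Filter.Tendsto U Filter.atTop (nhds u) := by
    refine tendsto_pi_nhds.2 fun w => ?_
    exact tendsto_const_nhds.congr' (Filter.eventually_atTop.2 ⟨_, fun k hk => (hu w k hk).symm⟩)
  have hr_lim : Filter.Tendsto (fun k => z - r k) Filter.atTop (nhds z) := by
    refine tendsto_pi_nhds.2 fun w => ?_
    refine tendsto_const_nhds.congr' (Filter.eventually_atTop.2
      ⟨(wdeg (offWt e) w).toNat, fun k hk => ?_⟩)
    change z w = z w - r k w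
    rw [(key k).2.2.2 w (by push_cast; omega), sub_zero]
  refine ⟨u, (isClosed_freeLie (K := K) (tdeg d)).mem_of_tendsto hlim
    (Filter.Eventually.of_forall fun k => sum_mem fun i _ => hvL i), fun w => ?_, ?_⟩
  · have : ∀ k, U k ∈ homog 𝒜 (tdeg d) (n - 1) := by
      intro k
      refine sum_mem fun i _ w => natInv_mul_mem _ _ _ ?_
      have := contract_mem_homog (deg := tdeg d) (e := e) hint (key i).2.1 w
      rwa [tdeg_unit he] at this
    exact this _ w
  · refine tendsto_nhds_unique (((continuous_der h_even).tendsto u).comp hlim) ?_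
    exact hr_lim.congr fun k => (hUD k).symm

/-- A closed Lie series has no component `τ`. -/
theorem apply_unit_of_der_eq_zero (he : M.IsUnital e) {z : List I → K} (h0 : M.der z = 0) :
    z [e] = 0 := by
  have h := congrFun h0 [e, e]
  have h1 : lettersAt M.onGen [e] = ∅ := Finset.eq_empty_of_forall_notMem fun a ha =>
    ((adm_onGen M).mem_lettersAt.1 ha) (onGen_apply_unit he a)
  rwa [der_apply_unit_pair he, h1, Finset.sum_empty, sub_zero] at h

/-- The pro-free Lie algebra with the vector field of a unital structure is acyclic. -/
theorem exists_der_eq (h_even : ∀ n : ℤ, Odd n → 𝒜 n = ⊥) (he : M.IsUnital e) {n : ℤ}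
    {z : List I → K} (hz : z ∈ freeLie K (tdeg d)) (hn : z ∈ homog 𝒜 (tdeg d) n)
    (h0 : M.der z = 0) :
    ∃ u ∈ freeLie K (tdeg d), u ∈ homog 𝒜 (tdeg d) (n - 1) ∧ M.der u = z := by
  classical
  -- `m τ` has the component `τ²`; subtracting a multiple of it leaves no power of `τ`.
  set v : List I → K := z [e, e] • letter K e with hv
  have hvL : v ∈ freeLie K (tdeg d) := Submodule.smul_mem _ _ (letter_mem _ _)
  have hvn : v ∈ homog 𝒜 (tdeg d) (n - 1) := by
    intro w
    rw [hv, Pi.smul_apply, smul_eq_mul]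
    by_cases hw : w = [e]
    · have := hn [e, e]
      rw [hw, letter_apply_self, mul_one]
      simp only [wdeg_cons, wdeg_nil, tdeg_unit he] at this ⊢
      convert this using 2
      ring
    · rw [letter_apply_of_ne hw, mul_zero]
      exact zero_mem _
  have h1 : z - M.der v ∈ offFil K e 1 := by
    have h0' : M.der (z - M.der v) = 0 := by rw [map_sub, h0, der_der M h_even hvL, sub_zero]
    have hL := sub_mem hz (der_mem_freeLie M h_even hvL)
    intro w hw
    have hw0 := wdeg_offWt_nonneg (e := e) w
    rw [wdeg_offWt_eq_zero (show wdeg (offWt e) w = 0 by omega)]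
    -- Lie series involve no power of `τ` but `τ` and `τ²`, and both are absent here.
    by_cases k1 : w.length = 1
    · rw [k1]
      exact apply_unit_of_der_eq_zero he h0'
    by_cases k2 : w.length = 2
    · rw [k2]
      change (z - M.der v) [e, e] = 0
      have : lettersAt M.onGen [e] = ∅ := Finset.eq_empty_of_forall_notMem fun a ha =>
        ((adm_onGen M).mem_lettersAt.1 ha) (onGen_apply_unit he a)
      rw [Pi.sub_apply, der_apply_unit_pair he, this, Finset.sum_empty, hv, Pi.smul_apply,
        letter_apply_self, smul_eq_mul, mul_one, sub_zero, sub_self]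
    · exact freeLie_apply_replicate hL k1 k2
  have hDn := der_mem_homog M hvn
  rw [sub_add_cancel] at hDn
  obtain ⟨u, huL, hun, hu⟩ := exists_der_eq_of_offFil h_even he
    (sub_mem hz (der_mem_freeLie M h_even hvL)) (sub_mem hn hDn)
    (by rw [map_sub, h0, der_der M h_even hvL, sub_zero]) h1
  exact ⟨u + v, add_mem huL hvL, add_mem hun hvn, by rw [map_add, hu, sub_add_cancel]⟩

end Acyclic

/-! ### Homogeneous components -/

section Components

variable {K A : Type*} [CommRing K] (𝒜 : ℤ → AddSubgroup K) [GradedRing 𝒜] (deg : A → ℤ)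

/-- The homogeneous component of degree `n` of a series. -/
def component (n : ℤ) : (List A → K) →+ (List A → K) where
  toFun f w := GradedRing.proj 𝒜 (n - wdeg deg w) (f w)
  map_zero' := by funext w; exact map_zero _
  map_add' f g := by funext w; exact map_add _ _ _

/-- The homogeneous component of degree `n` of an element of the completed tensor square. -/
def tensorComponent (n : ℤ) : (List A × List A → K) →+ (List A × List A → K) where
  toFun F p := GradedRing.proj 𝒜 (n - wdeg deg p.1 - wdeg deg p.2) (F p)
  map_zero' := by funext w; exact map_zero _
  map_add' f g := by funext w; exact map_add _ _ _

variable {𝒜 deg}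

theorem component_apply (n : ℤ) (f : List A → K) (w : List A) :
    component 𝒜 deg n f w = GradedRing.proj 𝒜 (n - wdeg deg w) (f w) := rfl

theorem tensorComponent_apply (n : ℤ) (F : List A × List A → K) (p : List A × List A) :
    tensorComponent 𝒜 deg n F p =
      GradedRing.proj 𝒜 (n - wdeg deg p.1 - wdeg deg p.2) (F p) := rfl

theorem proj_mul_right {k l : ℤ} {x : K} (hx : x ∈ 𝒜 l) (c : K) :
    GradedRing.proj 𝒜 k (c * x) = GradedRing.proj 𝒜 (k - l) c * x := by
  have := DirectSum.coe_decompose_mul_add_of_right_mem 𝒜 (i := k - l) (a := c) hx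
  rwa [sub_add_cancel] at this

theorem proj_usmul (k : ℤ) (c : ℤˣ) (x : K) :
    GradedRing.proj 𝒜 k (c • x) = c • GradedRing.proj 𝒜 k x := by
  rw [Units.smul_def, Units.smul_def, map_zsmul]

theorem tensorComponent_mem_tensorHomog (n : ℤ) (F : List A × List A → K) :
    tensorComponent 𝒜 deg n F ∈ tensorHomog 𝒜 deg n := fun _ => SetLike.coe_mem _

theorem tensorComponent_smul {k n : ℤ} {F : List A × List A → K} (hF : F ∈ tensorHomog 𝒜 deg n)
    (c : K) : tensorComponent 𝒜 deg k (c • F) = GradedRing.proj 𝒜 (k - n) c • F := by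
  funext p
  rw [tensorComponent_apply, Pi.smul_apply, Pi.smul_apply, smul_eq_mul, smul_eq_mul,
    proj_mul_right (hF p), show k - wdeg deg p.1 - wdeg deg p.2 -
      (n - wdeg deg p.1 - wdeg deg p.2) = k - n by ring]

theorem tensorComponent_eq_self {n : ℤ} {F : List A × List A → K}
    (hF : F ∈ tensorHomog 𝒜 deg n) : tensorComponent 𝒜 deg n F = F := by
  funext p
  exact DirectSum.decompose_of_mem_same 𝒜 (hF p)

/-- An odd derivation of degree one commutes with the passage to homogeneous components. -/
theorem component_oddDer {δ : A → List A → K} (hδ : ∀ a, δ a ∈ homog 𝒜 deg (deg a + 1)) (n : ℤ)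
    (f : List A → K) :
    component 𝒜 deg (n + 1) (oddDer deg δ f) = oddDer deg δ (component 𝒜 deg n f) := by
  funext w
  rw [component_apply, oddDer_apply, oddDer_apply, map_splitSum]
  refine splitSum_congr fun u r hr => ?_
  rw [map_splitSum]
  refine splitSum_congr fun v u' hu => ?_
  rw [map_sum]
  refine Finset.sum_congr rfl fun a _ => ?_
  rw [proj_usmul, proj_mul_right (hδ a v), component_apply, ← hr, ← hu, wdeg_append, wdeg_append,
    wdeg_append, wdeg_cons, show n + 1 - (wdeg deg u + (wdeg deg v + wdeg deg u')) -
      (deg a + 1 - wdeg deg v) = n - (wdeg deg u + (deg a + wdeg deg u')) by ring]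

theorem tensorComponent_tensorOdd {δ : A → List A → K}
    (hδ : ∀ a, δ a ∈ homog 𝒜 deg (deg a + 1)) (n : ℤ) (F : List A × List A → K) :
    tensorComponent 𝒜 deg (n + 1) (tensorOdd deg (oddDer deg δ) F) =
      tensorOdd deg (oddDer deg δ) (tensorComponent 𝒜 deg n F) := by
  funext p
  obtain ⟨u, v⟩ := p
  have h1 : (fun x => tensorComponent 𝒜 deg n F (x, v)) =
      component 𝒜 deg (n - wdeg deg v) fun x => F (x, v) := by
    funext x
    rw [tensorComponent_apply, component_apply, sub_right_comm]
  have h2 : (fun y => tensorComponent 𝒜 deg n F (u, y)) =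
      component 𝒜 deg (n - wdeg deg u) fun y => F (u, y) := rfl
  change GradedRing.proj 𝒜 (n + 1 - wdeg deg u - wdeg deg v)
      (oddDer deg δ (fun x => F (x, v)) u +
        (wdeg deg u).negOnePow • oddDer deg δ (fun y => F (u, y)) v) =
    oddDer deg δ (fun x => tensorComponent 𝒜 deg n F (x, v)) u +
      (wdeg deg u).negOnePow • oddDer deg δ (fun y => tensorComponent 𝒜 deg n F (u, y)) v
  rw [h1, h2, ← component_oddDer hδ, ← component_oddDer hδ, map_add, proj_usmul, component_apply,
    component_apply]
  congr 1
  · rw [show n + 1 - wdeg deg u - wdeg deg v = n - wdeg deg v + 1 - wdeg deg u by ring]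
  · rw [show n + 1 - wdeg deg u - wdeg deg v = n - wdeg deg u + 1 - wdeg deg v by ring]

section Topology

variable [TopologicalSpace K] [DiscreteTopology K]

theorem continuous_tensorComponent (n : ℤ) : Continuous (tensorComponent 𝒜 deg n) :=
  continuous_pi fun p => (continuous_of_discreteTopology
    (f := GradedRing.proj 𝒜 (n - wdeg deg p.1 - wdeg deg p.2))).comp (continuous_apply p)

variable (𝒜 deg) in
/-- The tensors all of whose multiples have their homogeneous components in `S`. -/
def componentSub (S : Submodule K (List A × List A → K)) :
    Submodule K (List A × List A → K) where
  carrier := {F | ∀ (n : ℤ) (c : K), tensorComponent 𝒜 deg n (c • F) ∈ S}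
  zero_mem' n c := by rw [smul_zero, map_zero]; exact zero_mem _
  add_mem' hF hG n c := by rw [smul_add, map_add]; exact add_mem (hF n c) (hG n c)
  smul_mem' c F hF n c' := by rw [smul_smul]; exact hF n _

theorem isClosed_componentSub {S : Submodule K (List A × List A → K)}
    (hS : IsClosed (S : Set (List A × List A → K))) :
    IsClosed (componentSub 𝒜 deg S : Set (List A × List A → K)) := by
  have : (componentSub 𝒜 deg S : Set (List A × List A → K)) =
      ⋂ (n : ℤ) (c : K), (fun F => tensorComponent 𝒜 deg n (c • F)) ⁻¹' S := by
    ext F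
    simp only [Set.mem_iInter]
    rfl
  rw [this]
  have hc : ∀ c : K, Continuous fun F : List A × List A → K => c • F := fun c =>
    continuous_pi fun p => continuous_const.mul (continuous_apply p)
  exact isClosed_iInter fun n => isClosed_iInter fun c =>
    hS.preimage ((continuous_tensorComponent n).comp (hc c))

theorem mem_componentSub {S : Submodule K (List A × List A → K)} {n : ℤ}
    {F : List A × List A → K} (hF : F ∈ S) (hn : F ∈ tensorHomog 𝒜 deg n) :
    F ∈ componentSub 𝒜 deg S := fun k c => by
  rw [tensorComponent_smul hn]
  exact Submodule.smul_mem _ _ hF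

theorem tensorComponent_mem_lieTensor (n : ℤ) {F : List A × List A → K}
    (hF : F ∈ lieTensor K deg) : tensorComponent 𝒜 deg n F ∈ lieTensor K deg := by
  have h : F ∈ componentSub 𝒜 deg (lieTensor K deg) := by
    refine lieTensor_le (isClosed_componentSub (isClosed_lieTensor deg)) (fun x y hx hy => ?_) hF
    obtain ⟨s, hs⟩ := hx.exists_monOf
    obtain ⟨t, ht⟩ := hy.exists_monOf
    exact mem_componentSub (tmul_mem_lieTensor hx.mem_freeLie hy.mem_freeLie)
      (tmul_mem_tensorHomog (isMul_of_gradedRing 𝒜)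
        (hs.mem_homog (isMul_of_gradedRing 𝒜) one_mem_zero)
        (ht.mem_homog (isMul_of_gradedRing 𝒜) one_mem_zero))
  have := h n 1
  rwa [one_smul] at this

/-- The relations of the Lie de Rham complex are homogeneous; the homogeneous components of limits
of combinations with arbitrary coefficients in `K` are again relations. -/
theorem tensorComponent_mem_lieRel (n : ℤ) {F : List A × List A → K}
    (hF : F ∈ lieRel K deg) : tensorComponent 𝒜 deg n F ∈ lieRel K deg := by
  have hmul := isMul_of_gradedRing 𝒜
  have hm : ∀ {s : Multiset A} {x : List A → K}, MonOf K deg s x →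
      x ∈ homog 𝒜 deg (s.map deg).sum := fun hx => hx.mem_homog hmul one_mem_zero
  have h : F ∈ componentSub 𝒜 deg (lieRel K deg) := by
    refine lieRel_le (isClosed_componentSub (isClosed_lieRel deg)) (fun x y hx hy => ?_)
      (fun x y z hx hy hz => ?_) hF
    · obtain ⟨s, hs⟩ := hx.exists_monOf
      obtain ⟨t, ht⟩ := hy.exists_monOf
      have h1 := tmul_mem_tensorHomog hmul (hm hs) (hm ht)
      exact mem_componentSub (symm_mem_lieRel hx.mem_freeLie hy.mem_freeLie)
        (sub_mem h1 (swap_mem_tensorHomog h1))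
    · obtain ⟨s, hs⟩ := hx.exists_monOf
      obtain ⟨t, ht⟩ := hy.exists_monOf
      obtain ⟨r, hr⟩ := hz.exists_monOf
      have h1 := tmul_mem_tensorHomog hmul (hm hs) (bracket_mem_homog (deg := deg) hmul (hm ht) (hm hr))
      have h2 := tmul_mem_tensorHomog hmul (bracket_mem_homog (deg := deg) hmul (hm hs) (hm ht)) (hm hr)
      rw [add_assoc] at h2
      exact mem_componentSub
        (invariance_mem_lieRel hx.mem_freeLie hy.mem_freeLie hz.mem_freeLie) (sub_mem h1 h2)
  have := h n 1
  rwa [one_smul] at this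

end Topology

end Components

/-! ### The dual complex and one-forms with a given moment -/

section Dual

variable {K I V : Type*} [CommRing K] [TopologicalSpace K] [DiscreteTopology K]
  {𝒜 : ℤ → AddSubgroup K} {d : I → ℤ} [AddCommGroup V] [Module K V] (b : Module.Basis I K V)

/-- The linear part of a series, as a functional on `V`. -/
def linFunctional : (List I → K) →ₗ[K] Module.Dual K V :=
  (b.constr K).toLinearMap ∘ₗ LinearMap.funLeft K K fun j : I => [j]

/-- The contraction of the quadratic part of a series with `v e` in the first slot. -/
def unitFunctional (e : I) : (List I → K) →ₗ[K] Module.Dual K V :=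
  (b.constr K).toLinearMap ∘ₗ LinearMap.funLeft K K fun j : I => [e, j]

/-- The series `∑ i, φ (v i) * t i`. -/
def dualSeries : Module.Dual K V →ₗ[K] (List I → K) where
  toFun φ w := match w with
    | [j] => φ (b j)
    | _ => 0
  map_add' φ ψ := by funext w; rcases w with _ | ⟨j, _ | ⟨k, w⟩⟩ <;> simp
  map_smul' c φ := by funext w; rcases w with _ | ⟨j, _ | ⟨k, w⟩⟩ <;> simp

variable {b} {e : I}

theorem linFunctional_apply (z : List I → K) (j : I) : linFunctional b z (b j) = z [j] :=
  b.constr_basis K _ j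

theorem unitFunctional_apply (z : List I → K) (j : I) : unitFunctional b e z (b j) = z [e, j] :=
  b.constr_basis K _ j

theorem dualSeries_singleton (φ : Module.Dual K V) (j : I) : dualSeries b φ [j] = φ (b j) := rfl

theorem dualSeries_of_length_ne (φ : Module.Dual K V) {w : List I} (hw : w.length ≠ 1) :
    dualSeries b φ w = 0 := by
  rcases w with _ | ⟨j, _ | ⟨k, w⟩⟩
  · rfl
  · exact absurd rfl hw
  · rfl

theorem dualSeries_eq_finsum (φ : Module.Dual K V) (w : List I) :
    dualSeries b φ w = ∑ᶠ i, φ (b i) * letter K i w := by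
  by_cases hw : ∃ j, w = [j]
  · obtain ⟨j, rfl⟩ := hw
    rw [finsum_eq_single _ j, letter_apply_self, mul_one, dualSeries_singleton]
    intro i hi
    rw [letter_apply_of_ne, mul_zero]
    simpa using hi.symm
  · rw [dualSeries_of_length_ne, finsum_eq_zero_of_forall_eq_zero]
    · intro i
      rw [letter_apply_of_ne fun h => hw ⟨i, h⟩, mul_zero]
    · exact fun h => hw (List.length_eq_one_iff.1 h)

theorem linFunctional_dualSeries (φ : Module.Dual K V) :
    linFunctional b (dualSeries b φ) = φ := b.ext fun j => by
  rw [linFunctional_apply, dualSeries_singleton]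

theorem unitFunctional_dualSeries (φ : Module.Dual K V) :
    unitFunctional b e (dualSeries b φ) = 0 := b.ext fun j => by
  rw [unitFunctional_apply, dualSeries_of_length_ne φ (by simp), LinearMap.zero_apply]

theorem dualSeries_mem_freeLie (φ : Module.Dual K V) : dualSeries b φ ∈ freeLie K (tdeg d) := by
  refine mem_of_word_mem (isClosed_freeLie _) fun w hw => ?_
  have : w.length = 1 := not_not.1 fun h => hw (dualSeries_of_length_ne φ h)
  obtain ⟨j, rfl⟩ := List.length_eq_one_iff.1 this
  rw [← letter_eq_word]
  exact letter_mem _ _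

theorem dualSeries_mem_homog {n : ℤ} {φ : Module.Dual K V} (hφ : φ ∈ dualCochains 𝒜 d b n) :
    dualSeries b φ ∈ homog 𝒜 (tdeg d) (n + 1) := by
  intro w
  by_cases hw : w.length = 1
  · obtain ⟨j, rfl⟩ := List.length_eq_one_iff.1 hw
    have := hφ j
    rw [dualSeries_singleton, wdeg_cons, wdeg_nil, tdeg]
    convert this using 2
    ring
  · rw [dualSeries_of_length_ne φ hw]
    exact zero_mem _

theorem linFunctional_mem {n : ℤ} {z : List I → K} (hz : z ∈ homog 𝒜 (tdeg d) (n + 1)) :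
    linFunctional b z ∈ dualCochains 𝒜 d b n := by
  intro j
  have := hz [j]
  rw [wdeg_cons, wdeg_nil, tdeg] at this
  rw [linFunctional_apply]
  convert this using 2
  ring

variable [GradedRing 𝒜] {M : CInftyStructure 𝒜 d}

theorem unitFunctional_mem (he : M.IsUnital e) {n : ℤ} {z : List I → K}
    (hz : z ∈ homog 𝒜 (tdeg d) (n + 2)) : unitFunctional b e z ∈ dualCochains 𝒜 d b n := by
  intro j
  have := hz [e, j]
  rw [wdeg_cons, wdeg_cons, wdeg_nil, tdeg_unit he, tdeg] at this
  rw [unitFunctional_apply]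
  convert this using 2
  ring

theorem dualMap_apply_basis (φ : Module.Dual K V) (j : I) :
    (M.linearPart b).dualMap φ (b j) =
      ∑ a ∈ lettersAt M.onGen [j], φ (b a) * M.onGen a [j] := by
  rw [LinearMap.dualMap_apply, CInftyStructure.linearPart, b.constr_basis, map_sum]
  refine Finset.sum_congr rfl fun a _ => ?_
  rw [map_smul, smul_eq_mul, mul_comm]

theorem linFunctional_der (u : List I → K) :
    linFunctional b (M.der u) = (M.linearPart b).dualMap (linFunctional b u) := b.ext fun j => by
  rw [linFunctional_apply, der_apply_singleton, dualMap_apply_basis]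
  simp only [linFunctional_apply]

/-- The coefficients of the words `τ t j` give a homotopy between the linear part and zero, which
is why the linear part of a solution of `m u = z` can be read off from `z` up to a coboundary. -/
theorem unitFunctional_der (he : M.IsUnital e) (u : List I → K) :
    unitFunctional b e (M.der u) =
      linFunctional b u - (M.linearPart b).dualMap (unitFunctional b e u) := b.ext fun j => by
  rw [unitFunctional_apply, der_apply_unit_pair he, LinearMap.sub_apply, linFunctional_apply,
    dualMap_apply_basis]
  simp only [unitFunctional_apply]

theorem bsum_mem_freeLie {y : I → List I → K} (hy : ∀ i, y i ∈ freeLie K (tdeg d)) :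
    bsum (tdeg d) y ∈ freeLie K (tdeg d) := by
  classical
  have ht : Filter.Tendsto (fun s : Finset I => ∑ i ∈ s, (Pi.single i (y i) : I → List I → K))
      Filter.atTop (nhds y) := by
    refine tendsto_pi_nhds.2 fun j => tendsto_const_nhds.congr' ?_
    filter_upwards [Filter.eventually_ge_atTop {j}] with s hs
    rw [Finset.sum_apply, Finset.sum_pi_single, if_pos (hs (Finset.mem_singleton_self j))]
  refine (isClosed_freeLie (K := K) (tdeg d)).mem_of_tendsto
    (((continuous_bsum (tdeg d)).tendsto y).comp ht) (Filter.Eventually.of_forall fun s => ?_)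
  rw [Function.comp_apply, map_sum]
  refine sum_mem fun i _ => ?_
  rw [bsum_single]
  exact bracket_mem (letter_mem _ _) (hy i)

theorem mem_normalSub_of_mem_drCochains {n : ℤ} {x : List (I ⊕ I) × List (I ⊕ I) → K}
    (hx : x ∈ drCochains 𝒜 d 1 n) : x ∈ normalSub K d :=
  mem_normalSub_of_formDeg_one hx.1 (mem_bihomog_iff.1 hx.2).1

theorem moment_mem_freeLie {x : List (I ⊕ I) × List (I ⊕ I) → K} (hx : x ∈ normalSub K d) :
    moment d x ∈ freeLie K (tdeg d) := bsum_mem_freeLie (mem_normalSub.1 hx).2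

theorem linFunctional_moment {x : List (I ⊕ I) × List (I ⊕ I) → K} (hx : x ∈ normalSub K d) :
    linFunctional b (moment d x) = 0 := b.ext fun j => by
  rw [linFunctional_apply, LinearMap.zero_apply]
  change headSum (LinearMap.pi (coeff d) x) [j] -
    lastSum (tdeg d) (LinearMap.pi (coeff d) x) ([] ++ [j]) = 0
  have : LinearMap.pi (coeff d) x j [] = 0 := freeLie_apply_nil ((mem_normalSub.1 hx).2 j)
  rw [headSum_cons, lastSum_concat, this, smul_zero, sub_zero]

theorem moment_mem_homog_of_mem {n : ℤ} {x : List (I ⊕ I) × List (I ⊕ I) → K}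
    (hx : x ∈ drCochains 𝒜 d 1 (n + 1)) : moment d x ∈ homog 𝒜 (tdeg d) n := by
  have := moment_mem_homog (mem_bihomog_iff.1 hx.2).2
  rwa [add_sub_cancel_right] at this

variable [Algebra ℚ K]

/-- A one-form whose moment is a given Lie series without linear part. -/
def formOfMoment (d : I → ℤ) : (List I → K) →ₗ[K] (List (I ⊕ I) × List (I ⊕ I) → K) :=
  tform Sum.inr ∘ₗ lieTails (tdeg d)

theorem moment_formOfMoment {u : List I → K} (hu : u ∈ freeLie K (tdeg d))
    (h0 : linFunctional b u = 0) : moment d (formOfMoment d u) = u := by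
  rw [formOfMoment, LinearMap.comp_apply, moment_tform, bsum_lieTails hu]
  intro a
  have := linFunctional_apply (b := b) u a
  rw [h0, LinearMap.zero_apply] at this
  exact this.symm

theorem formOfMoment_mem {n : ℤ} {u : List I → K} (hu : u ∈ homog 𝒜 (tdeg d) n) :
    formOfMoment d u ∈ drCochains 𝒜 d 1 (n + 1) := by
  refine ⟨tform_mem_lieTensor Sum.inr_injective fun i => lieTails_mem_freeLie u i,
    mem_bihomog_iff.2 ⟨?_, ?_⟩⟩
  · refine tform_mem_tensorHomog Sum.inr_injective fun i => ?_
    have h : ((1 : ℕ) : ℤ) - formWt (Sum.inr i : I ⊕ I) = 0 := rfl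
    rw [h]
    exact incl_mem_formWt _
  · refine tform_mem_tensorHomog Sum.inr_injective fun i => ?_
    have h : n + 1 - fdeg d (Sum.inr i) = n - tdeg d i := by
      change n + 1 - (tdeg d i + 1) = _
      ring
    rw [h]
    exact incl_mem_homog (wt := fdeg d) (lieTails_mem_homog hu i)

theorem oneForm_mem_lieTensor (y : I → freeLie K (tdeg d)) :
    oneForm y ∈ lieTensor K (fdeg d) := by
  rw [oneForm_eq]
  exact tform_mem_lieTensor Sum.inr_injective fun i => (y i).2

theorem oneForm_mem_formWt (y : I → freeLie K (tdeg d)) :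
    oneForm y ∈ tensorHomog (zeroSub K) formWt (1 : ℕ) := by
  rw [oneForm_eq]
  refine tform_mem_tensorHomog Sum.inr_injective fun i => ?_
  have h : ((1 : ℕ) : ℤ) - formWt (Sum.inr i : I ⊕ I) = 0 := rfl
  rw [h]
  exact incl_mem_formWt _

theorem moment_oneForm (y : I → freeLie K (tdeg d)) : moment d (oneForm y) = bracketSum y := by
  rw [oneForm_eq, moment_tform, bracketSum_eq]

theorem primitive_mem_drCochains {n : ℤ} {x : List (I ⊕ I) × List (I ⊕ I) → K}
    (hx : x ∈ drCochains 𝒜 d 1 (n + 1)) : primitive d x ∈ drCochains 𝒜 d 0 n := by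
  have h := primitive_mem_tensorHomog (mem_bihomog_iff.1 hx.2).2
  rw [add_sub_cancel_right] at h
  exact ⟨primitive_mem_lieTensor (mem_normalSub_of_mem_drCochains hx),
    mem_bihomog_iff.2 ⟨primitive_mem_formWt x, h⟩⟩

end Dual

/-! ### Maps of subquotients -/

section Subquotient

variable {G H L : Type*} [AddCommGroup G] [AddCommGroup H] [AddCommGroup L]

theorem mk_eq_mk_of_sub_mem {Z C : AddSubgroup G} {x y : Z} (h : (x : G) - y ∈ C) :
    (QuotientAddGroup.mk x : Z ⧸ C.addSubgroupOf Z) = QuotientAddGroup.mk y := by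
  rw [QuotientAddGroup.eq, AddSubgroup.mem_addSubgroupOf]
  have := neg_mem h
  rw [neg_sub] at this
  simpa [neg_add_eq_sub] using this

theorem mk_eq_zero_iff {Z C : AddSubgroup G} {x : Z} :
    (QuotientAddGroup.mk x : Z ⧸ C.addSubgroupOf Z) = 0 ↔ (x : G) ∈ C := by
  rw [QuotientAddGroup.eq_zero_iff, AddSubgroup.mem_addSubgroupOf]

/-- The map of subquotients that is induced by a homomorphism. -/
def subquotientMap (Z C : AddSubgroup G) (Z' C' : AddSubgroup H) (f : G →+ H)
    (hZ : ∀ x ∈ Z, f x ∈ Z') (hC : ∀ x ∈ Z, x ∈ C → f x ∈ C') :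
    Z ⧸ C.addSubgroupOf Z →+ Z' ⧸ C'.addSubgroupOf Z' :=
  QuotientAddGroup.map _ _ ((f.comp Z.subtype).codRestrict Z' fun x => hZ x x.2)
    fun x hx => AddSubgroup.mem_addSubgroupOf.2 (hC x x.2 (AddSubgroup.mem_addSubgroupOf.1 hx))

theorem exact_subquotientMap {Z C : AddSubgroup G} {Z' C' : AddSubgroup H} {Z'' C'' : AddSubgroup L}
    {f : G →+ H} {g : H →+ L} {hZ : ∀ x ∈ Z, f x ∈ Z'} {hC : ∀ x ∈ Z, x ∈ C → f x ∈ C'}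
    {hZ' : ∀ x ∈ Z', g x ∈ Z''} {hC' : ∀ x ∈ Z', x ∈ C' → g x ∈ C''}
    (h1 : ∀ x ∈ Z, g (f x) ∈ C'') (h2 : ∀ y ∈ Z', g y ∈ C'' → ∃ x ∈ Z, f x - y ∈ C') :
    Function.Exact (subquotientMap Z C Z' C' f hZ hC) (subquotientMap Z' C' Z'' C'' g hZ' hC') := by
  intro y
  induction y using QuotientAddGroup.induction_on with
  | H y =>
    constructor
    · intro hy
      obtain ⟨x, hx, hxy⟩ := h2 y y.2 (mk_eq_zero_iff.1 hy)
      exact ⟨QuotientAddGroup.mk ⟨x, hx⟩, mk_eq_mk_of_sub_mem hxy⟩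
    · rintro ⟨x, hx⟩
      rw [← hx]
      induction x using QuotientAddGroup.induction_on with
      | H x => exact mk_eq_zero_iff.2 (h1 x x.2)

end Subquotient

/-! ### The long exact sequence -/

section LongExact

variable {K I V : Type*} [CommRing K] [Algebra ℚ K] [TopologicalSpace K] [DiscreteTopology K]
  {𝒜 : ℤ → AddSubgroup K} [GradedRing 𝒜] {d : I → ℤ} [AddCommGroup V] [Module K V]
  {b : Module.Basis I K V} {M : CInftyStructure 𝒜 d} {e : I}

theorem mem_drCocycles {p : ℕ} {N : ℤ} {x : List (I ⊕ I) × List (I ⊕ I) → K} :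
    x ∈ M.drCocycles p N ↔ x ∈ drCochains 𝒜 d p N ∧ M.lieDR x ∈ lieRel K (fdeg d) := Iff.rfl

theorem mem_drCoboundaries_of {p : ℕ} {N k : ℤ} (hN : N = k + 1)
    {x y : List (I ⊕ I) × List (I ⊕ I) → K} (hy : y ∈ drCochains 𝒜 d p k)
    (h : x - M.lieDR y ∈ lieRel K (fdeg d)) : x ∈ M.drCoboundaries p N := by
  rw [CInftyStructure.drCoboundaries, AddSubgroup.mem_sup]
  refine ⟨M.lieDR y, ⟨y, ?_, rfl⟩, _, h, add_sub_cancel _ _⟩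
  rwa [hN, add_sub_cancel_right]

theorem exists_of_mem_drCoboundaries {p : ℕ} {N k : ℤ} (hN : N = k + 1)
    {x : List (I ⊕ I) × List (I ⊕ I) → K} (h : x ∈ M.drCoboundaries p N) :
    ∃ y ∈ drCochains 𝒜 d p k, x - M.lieDR y ∈ lieRel K (fdeg d) := by
  rw [CInftyStructure.drCoboundaries, AddSubgroup.mem_sup] at h
  obtain ⟨_, ⟨y, hy, rfl⟩, r, hr, rfl⟩ := h
  rw [hN, add_sub_cancel_right] at hy
  refine ⟨y, hy, ?_⟩
  have h : M.lieDR y + r - M.lieDR y = r := add_sub_cancel_left _ _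
  exact h.symm ▸ hr

theorem mem_dualCocycles {n : ℤ} {φ : Module.Dual K V} : φ ∈ M.dualCocycles b n ↔
    φ ∈ dualCochains 𝒜 d b n ∧ (M.linearPart b).dualMap φ = 0 := Iff.rfl

theorem lieDR_mem_lieRel_of_sub (h_even : ∀ n : ℤ, Odd n → 𝒜 n = ⊥)
    {x y : List (I ⊕ I) × List (I ⊕ I) → K} (h : x - y ∈ lieRel K (fdeg d))
    (hy : M.lieDR y ∈ lieRel K (fdeg d)) : M.lieDR x ∈ lieRel K (fdeg d) := by
  have := lieDR_mem_lieRel (M := M) h_even h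
  rw [map_sub] at this
  exact mem_lieRel_of_sub this hy

/-- A zero-form is a cocycle as soon as its de Rham differential is one. -/
theorem mem_drCocycles_of_dDR (h_even : ∀ n : ℤ, Odd n → 𝒜 n = ⊥) {N : ℤ}
    {c : List (I ⊕ I) × List (I ⊕ I) → K} (hc : c ∈ drCochains 𝒜 d 0 N)
    (h : M.lieDR (dDR K d c) ∈ lieRel K (fdeg d)) : c ∈ M.drCocycles 0 N := by
  have hl := lieDR_mem_drCochains (M := M) h_even hc
  refine mem_drCocycles.2 ⟨hc, mem_lieRel_of_dDR_mem hl.1 (mem_bihomog_iff.1 hl.2).1 ?_⟩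
  rw [dDR_lieDR h_even]
  exact neg_mem h

/-! #### The map induced by the de Rham differential -/

theorem dDR_mem_drCocycles (h_even : ∀ n : ℤ, Odd n → 𝒜 n = ⊥) {N : ℤ}
    {c : List (I ⊕ I) × List (I ⊕ I) → K} (hc : c ∈ M.drCocycles 0 N) :
    dDR K d c ∈ M.drCocycles 1 (N + 1) := by
  refine mem_drCocycles.2 ⟨dDR_mem_drCochains (mem_drCocycles.1 hc).1, ?_⟩
  have := dDR_mem_lieRel (mem_drCocycles.1 hc).2
  rw [dDR_lieDR h_even] at this
  exact neg_mem_iff.1 this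

theorem dDR_mem_drCoboundaries (h_even : ∀ n : ℤ, Odd n → 𝒜 n = ⊥) {N : ℤ}
    {c : List (I ⊕ I) × List (I ⊕ I) → K} (hc : c ∈ M.drCoboundaries 0 N) :
    dDR K d c ∈ M.drCoboundaries 1 (N + 1) := by
  obtain ⟨E, hE, h⟩ := exists_of_mem_drCoboundaries (k := N - 1) (by ring) hc
  refine mem_drCoboundaries_of (k := N - 1 + 1) (by ring) (neg_mem (dDR_mem_drCochains hE)) ?_
  have := dDR_mem_lieRel h
  rwa [map_sub, dDR_lieDR h_even, ← map_neg] at this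

/-! #### The map `B` -/

theorem moment_der_eq_zero (h_even : ∀ n : ℤ, Odd n → 𝒜 n = ⊥) {x : List (I ⊕ I) × List (I ⊕ I) → K}
    (hx : x ∈ normalSub K d) (h : M.lieDR x ∈ lieRel K (fdeg d)) : M.der (moment d x) = 0 := by
  have := moment_lieDR M h_even hx
  rw [moment_eq_zero h] at this
  exact neg_eq_zero.1 this.symm

variable (b e) in
/-- The map `B` on cocycles. -/
def mapB (d : I → ℤ) : (List (I ⊕ I) × List (I ⊕ I) → K) →ₗ[K] Module.Dual K V :=
  -(unitFunctional b e ∘ₗ moment d)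

theorem mapB_apply (x : List (I ⊕ I) × List (I ⊕ I) → K) :
    mapB b e d x = -unitFunctional b e (moment d x) := rfl

theorem mapB_mem_dualCocycles (h_even : ∀ n : ℤ, Odd n → 𝒜 n = ⊥) (he : M.IsUnital e) {n : ℤ}
    {x : List (I ⊕ I) × List (I ⊕ I) → K} (hx : x ∈ M.drCocycles 1 (n + 3)) :
    mapB b e d x ∈ M.dualCocycles b n := by
  obtain ⟨hx, hc⟩ := mem_drCocycles.1 hx
  have hN := mem_normalSub_of_mem_drCochains hx
  have hm : moment d x ∈ homog 𝒜 (tdeg d) (n + 2) := by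
    refine moment_mem_homog_of_mem ?_
    rwa [add_assoc]
  refine mem_dualCocycles.2 ⟨neg_mem (unitFunctional_mem he hm), ?_⟩
  have := unitFunctional_der (b := b) he (moment d x)
  rw [moment_der_eq_zero h_even hN hc, map_zero, linFunctional_moment hN, zero_sub] at this
  rw [mapB_apply, map_neg, ← this]

theorem mapB_mem_coboundaries (h_even : ∀ n : ℤ, Odd n → 𝒜 n = ⊥) (he : M.IsUnital e) {n : ℤ}
    {x : List (I ⊕ I) × List (I ⊕ I) → K} (hx : x ∈ M.drCoboundaries 1 (n + 3)) :
    mapB b e d x ∈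
      (dualCochains 𝒜 d b (n - 1)).map (M.linearPart b).dualMap.toAddMonoidHom := by
  obtain ⟨E, hE, h⟩ := exists_of_mem_drCoboundaries (k := n + 2) (by ring) hx
  have hN := mem_normalSub_of_mem_drCochains hE
  have hm : moment d E ∈ homog 𝒜 (tdeg d) (n - 1 + 2) := by
    refine moment_mem_homog_of_mem ?_
    rwa [show n - 1 + 2 + 1 = n + 2 by ring]
  refine ⟨-unitFunctional b e (moment d E), neg_mem (unitFunctional_mem he hm), ?_⟩
  change (M.linearPart b).dualMap _ = _
  rw [mapB_apply, moment_congr h, moment_lieDR M h_even hN, map_neg, map_neg,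
    unitFunctional_der he, linFunctional_moment hN, zero_sub, neg_neg]

theorem bRel_iff {x : List (I ⊕ I) × List (I ⊕ I) → K} (hx : x ∈ normalSub K d)
    {φ : Module.Dual K V} : BRel (d := d) b e x φ ↔ φ = mapB b e d x := by
  constructor
  · rintro ⟨y, hy, hφ⟩
    refine b.ext fun j => ?_
    rw [hφ j, mapB_apply, LinearMap.neg_apply, unitFunctional_apply, moment_congr hy,
      moment_oneForm]
  · rintro rfl
    obtain ⟨h1, h2⟩ := mem_normalSub.1 hx
    have hy : oneForm (fun i => (⟨coeff d i x, h2 i⟩ : freeLie K (tdeg d))) = normalForm d x :=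
      oneForm_eq _
    refine ⟨fun i => ⟨coeff d i x, h2 i⟩, by rwa [hy], fun j => ?_⟩
    rw [bracketSum_eq, mapB_apply, LinearMap.neg_apply, unitFunctional_apply]
    rfl

/-! #### The map `S` -/

variable (b M) in
/-- The one-form with moment `m (∑ i, φ (v i) t i)` that enters the construction of `S`. -/
def formS : Module.Dual K V →ₗ[K] (List (I ⊕ I) × List (I ⊕ I) → K) :=
  formOfMoment d ∘ₗ M.der ∘ₗ dualSeries b

variable (b M) in
/-- The map `S` on cocycles. -/
def mapS : Module.Dual K V →ₗ[K] (List (I ⊕ I) × List (I ⊕ I) → K) :=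
  primitive d ∘ₗ M.lieDR ∘ₗ formS b M

theorem formS_mem {n : ℤ} {φ : Module.Dual K V} (hφ : φ ∈ dualCochains 𝒜 d b n) :
    formS b M φ ∈ drCochains 𝒜 d 1 (n + 3) := by
  have := formOfMoment_mem (der_mem_homog M (dualSeries_mem_homog hφ))
  rwa [show n + 1 + 1 + 1 = n + 3 by ring] at this

theorem moment_formS (h_even : ∀ n : ℤ, Odd n → 𝒜 n = ⊥) {n : ℤ} {φ : Module.Dual K V}
    (hφ : φ ∈ M.dualCocycles b n) : moment d (formS b M φ) = M.der (dualSeries b φ) := by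
  refine moment_formOfMoment (b := b) (der_mem_freeLie M h_even (dualSeries_mem_freeLie φ)) ?_
  change linFunctional b (M.der (dualSeries b φ)) = 0
  rw [linFunctional_der, linFunctional_dualSeries, (mem_dualCocycles.1 hφ).2]

theorem lieDR_formS_sub_mem (h_even : ∀ n : ℤ, Odd n → 𝒜 n = ⊥) {n : ℤ} {φ : Module.Dual K V}
    (hφ : φ ∈ M.dualCocycles b n) :
    M.lieDR (formS b M φ) - dDR K d (mapS b M φ) ∈ lieRel K (fdeg d) := by
  have hα := formS_mem (M := M) (mem_dualCocycles.1 hφ).1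
  refine sub_dDR_primitive_mem (mem_normalSub_of_mem_drCochains
    (lieDR_mem_drCochains (M := M) h_even hα)) ?_
  rw [moment_lieDR M h_even (mem_normalSub_of_mem_drCochains hα), moment_formS h_even hφ,
    der_der M h_even (dualSeries_mem_freeLie φ), neg_zero]

theorem mapS_mem (h_even : ∀ n : ℤ, Odd n → 𝒜 n = ⊥) {n : ℤ} {φ : Module.Dual K V}
    (hφ : φ ∈ M.dualCocycles b n) : mapS b M φ ∈ M.drCocycles 0 (n + 3) := by
  have hα := formS_mem (M := M) (mem_dualCocycles.1 hφ).1
  refine mem_drCocycles_of_dDR h_even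
    (primitive_mem_drCochains (lieDR_mem_drCochains h_even hα)) ?_
  have h := neg_mem (lieDR_formS_sub_mem h_even hφ)
  rw [neg_sub] at h
  refine lieDR_mem_lieRel_of_sub h_even h ?_
  rw [lieDR_lieDR h_even]
  exact zero_mem _

/-- The class of `S φ` is determined by any one-form `α` with moment `m (∑ i, φ (v i) t i)` and any
solution `c` of `d c = L_m α`. -/
theorem sub_mapS_mem (h_even : ∀ n : ℤ, Odd n → 𝒜 n = ⊥) {n : ℤ} {φ : Module.Dual K V}
    (hφ : φ ∈ M.dualCocycles b n) {α c : List (I ⊕ I) × List (I ⊕ I) → K}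
    (hα : α ∈ lieTensor K (fdeg d)) (hα' : α ∈ tensorHomog (zeroSub K) formWt (1 : ℕ))
    (hm : moment d α = M.der (dualSeries b φ)) (hc : c ∈ drCochains 𝒜 d 0 (n + 3))
    (h : dDR K d c - M.lieDR α ∈ lieRel K (fdeg d)) :
    c - mapS b M φ ∈ M.drCoboundaries 0 (n + 3) := by
  have hS := formS_mem (M := M) (mem_dualCocycles.1 hφ).1
  have hcS := (mem_drCocycles.1 (mapS_mem h_even hφ)).1
  -- The two one-forms have the same moment, hence differ by an exact form.
  have hβ : α - formS b M φ ∈ normalSub K d := mem_normalSub_of_formDeg_one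
    (sub_mem hα hS.1) (sub_mem hα' (mem_bihomog_iff.1 hS.2).1)
  set E := primitive d (α - formS b M φ) with hE
  have hET : E ∈ lieTensor K (fdeg d) := primitive_mem_lieTensor hβ
  have hE0 : E ∈ tensorHomog (zeroSub K) formWt (0 : ℕ) := primitive_mem_formWt _
  have hEr : α - formS b M φ - dDR K d E ∈ lieRel K (fdeg d) :=
    sub_dDR_primitive_mem hβ (by rw [map_sub, hm, moment_formS h_even hφ, sub_self])
  have hD := sub_mem hc hcS
  have hrel : c - mapS b M φ + M.lieDR E ∈ lieRel K (fdeg d) := by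
    refine mem_lieRel_of_dDR_mem (add_mem hD.1 (lieDR_mem_lieTensor h_even hET))
      (add_mem (mem_bihomog_iff.1 hD.2).1 ?_) ?_
    · have := tensorOdd_mem_tensorHomog (deg := fdeg d) (D := M.lieDer) (s := 0) (fun k f hf =>
        oddDer_mem_homog (deg := fdeg d) zeroSub_isMul (lieDerOn_mem_formWt M) hf) hE0
      rwa [add_zero] at this
    · have h3 := lieDR_mem_lieRel (M := M) h_even hEr
      rw [map_sub, map_sub] at h3
      have h4 := add_mem (add_mem h (lieDR_formS_sub_mem h_even hφ)) h3
      rw [map_add, map_sub, dDR_lieDR h_even]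
      convert h4 using 1
      abel
  -- `E` need not be homogeneous, but only its component of the right degree matters.
  have h5 := tensorComponent_mem_lieRel (𝒜 := 𝒜) (n + 3) hrel
  have h6 : tensorComponent 𝒜 (fdeg d) (n + 3) (M.lieDR E) =
      M.lieDR (tensorComponent 𝒜 (fdeg d) (n + 2) E) := by
    have := tensorComponent_tensorOdd (deg := fdeg d) (lieDerOn_mem_homog M) (n + 2) E
    rwa [add_assoc] at this
  rw [map_add, tensorComponent_eq_self (mem_bihomog_iff.1 hD.2).2, h6] at h5
  have hEc : tensorComponent 𝒜 (fdeg d) (n + 2) E ∈ drCochains 𝒜 d 0 (n + 2) := by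
    refine ⟨tensorComponent_mem_lieTensor _ hET, mem_bihomog_iff.2
      ⟨fun p => mem_zeroSub.2 fun hp => ?_, tensorComponent_mem_tensorHomog _ _⟩⟩
    rw [tensorComponent_apply, mem_zeroSub.1 (hE0 p) hp, map_zero]
  refine mem_drCoboundaries_of (k := n + 2) (by ring) (neg_mem hEc) ?_
  rwa [map_neg, sub_neg_eq_add]

/-- If the moment of a closed one-form is `m (∑ i, φ (v i) t i)`, then `S φ` is exact. -/
theorem mapS_mem_coboundaries (h_even : ∀ n : ℤ, Odd n → 𝒜 n = ⊥) {n : ℤ} {φ : Module.Dual K V}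
    (hφ : φ ∈ M.dualCocycles b n) {α : List (I ⊕ I) × List (I ⊕ I) → K}
    (hα : α ∈ drCochains 𝒜 d 1 (n + 3)) (hm : moment d α = M.der (dualSeries b φ))
    (h : M.lieDR α ∈ lieRel K (fdeg d)) : mapS b M φ ∈ M.drCoboundaries 0 (n + 3) := by
  have := sub_mapS_mem h_even hφ hα.1 (mem_bihomog_iff.1 hα.2).1 hm (c := 0) (zero_mem _)
    (by rw [map_zero, zero_sub]; exact neg_mem h)
  rw [zero_sub] at this
  exact neg_mem_iff.1 this

/-- The map `S` sends coboundaries to coboundaries. -/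
theorem mapS_dualMap_mem (h_even : ∀ n : ℤ, Odd n → 𝒜 n = ⊥) {n : ℤ} {φ : Module.Dual K V}
    (hφ : φ ∈ M.dualCocycles b n)
    (h : φ ∈ (dualCochains 𝒜 d b (n - 1)).map (M.linearPart b).dualMap.toAddMonoidHom) :
    mapS b M φ ∈ M.drCoboundaries 0 (n + 3) := by
  obtain ⟨ψ, hψ, rfl⟩ := h
  change mapS b M ((M.linearPart b).dualMap ψ) ∈ _
  change (M.linearPart b).dualMap ψ ∈ _ at hφ
  -- With `u` the difference of `w` and the `m`-image of the series of `ψ`, one has `m u = m w`.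
  set u := dualSeries b ((M.linearPart b).dualMap ψ) - M.der (dualSeries b ψ) with hu
  have hL : u ∈ freeLie K (tdeg d) := sub_mem (dualSeries_mem_freeLie _)
    (der_mem_freeLie M h_even (dualSeries_mem_freeLie _))
  have hn : u ∈ homog 𝒜 (tdeg d) (n + 1) := by
    have h1 := der_mem_homog M (dualSeries_mem_homog hψ)
    rw [sub_add_cancel] at h1
    exact sub_mem (dualSeries_mem_homog (mem_dualCocycles.1 hφ).1) h1
  have hl : linFunctional b u = 0 := by
    rw [hu, map_sub, linFunctional_der, linFunctional_dualSeries, linFunctional_dualSeries,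
      sub_self]
  have hβ := formOfMoment_mem (d := d) hn
  refine mapS_mem_coboundaries h_even hφ (α := -M.lieDR (formOfMoment d u)) ?_ ?_ ?_
  · have := lieDR_mem_drCochains (M := M) h_even hβ
    rw [show n + 1 + 1 + 1 = n + 3 by ring] at this
    exact neg_mem this
  · rw [map_neg, moment_lieDR M h_even (mem_normalSub_of_mem_drCochains hβ),
      moment_formOfMoment hL hl, neg_neg, hu, map_sub, der_der M h_even (dualSeries_mem_freeLie _),
      sub_zero]
  · rw [map_neg, lieDR_lieDR h_even, neg_zero]
    exact zero_mem _

theorem sRel_mapS (h_even : ∀ n : ℤ, Odd n → 𝒜 n = ⊥) {n : ℤ} {φ : Module.Dual K V}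
    (hφ : φ ∈ M.dualCocycles b n) : M.SRel b φ (mapS b M φ) := by
  set z := M.der (dualSeries b φ) with hz
  let y : I → freeLie K (tdeg d) := fun i => ⟨lieTails (tdeg d) z i, lieTails_mem_freeLie z i⟩
  have hy : oneForm y = formS b M φ := oneForm_eq _
  refine ⟨⟨dualSeries b φ, dualSeries_mem_freeLie φ⟩, y, dualSeries_eq_finsum φ, ?_, ?_⟩
  · rw [← moment_oneForm, hy, moment_formS h_even hφ, der_eq M h_even]
  · have := neg_mem (lieDR_formS_sub_mem h_even hφ)
    rwa [neg_sub, ← hy] at this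

theorem sub_mapS_mem_of_sRel (h_even : ∀ n : ℤ, Odd n → 𝒜 n = ⊥) {n : ℤ} {φ : Module.Dual K V}
    (hφ : φ ∈ M.dualCocycles b n) {c : List (I ⊕ I) × List (I ⊕ I) → K}
    (hc : c ∈ drCochains 𝒜 d 0 (n + 3)) (h : M.SRel b φ c) :
    c - mapS b M φ ∈ M.drCoboundaries 0 (n + 3) := by
  obtain ⟨w, y, hw, hy, h⟩ := h
  refine sub_mapS_mem h_even hφ (oneForm_mem_lieTensor y) (oneForm_mem_formWt y) ?_ hc h
  have : (w : List I → K) = dualSeries b φ := by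
    funext u
    rw [hw, dualSeries_eq_finsum]
  rw [moment_oneForm, hy, der_eq M h_even, this]

/-! #### Exactness -/

/-- With `m u` the moment of the cocycle `x`, the map `B` sends `x` to minus the linear part of
`u`, up to a coboundary. A one-form that corrects `-x` for the nonlinear part of `u` and for the
coboundary is a closed form that computes `S (B x)`. -/
theorem mapS_mapB_mem (h_even : ∀ n : ℤ, Odd n → 𝒜 n = ⊥) (he : M.IsUnital e) {n : ℤ}
    {x : List (I ⊕ I) × List (I ⊕ I) → K} (hx : x ∈ M.drCocycles 1 (n + 3)) :
    mapS b M (mapB b e d x) ∈ M.drCoboundaries 0 (n + 3) := by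
  have hφ := mapB_mem_dualCocycles (b := b) h_even he hx
  obtain ⟨hx, hc⟩ := mem_drCocycles.1 hx
  have hN := mem_normalSub_of_mem_drCochains hx
  have hm : moment d x ∈ homog 𝒜 (tdeg d) (n + 2) := by
    refine moment_mem_homog_of_mem ?_
    rwa [add_assoc]
  obtain ⟨u, huL, hun, hu⟩ := exists_der_eq h_even he (moment_mem_freeLie hN) hm
    (moment_der_eq_zero h_even hN hc)
  rw [show n + 2 - 1 = n + 1 by ring] at hun
  have hB : mapB b e d x =
      (M.linearPart b).dualMap (unitFunctional b e u) - linFunctional b u := by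
    rw [mapB_apply, ← hu, unitFunctional_der he, neg_sub]
  have hψ : unitFunctional b e u ∈ dualCochains 𝒜 d b (n - 1) := by
    refine unitFunctional_mem he ?_
    rwa [show n - 1 + 2 = n + 1 by ring]
  set φ := mapB b e d x with hφ_def
  -- `v` is `-u` with its linear part removed, up to the coboundary in the formula for `B x`.
  set ψ := unitFunctional b e u
  set v := M.der (dualSeries b ψ) - u - dualSeries b φ with hv
  have hvL : v ∈ freeLie K (tdeg d) := sub_mem (sub_mem
    (der_mem_freeLie M h_even (dualSeries_mem_freeLie _)) huL) (dualSeries_mem_freeLie _)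
  have hvn : v ∈ homog 𝒜 (tdeg d) (n + 1) := by
    have h1 := der_mem_homog M (dualSeries_mem_homog hψ)
    rw [sub_add_cancel] at h1
    exact sub_mem (sub_mem h1 hun) (dualSeries_mem_homog (mem_dualCocycles.1 hφ).1)
  have hvl : linFunctional b v = 0 := by
    rw [hv, map_sub, map_sub, linFunctional_der, linFunctional_dualSeries,
      linFunctional_dualSeries, hB, sub_self]
  have hβ := formOfMoment_mem (d := d) hvn
  have hβ' := lieDR_mem_drCochains (M := M) h_even hβ
  rw [show n + 1 + 1 + 1 = n + 3 by ring] at hβ'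
  refine mapS_mem_coboundaries h_even hφ (α := M.lieDR (formOfMoment d v) - x)
    (sub_mem hβ' hx) ?_ ?_
  · rw [map_sub, moment_lieDR M h_even (mem_normalSub_of_mem_drCochains hβ),
      moment_formOfMoment hvL hvl, hv, map_sub, map_sub, hu,
      der_der M h_even (dualSeries_mem_freeLie _)]
    abel
  · rw [map_sub, lieDR_lieDR h_even, zero_sub]
    exact neg_mem hc

/-- If `S φ` is exact, then the one-form that computes it can be corrected to a cocycle by an exact
form, which does not change the moment `m (∑ i, φ (v i) t i)`. -/
theorem exists_mapB_eq (h_even : ∀ n : ℤ, Odd n → 𝒜 n = ⊥) (he : M.IsUnital e) {n : ℤ}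
    {φ : Module.Dual K V} (hφ : φ ∈ M.dualCocycles b n)
    (h : mapS b M φ ∈ M.drCoboundaries 0 (n + 3)) :
    ∃ x ∈ M.drCocycles 1 (n + 3), mapB b e d x = φ := by
  obtain ⟨E, hE, h⟩ := exists_of_mem_drCoboundaries (k := n + 2) (by ring) h
  have hα := formS_mem (M := M) (mem_dualCocycles.1 hφ).1
  have hd := dDR_mem_drCochains hE
  rw [add_assoc] at hd
  -- The sign matches the one in the definition of `B`.
  refine ⟨-(formS b M φ + dDR K d E), mem_drCocycles.2 ⟨neg_mem (add_mem hα hd), ?_⟩, ?_⟩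
  · have h1 := add_mem (lieDR_formS_sub_mem h_even hφ) (dDR_mem_lieRel h)
    rw [map_sub, dDR_lieDR h_even] at h1
    rw [map_neg, map_add]
    refine neg_mem ?_
    convert h1 using 1
    abel
  · rw [mapB_apply, map_neg, map_add, moment_dDR hE.1 (mem_bihomog_iff.1 hE.2).1, add_zero,
      moment_formS h_even hφ, map_neg, neg_neg, unitFunctional_der he, linFunctional_dualSeries,
      unitFunctional_dualSeries, map_zero, sub_zero]

theorem dDR_mapS_mem (h_even : ∀ n : ℤ, Odd n → 𝒜 n = ⊥) {n : ℤ} {φ : Module.Dual K V}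
    (hφ : φ ∈ M.dualCocycles b n) : dDR K d (mapS b M φ) ∈ M.drCoboundaries 1 (n + 4) := by
  refine mem_drCoboundaries_of (k := n + 3) (by ring)
    (formS_mem (M := M) (mem_dualCocycles.1 hφ).1) ?_
  have := neg_mem (lieDR_formS_sub_mem h_even hφ)
  rwa [neg_sub] at this

/-- If `d c = L_m α`, then the moment of `α` is closed, hence `m u` for some `u`; the linear part
of `u` is a cocycle whose image under `S` is the class of `c`. -/
theorem exists_mapS_sub_mem (h_even : ∀ n : ℤ, Odd n → 𝒜 n = ⊥) (he : M.IsUnital e) {n : ℤ}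
    {c : List (I ⊕ I) × List (I ⊕ I) → K} (hc : c ∈ drCochains 𝒜 d 0 (n + 3))
    (h : dDR K d c ∈ M.drCoboundaries 1 (n + 4)) :
    ∃ φ ∈ M.dualCocycles b n, mapS b M φ - c ∈ M.drCoboundaries 0 (n + 3) := by
  obtain ⟨α, hα, h⟩ := exists_of_mem_drCoboundaries (k := n + 3) (by ring) h
  have hN := mem_normalSub_of_mem_drCochains hα
  have hm : moment d α ∈ homog 𝒜 (tdeg d) (n + 2) := by
    refine moment_mem_homog_of_mem ?_
    rwa [add_assoc]
  have h0 : M.der (moment d α) = 0 := by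
    have h1 := moment_congr h
    rw [moment_dDR hc.1 (mem_bihomog_iff.1 hc.2).1, moment_lieDR M h_even hN] at h1
    exact neg_eq_zero.1 h1.symm
  obtain ⟨u, huL, hun, hu⟩ := exists_der_eq h_even he (moment_mem_freeLie hN) hm h0
  rw [show n + 2 - 1 = n + 1 by ring] at hun
  -- A moment has no linear part, so that the linear part of `u` is closed.
  have hφ : linFunctional b u ∈ M.dualCocycles b n := by
    refine mem_dualCocycles.2 ⟨linFunctional_mem hun, ?_⟩
    rw [← linFunctional_der, hu, linFunctional_moment hN]
  refine ⟨_, hφ, ?_⟩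
  set φ := linFunctional b u with hφ_def
  have hvL := sub_mem huL (dualSeries_mem_freeLie (d := d) (b := b) φ)
  have hvn := sub_mem hun (dualSeries_mem_homog (mem_dualCocycles.1 hφ).1)
  have hvl : linFunctional b (u - dualSeries b φ) = 0 := by
    rw [map_sub, linFunctional_dualSeries, sub_self]
  have hβ := formOfMoment_mem (d := d) hvn
  have hβ' := lieDR_mem_drCochains (M := M) h_even hβ
  rw [show n + 1 + 1 + 1 = n + 3 by ring] at hβ'
  have hα' := add_mem hα hβ'
  have := sub_mapS_mem h_even hφ hα'.1 (mem_bihomog_iff.1 hα'.2).1 (c := c) ?_ hc ?_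
  · have := neg_mem this
    rwa [neg_sub] at this
  · rw [map_add, moment_lieDR M h_even (mem_normalSub_of_mem_drCochains hβ),
      moment_formOfMoment hvL hvl, map_sub, hu]
    abel
  · rwa [map_add, lieDR_lieDR h_even, add_zero]

theorem mapB_dDR {N : ℤ} {c : List (I ⊕ I) × List (I ⊕ I) → K}
    (hc : c ∈ drCochains 𝒜 d 0 N) : mapB b e d (dDR K d c) = 0 := by
  rw [mapB_apply, moment_dDR hc.1 (mem_bihomog_iff.1 hc.2).1, map_zero, neg_zero]

/-- If `B x` is exact, then the moment of `x` is `m v` with `v` without linear part; then `v` is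
itself a moment, and `x` can be corrected by a coboundary to a form of vanishing moment, which is
exact. -/
theorem exists_dDR_sub_mem (h_even : ∀ n : ℤ, Odd n → 𝒜 n = ⊥) (he : M.IsUnital e) {n : ℤ}
    {x : List (I ⊕ I) × List (I ⊕ I) → K} (hx : x ∈ M.drCocycles 1 (n + 3))
    (h : mapB b e d x ∈
      (dualCochains 𝒜 d b (n - 1)).map (M.linearPart b).dualMap.toAddMonoidHom) :
    ∃ c ∈ M.drCocycles 0 (n + 2), dDR K d c - x ∈ M.drCoboundaries 1 (n + 3) := by
  obtain ⟨χ, hχ, hB⟩ := h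
  change (M.linearPart b).dualMap χ = _ at hB
  obtain ⟨hx, hc⟩ := mem_drCocycles.1 hx
  have hN := mem_normalSub_of_mem_drCochains hx
  have hm : moment d x ∈ homog 𝒜 (tdeg d) (n + 2) := by
    refine moment_mem_homog_of_mem ?_
    rwa [add_assoc]
  obtain ⟨u, huL, hun, hu⟩ := exists_der_eq h_even he (moment_mem_freeLie hN) hm
    (moment_der_eq_zero h_even hN hc)
  rw [show n + 2 - 1 = n + 1 by ring] at hun
  have hψ : unitFunctional b e u - χ ∈ dualCochains 𝒜 d b (n - 1) := by
    refine sub_mem (unitFunctional_mem he ?_) hχ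
    rwa [show n - 1 + 2 = n + 1 by ring]
  set ψ := unitFunctional b e u - χ with hψ_def
  -- The linear part of `u` is exact, so that `u` can be changed into a series without linear part.
  have hlin : linFunctional b u = (M.linearPart b).dualMap ψ := by
    rw [mapB_apply, ← hu, unitFunctional_der he] at hB
    rw [hψ_def, map_sub, hB]
    abel
  set v := u - M.der (dualSeries b ψ) with hv
  have hvL : v ∈ freeLie K (tdeg d) :=
    sub_mem huL (der_mem_freeLie M h_even (dualSeries_mem_freeLie _))
  have hvn : v ∈ homog 𝒜 (tdeg d) (n + 1) := by
    have h1 := der_mem_homog M (dualSeries_mem_homog hψ)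
    rw [sub_add_cancel] at h1
    exact sub_mem hun h1
  have hvl : linFunctional b v = 0 := by
    rw [hv, map_sub, linFunctional_der, linFunctional_dualSeries, hlin, sub_self]
  have hβ := formOfMoment_mem (d := d) hvn
  rw [show n + 1 + 1 = n + 2 by ring] at hβ
  have hβ' := lieDR_mem_drCochains (M := M) h_even hβ
  rw [add_assoc] at hβ'
  set β := formOfMoment d v
  have hxβ := add_mem hx hβ'
  -- The one-form `β` has moment `v`, and `m v = m u` is the moment of `x`.
  have h0 : moment d (x + M.lieDR β) = 0 := by
    rw [map_add, moment_lieDR M h_even (mem_normalSub_of_mem_drCochains hβ),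
      moment_formOfMoment hvL hvl, hv, map_sub, hu, der_der M h_even (dualSeries_mem_freeLie _)]
    abel
  have hr := sub_dDR_primitive_mem (mem_normalSub_of_mem_drCochains hxβ) h0
  have hr' := neg_mem hr
  rw [neg_sub] at hr'
  refine ⟨primitive d (x + M.lieDR β), mem_drCocycles_of_dDR h_even
    (primitive_mem_drCochains ?_) ?_, mem_drCoboundaries_of (k := n + 2) (by ring) hβ ?_⟩
  · rwa [add_assoc]
  · refine lieDR_mem_lieRel_of_sub h_even hr' ?_
    rwa [map_add, lieDR_lieDR h_even, add_zero]
  · convert hr' using 1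
    abel

end LongExact

end

end CInf

theorem mainTheorem8 {K I V : Type*} [CommRing K] [Algebra ℚ K]
    [TopologicalSpace K] [DiscreteTopology K]
    (𝒜 : ℤ → AddSubgroup K) [GradedRing 𝒜] (h_even : ∀ n : ℤ, Odd n → 𝒜 n = ⊥)
    [AddCommGroup V] [Module K V] (b : Module.Basis I K V) (d : I → ℤ)
    (M : CInf.CInftyStructure 𝒜 d) (e : I) (he : M.IsUnital e) :
    ∃ (S : ∀ n : ℤ, M.HDual b n →+ M.HCHarr (n + 2))
      (J : ∀ n : ℤ, M.HCHarr n →+ M.HHarr n)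
      (B : ∀ n : ℤ, M.HHarr (n + 1) →+ M.HDual b n),
      (∀ n : ℤ, Function.Exact (B n) (S n)) ∧
      (∀ n : ℤ, Function.Exact (S n) (J (n + 2))) ∧
      (∀ n : ℤ, Function.Exact (J (n + 1)) (B n)) ∧
      (∀ (n : ℤ) (c : M.cyclicCocycles n), ∃ h : CInf.dDR K d c ∈ M.harrCocycles n,
        J n (QuotientAddGroup.mk c) = QuotientAddGroup.mk ⟨CInf.dDR K d c, h⟩) ∧
      (∀ (n : ℤ) (x : M.harrCocycles (n + 1)),
        (∃ φ : M.dualCocycles b n, CInf.BRel (d := d) b e x φ) ∧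
        ∀ φ : M.dualCocycles b n, CInf.BRel (d := d) b e x φ →
          B n (QuotientAddGroup.mk x) = QuotientAddGroup.mk φ) ∧
      (∀ (n : ℤ) (φ : M.dualCocycles b n),
        (∃ c : M.cyclicCocycles (n + 2), M.SRel b φ c) ∧
        ∀ c : M.cyclicCocycles (n + 2), M.SRel b φ c →
          S n (QuotientAddGroup.mk φ) = QuotientAddGroup.mk c) := by
  have h3 : ∀ n : ℤ, n + 2 + 1 = n + 3 := fun n => by ring
  have h4 : ∀ n : ℤ, n + 2 + 2 = n + 4 := fun n => by ring
  have h3' : ∀ n : ℤ, n + 1 + 2 = n + 3 := fun n => by ring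
  have h2 : ∀ n : ℤ, n + 1 + 1 = n + 2 := fun n => by ring
  -- The three maps on cocycles and coboundaries, in the degrees of the statement.
  have S1 : ∀ n : ℤ, ∀ φ ∈ M.dualCocycles b n,
      CInf.mapS b M φ ∈ M.cyclicCocycles (n + 2) := by
    intro n φ hφ
    rw [CInf.CInftyStructure.cyclicCocycles, h3]
    exact CInf.mapS_mem h_even hφ
  have S2 : ∀ n : ℤ, ∀ φ ∈ M.dualCocycles b n,
      φ ∈ (CInf.dualCochains 𝒜 d b (n - 1)).map (M.linearPart b).dualMap.toAddMonoidHom →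
        CInf.mapS b M φ ∈ M.drCoboundaries 0 (n + 2 + 1) := by
    intro n φ hφ h
    rw [h3]
    exact CInf.mapS_dualMap_mem h_even hφ h
  have J1 : ∀ n : ℤ, ∀ c ∈ M.cyclicCocycles n, CInf.dDR K d c ∈ M.harrCocycles n := by
    intro n c hc
    rw [CInf.CInftyStructure.harrCocycles, ← h2]
    exact CInf.dDR_mem_drCocycles h_even hc
  have J2 : ∀ n : ℤ, ∀ c ∈ M.cyclicCocycles n, c ∈ M.drCoboundaries 0 (n + 1) →
      CInf.dDR K d c ∈ M.drCoboundaries 1 (n + 2) := by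
    intro n c _ hc
    rw [← h2]
    exact CInf.dDR_mem_drCoboundaries h_even hc
  have B1 : ∀ n : ℤ, ∀ x ∈ M.harrCocycles (n + 1), CInf.mapB b e d x ∈ M.dualCocycles b n := by
    intro n x hx
    rw [CInf.CInftyStructure.harrCocycles, h3'] at hx
    exact CInf.mapB_mem_dualCocycles h_even he hx
  have B2 : ∀ n : ℤ, ∀ x ∈ M.harrCocycles (n + 1), x ∈ M.drCoboundaries 1 (n + 1 + 2) →
      CInf.mapB b e d x ∈
        (CInf.dualCochains 𝒜 d b (n - 1)).map (M.linearPart b).dualMap.toAddMonoidHom := by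
    intro n x _ hx
    rw [h3'] at hx
    exact CInf.mapB_mem_coboundaries h_even he hx
  refine ⟨fun n => CInf.subquotientMap _ _ _ _ (CInf.mapS b M).toAddMonoidHom (S1 n) (S2 n),
    fun n => CInf.subquotientMap _ _ _ _ (CInf.dDR K d).toAddMonoidHom (J1 n) (J2 n),
    fun n => CInf.subquotientMap _ _ _ _ (CInf.mapB b e d).toAddMonoidHom (B1 n) (B2 n),
    fun n => CInf.exact_subquotientMap (fun x hx => ?_) (fun φ hφ h => ?_),
    fun n => CInf.exact_subquotientMap (fun φ hφ => ?_) (fun c hc h => ?_),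
    fun n => CInf.exact_subquotientMap (fun c hc => ?_) (fun x hx h => ?_),
    fun n c => ⟨J1 n c c.2, rfl⟩, fun n x => ?_, fun n φ => ⟨⟨⟨_, S1 n φ φ.2⟩,
      CInf.sRel_mapS h_even φ.2⟩, fun c hc => ?_⟩⟩
  · rw [CInf.CInftyStructure.harrCocycles, h3'] at hx
    rw [h3]
    exact CInf.mapS_mapB_mem h_even he hx
  · rw [h3] at h
    obtain ⟨x, hx, hxφ⟩ := CInf.exists_mapB_eq h_even he hφ h
    refine ⟨x, ?_, ?_⟩
    · rwa [CInf.CInftyStructure.harrCocycles, h3']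
    · change CInf.mapB b e d x - φ ∈ _
      rw [hxφ, sub_self]
      exact zero_mem _
  · rw [h4]
    exact CInf.dDR_mapS_mem h_even hφ
  · rw [CInf.CInftyStructure.cyclicCocycles, h3] at hc
    rw [h4] at h
    rw [h3]
    exact CInf.exists_mapS_sub_mem h_even he (CInf.mem_drCocycles.1 hc).1 h
  · change CInf.mapB b e d (CInf.dDR K d c) ∈ _
    rw [CInf.mapB_dDR (CInf.mem_drCocycles.1 hc).1]
    exact zero_mem _
  · rw [CInf.CInftyStructure.harrCocycles, h3'] at hx
    rw [CInf.CInftyStructure.cyclicCocycles, h2, h3']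
    exact CInf.exists_dDR_sub_mem h_even he hx h
  · have hN := CInf.mem_normalSub_of_mem_drCochains (CInf.mem_drCocycles.1 x.2).1
    refine ⟨⟨⟨_, B1 n x x.2⟩, (CInf.bRel_iff hN).2 rfl⟩, fun φ hφ => ?_⟩
    refine CInf.mk_eq_mk_of_sub_mem ?_
    rw [(CInf.bRel_iff hN).1 hφ]
    change CInf.mapB b e d x - CInf.mapB b e d x ∈ _
    rw [sub_self]
    exact zero_mem _
  · refine CInf.mk_eq_mk_of_sub_mem ?_
    have hc' := (CInf.mem_drCocycles.1 c.2).1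
    rw [h3] at hc' ⊢
    have := neg_mem (CInf.sub_mapS_mem_of_sRel h_even φ.2 hc' hc)
    rwa [neg_sub] at this
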